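/- Let $d\ge 1$, let $\mathcal D\subset\mathbb R^d$ be an open set whose closure is triangulated by a finite conforming simplicial mesh $\mathcal T_h$ with faces $\mathcal F_h$, and let $p\ge 0$. Let $\mathbf V_h^p$ and $W_h^p$ be the vector fields and the functions that are complex polynomials of degree $\le p$ (componentwise) on each element, let $M_h^p$ be the functions on the faces that are polynomials of degree $\le p$ on each face, and let $\mathbf W=W_h^p\times M_h^p$. Write $(\cdot,\cdot)_{\mathcal T_h}$, $\langle\cdot,\cdot\rangle_{\partial\mathcal T_h}$ and $\langle\cdot,\cdot\rangle_{\partial\mathcal D}$ for the $L^2$ products (antilinear in the second argument) over all elements, all element boundaries, and the domain boundary. Let $\boldsymbol n$ be the outward unit normal and let $\tau>0$. Let $\boldsymbol l(w),\boldsymbol m(\mu)\in\mathbf V_h^p$ be given by $(\boldsymbol l(w),\boldsymbol r)_{\mathcal T_h}=-(w,\nabla\cdot\boldsymbol r)_{\mathcal T_h}$ and $(\boldsymbol m(\mu),\boldsymbol r)_{\mathcal T_h}=\langle\mu,\boldsymbol r\cdot\boldsymbol n\rangle_{\partial\mathcal T_h}$ for all $\boldsymbol r\in\mathbf V_h^p$.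 For $\mathbf v=(v,\eta)$ and $\mathbf w=(w,\mu)$ in $\mathbf W$ put $\boldsymbol q=\boldsymbol l(v)+\boldsymbol m(\eta)$ and $$\begin{aligned}a_h(\mathbf v,\mathbf w;(\kappa,\varrho,\nu))={}&(\kappa\boldsymbol q,\nabla w)_{\mathcal T_h}-\langle\kappa\boldsymbol q\cdot\boldsymbol n-\kappa\tau(v-\eta),w\rangle_{\partial\mathcal T_h}+(\varrho v,w)_{\mathcal T_h}\\&+\langle\kappa\boldsymbol q\cdot\boldsymbol n-\kappa\tau(v-\eta),\mu\rangle_{\partial\mathcal T_h}+\langle\nu\eta,\mu\rangle_{\partial\mathcal D},\end{aligned}$$ $$b_h(\mathbf w)=(f,w)_{\mathcal T_h}+\langle g,\mu\rangle_{\partial\mathcal D},\qquad(\mathbf v,\mathbf w)_{\mathbf W}=a_h(\mathbf v,\mathbf w;(1,1,1)),\qquad\|\mathbf w\|_{\mathbf W}=\sqrt{(\mathbf w,\mathbf w)_{\mathbf W}}.$$ Here $\varrho,f$ are complex-valued and integrable on $\mathcal D$, and $\nu,g$ are complex-valued and integrable on $\partial\mathcal D$. Let $\kappa(x,y)=\bar\kappa(x)+\sum_{q=1}^Q\psi_q(x)y_q$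 for $y\in\Lambda=\prod_{q=1}^Q[-\gamma_q,\gamma_q]$, where $\bar\kappa,\psi_q$ are real, measurable and bounded on each closed element (they may jump between elements). Write $a_h(\cdot,\cdot;y)=a_h(\cdot,\cdot;(\kappa(\cdot,y),\varrho,\nu))$, and let $\ell_h:\mathbf W\to\mathbb C$ be linear. For $y\in\Lambda$ let $\mathbf u_h(y)\in\mathbf W$ solve $a_h(\mathbf u_h(y),\mathbf w;y)=b_h(\mathbf w)$ for all $\mathbf w\in\mathbf W$, and let $s_h(y)=\operatorname{Re}\ell_h(\mathbf u_h(y))$. Let $(\zeta_n^{\rm pr})_{n\le N_{\max}}$ and $(\zeta_n^{\rm du})_{n\le N_{\max}}$ be $(\cdot,\cdot)_{\mathbf W}$-orthonormal families in $\mathbf W$, let $1\le N\le N_{\max}$, and let $\mathbf W_N^{\rm pr},\mathbf W_N^{\rm du}$ be the spans of their first $N$ members. For $y\in\Lambda$ let $\mathbf u_N(y)\in\mathbf W_N^{\rm pr}$ and $\boldsymbol\phi_N(y)\in\mathbf W_N^{\rm du}$ satisfy $a_h(\mathbf u_N(y),\mathbf w;y)=b_h(\mathbf w)$ for all $\mathbf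 w\in\mathbf W_N^{\rm pr}$ and $a_h(\mathbf w,\boldsymbol\phi_N(y);y)=-\ell_h(\mathbf w)$ for all $\mathbf w\in\mathbf W_N^{\rm du}$, and set $$s_N(y)=\operatorname{Re}\bigl(\ell_h(\mathbf u_N(y))+a_h(\mathbf u_N(y),\boldsymbol\phi_N(y);y)-b_h(\boldsymbol\phi_N(y))\bigr).$$ Let $\tilde\beta(y)$ satisfy, for every $y\in\Lambda$, $$0<\tilde\beta(y)\le\beta_h(y)=\inf_{\mathbf w\ne0}\sup_{\mathbf v\ne0}\frac{|a_h(\mathbf w,\mathbf v;y)|}{\|\mathbf w\|_{\mathbf W}\|\mathbf v\|_{\mathbf W}}.$$ With $\|r\|_{\mathbf W'}=\sup_{\mathbf w\neq 0}|r(\mathbf w)|/\|\mathbf w\|_{\mathbf W}$ let $$\Delta_N^{\rm pr}(y)=\frac{\|b_h-a_h(\mathbf u_N(y),\cdot;y)\|_{\mathbf W'}}{\tilde\beta(y)},\qquad\Delta_N^{\rm du}(y)=\frac{\|-\ell_h-a_h(\cdot,\boldsymbol\phi_N(y);y)\|_{\mathbf W'}}{\tilde\beta(y)},\qquad\Delta_N^s=\tilde\beta\,\Delta_N^{\rm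 pr}\,\Delta_N^{\rm du}.$$ Assume that $s_N$ and $\Delta_N^s$ are measurable. Let $\rho(y)=\prod_q\rho_q(y_q)$ with bounded probability densities $\rho_q$ on $[-\gamma_q,\gamma_q]$, let $y_1,y_2,\dots$ be independent random vectors in $\Lambda$ with density $\rho$, and let $E[s_h]=\int_\Lambda s_h(y)\rho(y)\,dy$. For a function $s$ on $\Lambda$ put $$E_M[s]=\frac1M\sum_{m=1}^M s(y_m),\qquad V_M[s]=\frac1{M-1}\sum_{m=1}^M\bigl(E_M[s]-s(y_m)\bigr)^2,$$ and let $$\Delta^E_{N,M}=\frac1M\sum_{m=1}^M\Delta_N^s(y_m),\qquad\Delta^V_{N,M}=\frac1{M-1}\sum_{m=1}^M\bigl(\Delta_N^s(y_m)+\Delta^E_{N,M}\bigr)\bigl(\Delta_N^s(y_m)+2|s_N(y_m)|\bigr).$$ For $a>0$ set $$\widetilde\Delta^E_{N,M}=a\sqrt{\frac{V_M[s_N]+\Delta^V_{N,M}}{M}}+\Delta^E_{N,M}.$$ Then the following limit exists and satisfies $$\lim_{M\to\infty}\Pr\Bigl(\bigl|E[s_h]-E_M[s_N]\bigr|\le\widetilde\Delta^E_{N,M}\Bigr)\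 \ge\ \operatorname{erf}\Bigl(\frac{a}{\sqrt2}\Bigr).$$ -/

import Mathlib

open MeasureTheory ProbabilityTheory Filter Topology

noncomputable section

namespace HDG

open scoped Classical ComplexConjugate

/-! ## Triangulations -/

/-- A triangulation of the physical domain `domain ⊆ ℝᵈ`: a finite simplicial complex, all of whose
simplices are faces of `d`-simplices, that covers the closure of the domain. (Being a simplicial
complex, it is conforming: two simplices meet in a common face or not at all.) -/
structure Mesh (d : ℕ) where
  domain : Set (EuclideanSpace ℝ (Fin d))
  isOpen_domain : IsOpen domain
  complex : Geometry.SimplicialComplex ℝ (EuclideanSpace ℝ (Fin d))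
  finite_faces : complex.faces.Finite
  pure : ∀ s ∈ complex.faces, ∃ t ∈ complex.faces, s ⊆ t ∧ t.card = d + 1
  space_eq : complex.space = closure domain

variable {d : ℕ}

namespace Mesh

/-- The elements `T ∈ 𝒯_h`, given by their `d + 1` vertices. -/
def Elem (𝒯 : Mesh d) : Type :=
  {T : Finset (EuclideanSpace ℝ (Fin d)) // T ∈ 𝒯.complex.faces ∧ T.card = d + 1}

/-- The faces `F ∈ ℱ_h` of the elements, given by their `d` vertices. -/
def Face (𝒯 : Mesh d) : Type :=
  {F : Finset (EuclideanSpace ℝ (Fin d)) // F ∈ 𝒯.complex.faces ∧ F.card = d}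

instance (𝒯 : Mesh d) : Fintype 𝒯.Elem :=
  @Fintype.ofFinite _ ((𝒯.finite_faces.subset fun _ h => h.1 :
    {T | T ∈ 𝒯.complex.faces ∧ T.card = d + 1}.Finite).to_subtype)

instance (𝒯 : Mesh d) : Fintype 𝒯.Face :=
  @Fintype.ofFinite _ ((𝒯.finite_faces.subset fun _ h => h.1 :
    {F | F ∈ 𝒯.complex.faces ∧ F.card = d}.Finite).to_subtype)

/-- The closed simplex spanned by an element. -/
def Elem.hull {𝒯 : Mesh d} (T : 𝒯.Elem) : Set (EuclideanSpace ℝ (Fin d)) :=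
  convexHull ℝ (T.1 : Set (EuclideanSpace ℝ (Fin d)))

/-- The closed `(d - 1)`-simplex spanned by a face. -/
def Face.hull {𝒯 : Mesh d} (F : 𝒯.Face) : Set (EuclideanSpace ℝ (Fin d)) :=
  convexHull ℝ (F.1 : Set (EuclideanSpace ℝ (Fin d)))

/-- The faces that make up the boundary `∂T` of an element `T`. -/
def Elem.faces {𝒯 : Mesh d} (T : 𝒯.Elem) : Finset 𝒯.Face :=
  Finset.univ.filter fun F => F.1 ⊆ T.1

/-- The faces that make up the boundary `∂𝒟` of the domain. -/
def boundaryFaces (𝒯 : Mesh d) : Finset 𝒯.Face :=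
  Finset.univ.filter fun F => F.hull ⊆ frontier 𝒯.domain

/-- The outward unit normal `n` of the element `T` on its face `F`: the normalized component,
orthogonal to `F`, of the vector from the barycentre of `T` to the barycentre of `F`. -/
def normal {𝒯 : Mesh d} (T : 𝒯.Elem) (F : 𝒯.Face) : EuclideanSpace ℝ (Fin d) :=
  let v := (vectorSpan ℝ (F.1 : Set (EuclideanSpace ℝ (Fin d))))ᗮ.starProjection
    (F.1.centroid ℝ id - T.1.centroid ℝ id)
  ‖v‖⁻¹ • v

end Mesh

/-! ## Piecewise polynomial spaces -/

/-- Complex polynomials in `d` variables of total degree at most `p`. -/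
abbrev Poly (d p : ℕ) : Submodule ℂ (MvPolynomial (Fin d) ℂ) :=
  MvPolynomial.restrictTotalDegree (Fin d) ℂ p

/-- The value of a complex polynomial at a point of `ℝᵈ`, as a linear map in the polynomial. -/
def evalAt (x : EuclideanSpace ℝ (Fin d)) : MvPolynomial (Fin d) ℂ →ₗ[ℂ] ℂ :=
  (MvPolynomial.aeval fun i => ((x i : ℝ) : ℂ)).toLinearMap

/-- Restriction of a polynomial to a set `S`; the value is set to `0` outside `S`. -/
def restrictTo (S : Set (EuclideanSpace ℝ (Fin d))) :
    MvPolynomial (Fin d) ℂ →ₗ[ℂ] (EuclideanSpace ℝ (Fin d) → ℂ) where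
  toFun q := S.indicator fun x => evalAt x q
  map_add' q r := by
    funext x; by_cases hx : x ∈ S <;> simp [hx]
  map_smul' c q := by
    funext x; by_cases hx : x ∈ S <;> simp [hx]

/-- `P_p(F)`: the functions on a face that are restrictions of polynomials of degree `≤ p`. -/
def FacePoly (p : ℕ) {𝒯 : Mesh d} (F : 𝒯.Face) :
    Submodule ℂ (EuclideanSpace ℝ (Fin d) → ℂ) :=
  (Poly d p).map (restrictTo F.hull)

/-- `V_h^p`: vector fields whose components are, on each element, polynomials of degree `≤ p`. -/
abbrev VSpace (𝒯 : Mesh d) (p : ℕ) : Type := 𝒯.Elem → Fin d → Poly d p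

/-- `W_h^p`: functions that are, on each element, polynomials of degree `≤ p`. -/
abbrev WSpace (𝒯 : Mesh d) (p : ℕ) : Type := 𝒯.Elem → Poly d p

/-- `M_h^p`: functions on the skeleton that are, on each face, polynomials of degree `≤ p`. -/
abbrev MSpace (𝒯 : Mesh d) (p : ℕ) : Type := ∀ F : 𝒯.Face, FacePoly p F

/-- The product approximation space `𝐖_h^p = W_h^p × M_h^p`. -/
abbrev Space (𝒯 : Mesh d) (p : ℕ) : Type := WSpace 𝒯 p × MSpace 𝒯 p

variable {𝒯 : Mesh d} {p : ℕ}

/-- The value of `w ∈ W_h^p` at `x`, taken from the element `T`. -/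
def WSpace.val (w : WSpace 𝒯 p) (T : 𝒯.Elem) (x : EuclideanSpace ℝ (Fin d)) : ℂ :=
  evalAt x (w T : MvPolynomial (Fin d) ℂ)

/-- The `i`-th component of the gradient of `w ∈ W_h^p` at `x`, taken from the element `T`. -/
def WSpace.grad (w : WSpace 𝒯 p) (T : 𝒯.Elem) (x : EuclideanSpace ℝ (Fin d)) (i : Fin d) : ℂ :=
  evalAt x (MvPolynomial.pderiv i (w T : MvPolynomial (Fin d) ℂ))

/-- The `i`-th component of `r ∈ V_h^p` at `x`, taken from the element `T`. -/
def VSpace.val (r : VSpace 𝒯 p) (T : 𝒯.Elem) (x : EuclideanSpace ℝ (Fin d)) (i : Fin d) : ℂ :=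
  evalAt x (r T i : MvPolynomial (Fin d) ℂ)

/-- The divergence of `r ∈ V_h^p` at `x`, taken from the element `T`. -/
def VSpace.div (r : VSpace 𝒯 p) (T : 𝒯.Elem) (x : EuclideanSpace ℝ (Fin d)) : ℂ :=
  ∑ i, evalAt x (MvPolynomial.pderiv i (r T i : MvPolynomial (Fin d) ℂ))

/-- The normal component `r · n` at a point `x` of the face `F` of `T`, taken from `T`. -/
def VSpace.flux (r : VSpace 𝒯 p) (T : 𝒯.Elem) (F : 𝒯.Face)
    (x : EuclideanSpace ℝ (Fin d)) : ℂ :=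
  ∑ i, VSpace.val r T x i * ((Mesh.normal T F i : ℝ) : ℂ)

/-- The value of `μ ∈ M_h^p` at a point `x` of the face `F`. -/
def MSpace.val (μ : MSpace 𝒯 p) (F : 𝒯.Face) (x : EuclideanSpace ℝ (Fin d)) : ℂ :=
  (μ F : EuclideanSpace ℝ (Fin d) → ℂ) x

/-! ## The HDG forms -/

/-- `∑_{T ∈ 𝒯_h} ∫_T φ dx`, for an integrand given element by element. -/
def intElems (φ : 𝒯.Elem → EuclideanSpace ℝ (Fin d) → ℂ) : ℂ :=
  ∑ T, ∫ x in T.hull, φ T x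

/-- `∑_{T ∈ 𝒯_h} ∫_{∂T} φ ds`, for an integrand given element by element and face by face; `ds` is
the `(d - 1)`-dimensional surface measure. -/
def intSkeleton (φ : 𝒯.Elem → 𝒯.Face → EuclideanSpace ℝ (Fin d) → ℂ) : ℂ :=
  ∑ T, ∑ F ∈ T.faces, ∫ x in F.hull, φ T F x ∂μHE[d - 1]

/-- `∫_{∂𝒟} φ ds`. -/
def intBoundary (φ : 𝒯.Face → EuclideanSpace ℝ (Fin d) → ℂ) : ℂ :=
  ∑ F ∈ 𝒯.boundaryFaces, ∫ x in F.hull, φ F x ∂μHE[d - 1]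

lemma hull_interior (T : 𝒯.Elem) : (interior T.hull).Nonempty := by
  have h := 𝒯.complex.indep T.2.1
  have h2 : affineSpan ℝ (T.1 : Set (EuclideanSpace ℝ (Fin d))) = ⊤ := by
    have := h.affineSpan_eq_top_iff_card_eq_finrank_add_one
    simp only [Subtype.range_coe_subtype, Finset.setOfPred_mem, Fintype.card_coe,
      finrank_euclideanSpace_fin] at this
    exact this.2 T.2.2
  exact interior_convexHull_nonempty_iff_affineSpan_eq_top.2 h2

lemma evalAt_continuous (q : MvPolynomial (Fin d) ℂ) :
    Continuous fun x : EuclideanSpace ℝ (Fin d) => evalAt x q := by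
  have : Continuous fun x : EuclideanSpace ℝ (Fin d) => fun i => ((x i : ℝ) : ℂ) := by fun_prop
  exact (MvPolynomial.continuous_eval q).comp this

lemma eq_zero_of_open (q : MvPolynomial (Fin d) ℂ) (U : Set (EuclideanSpace ℝ (Fin d)))
    (hU : IsOpen U) (hne : U.Nonempty) (h : ∀ x ∈ U, evalAt x q = 0) : q = 0 := by
  obtain ⟨x0, hx0⟩ := hne
  have hU' : IsOpen ((WithLp.toLp 2 : (Fin d → ℝ) → _) ⁻¹' U) :=
    hU.preimage (PiLp.continuous_toLp 2 _)
  obtain ⟨ε, hε, hb⟩ := Metric.isOpen_iff.1 hU' (WithLp.ofLp x0) (by simpa using hx0)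
  refine MvPolynomial.funext_set (fun i => (fun t : ℝ => (t : ℂ)) '' Metric.ball (x0 i) ε)
    (fun i => ?_) fun z hz => ?_
  · refine Set.Infinite.image (Complex.ofReal_injective.injOn) ?_
    rw [Real.ball_eq_Ioo]
    exact Set.Ioo_infinite (by linarith)
  · have hz' : ∀ i, ∃ t ∈ Metric.ball (x0 i) ε, (t : ℂ) = z i := fun i => hz i (Set.mem_univ i)
    choose t ht htz using hz'
    have hm : t ∈ Metric.ball (WithLp.ofLp x0) ε := by
      rw [Metric.mem_ball, dist_pi_lt_iff hε]; exact ht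
    have := h _ (hb hm)
    obtain rfl : (fun i => (t i : ℂ)) = z := funext htz
    rw [map_zero, ← this]
    exact (DFunLike.congr_fun (MvPolynomial.coe_aeval_eq_eval (fun i => (t i : ℂ))) q).symm

lemma hull_compact (T : 𝒯.Elem) : IsCompact T.hull :=
  T.1.finite_toSet.isCompact_convexHull ℝ

lemma intOn (T : 𝒯.Elem) {h : EuclideanSpace ℝ (Fin d) → ℂ} (hh : Continuous h) :
    IntegrableOn h T.hull :=
  hh.continuousOn.integrableOn_compact (hull_compact T)

/-- The inner product `(q, r)_{𝒯_h}` on `V_h^p`. -/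
def gram (q r : VSpace 𝒯 p) : ℂ :=
  intElems (fun T x => ∑ i, VSpace.val q T x i * conj (VSpace.val r T x i))

lemma val_cont (q : VSpace 𝒯 p) (T : 𝒯.Elem) (i : Fin d) :
    Continuous fun x => VSpace.val q T x i := evalAt_continuous _

lemma gram_int (q r : VSpace 𝒯 p) (T : 𝒯.Elem) :
    IntegrableOn (fun x => ∑ i, VSpace.val q T x i * conj (VSpace.val r T x i)) T.hull := by
  refine intOn T ?_
  have := val_cont q T
  have := val_cont r T
  fun_prop

lemma gram_def (q : VSpace 𝒯 p) (h : gram q q = 0) : q = 0 := by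
  have key : ∀ T : 𝒯.Elem, ∫ x in T.hull, ∑ i, ‖VSpace.val q T x i‖ ^ 2 = 0 := by
    have h1 : gram q q =
        ((∑ T : 𝒯.Elem, ∫ x in T.hull, ∑ i, ‖VSpace.val q T x i‖ ^ 2 : ℝ) : ℂ) := by
      simp only [gram, intElems, Complex.mul_conj']
      push_cast
      refine Finset.sum_congr rfl fun T _ => ?_
      rw [← integral_complex_ofReal]
      push_cast
      rfl
    rw [h1, Complex.ofReal_eq_zero, Finset.sum_eq_zero_iff_of_nonneg] at h
    · exact fun T => h T (Finset.mem_univ T)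
    · exact fun T _ => integral_nonneg fun x => Finset.sum_nonneg fun i _ => sq_nonneg _
  funext T i
  have hc : Continuous fun x => ∑ i, ‖VSpace.val q T x i‖ ^ 2 := by
    have := val_cont q T
    fun_prop
  have h0 := (setIntegral_eq_zero_iff_of_nonneg_ae
    (Filter.Eventually.of_forall fun x => Finset.sum_nonneg fun i _ => sq_nonneg _)
    (hc.continuousOn.integrableOn_compact (hull_compact T))).1 (key T)
  have h2 : (fun x => ∑ i, ‖VSpace.val q T x i‖ ^ 2) =ᵐ[volume.restrict (interior T.hull)] 0 :=
    ae_restrict_of_ae_restrict_of_subset interior_subset h0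
  have h3 := Measure.eqOn_open_of_ae_eq h2 isOpen_interior hc.continuousOn continuousOn_const
  refine Subtype.ext (eq_zero_of_open _ _ isOpen_interior (hull_interior T) fun x hx => ?_)
  have h4 := (Finset.sum_eq_zero_iff_of_nonneg (fun i _ => sq_nonneg _)).1 (h3 hx) i
    (Finset.mem_univ i)
  simpa [VSpace.val] using h4

lemma val_add (q r : VSpace 𝒯 p) (T : 𝒯.Elem) (x) (i : Fin d) :
    VSpace.val (q + r) T x i = VSpace.val q T x i + VSpace.val r T x i := by
  simp [VSpace.val]

lemma val_smul (c : ℂ) (r : VSpace 𝒯 p) (T : 𝒯.Elem) (x) (i : Fin d) :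
    VSpace.val (c • r) T x i = c * VSpace.val r T x i := by
  simp [VSpace.val]

lemma gram_add_left (q q' r : VSpace 𝒯 p) : gram (q + q') r = gram q r + gram q' r := by
  simp only [gram, intElems, ← Finset.sum_add_distrib]
  refine Finset.sum_congr rfl fun T _ => ?_
  rw [← integral_add (gram_int _ _ _) (gram_int _ _ _)]
  simp only [val_add, add_mul, Finset.sum_add_distrib]

lemma gram_smul_left (c : ℂ) (q r : VSpace 𝒯 p) : gram (c • q) r = c * gram q r := by
  simp only [gram, intElems, Finset.mul_sum]
  refine Finset.sum_congr rfl fun T _ => ?_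
  rw [← integral_const_mul]
  simp only [val_smul, Finset.mul_sum, mul_assoc]

lemma gram_conj (q r : VSpace 𝒯 p) : conj (gram q r) = gram r q := by
  simp only [gram, intElems, map_sum, ← integral_conj]
  refine Finset.sum_congr rfl fun T _ => ?_
  simp only [map_mul, Complex.conj_conj, mul_comm]

/-- Every antilinear functional on `V_h^p` is represented by a unique element of `V_h^p`. -/
theorem existsUnique_riesz (φ : VSpace 𝒯 p → ℂ) (hadd : ∀ r s, φ (r + s) = φ r + φ s)
    (hsmul : ∀ (c : ℂ) r, φ (c • r) = conj c * φ r) :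
    ∃! q : VSpace 𝒯 p, ∀ r : VSpace 𝒯 p, gram q r = φ r := by
  let G : VSpace 𝒯 p →ₗ[ℝ] Module.Dual ℂ (VSpace 𝒯 p) :=
    { toFun q :=
        { toFun r := gram r q
          map_add' r s := gram_add_left r s q
          map_smul' c r := gram_smul_left c r q }
      map_add' q q' := by
        refine LinearMap.ext fun r => ?_
        change gram r (q + q') = gram r q + gram r q'
        rw [← gram_conj, gram_add_left, map_add, gram_conj, gram_conj]
      map_smul' c q := by
        refine LinearMap.ext fun r => ?_
        change gram r ((c : ℂ) • q) = (c : ℂ) * gram r q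
        rw [← gram_conj, gram_smul_left, map_mul, gram_conj, Complex.conj_ofReal] }
  have hinj : Function.Injective G := by
    rw [injective_iff_map_eq_zero]
    intro q hq
    exact gram_def q (DFunLike.congr_fun hq q)
  have : FiniteDimensional ℝ (VSpace 𝒯 p) := FiniteDimensional.complexToReal _
  have : FiniteDimensional ℝ (Module.Dual ℂ (VSpace 𝒯 p)) := FiniteDimensional.complexToReal _
  have hsurj : Function.Surjective G := by
    refine (LinearMap.injective_iff_surjective_of_finrank_eq_finrank ?_).1 hinj
    rw [finrank_real_of_complex, finrank_real_of_complex, Subspace.dual_finrank_eq]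
  obtain ⟨q, hq⟩ := hsurj
    { toFun r := conj (φ r)
      map_add' r s := by rw [hadd, map_add]
      map_smul' c r := by simp [hsmul] }
  have hq' : ∀ r, gram q r = φ r := fun r => by
    have : gram r q = conj (φ r) := DFunLike.congr_fun hq r
    rw [← gram_conj, this, Complex.conj_conj]
  refine ⟨q, hq', fun q' hq'' => hinj ?_⟩
  refine LinearMap.ext fun r => ?_
  change gram r q' = gram r q
  rw [← gram_conj q', ← gram_conj q, hq' r]
  exact congrArg _ (hq'' r)


/-- The element of `V_h^p` that represents the antilinear functional `φ` with respect to
`(·, ·)_{𝒯_h}`, i.e. the `q` with `(q, r)_{𝒯_h} = φ r` for all `r ∈ V_h^p`. -/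
def riesz (φ : VSpace 𝒯 p → ℂ) : VSpace 𝒯 p :=
  Classical.epsilon fun q : VSpace 𝒯 p => ∀ r : VSpace 𝒯 p, gram q r = φ r

theorem gram_riesz (φ : VSpace 𝒯 p → ℂ) (hadd : ∀ r s, φ (r + s) = φ r + φ s)
    (hsmul : ∀ (c : ℂ) r, φ (c • r) = conj c * φ r) (r : VSpace 𝒯 p) :
    gram (riesz φ) r = φ r :=
  Classical.epsilon_spec (p := fun q : VSpace 𝒯 p => ∀ r : VSpace 𝒯 p, gram q r = φ r)
    (existsUnique_riesz φ hadd hsmul).exists r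

/-- The lifting `l : W_h^p → V_h^p`, `(l(w), r)_{𝒯_h} = - (w, ∇·r)_{𝒯_h}`. -/
def liftW (w : WSpace 𝒯 p) : VSpace 𝒯 p :=
  riesz fun r => - intElems (fun T x => WSpace.val w T x * conj (VSpace.div r T x))

/-- The lifting `m : M_h^p → V_h^p`, `(m(μ), r)_{𝒯_h} = ⟨μ, r·n⟩_{∂𝒯_h}`. -/
def liftM (μ : MSpace 𝒯 p) : VSpace 𝒯 p :=
  riesz fun r => intSkeleton (fun T F x => MSpace.val μ F x * conj (VSpace.flux r T F x))

/-- The form `a_h((v, η), (w, μ); (κ, ϱ, ν))` with stabilization parameter `τ`. The coefficient `κ`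
is given element by element (`κ T x` for `x` in the closed simplex `T`), so that it may jump across
interelement faces; in integrals over `∂T` the branch belonging to `T` is used. -/
def aForm (τ : ℝ) (κ : 𝒯.Elem → EuclideanSpace ℝ (Fin d) → ℝ)
    (ϱ ν : EuclideanSpace ℝ (Fin d) → ℂ) (v w : Space 𝒯 p) : ℂ :=
  let q : VSpace 𝒯 p := liftW v.1 + liftM v.2
  let flux : 𝒯.Elem → 𝒯.Face → EuclideanSpace ℝ (Fin d) → ℂ := fun T F x =>
    (κ T x : ℂ) * VSpace.flux q T F x
      - (κ T x : ℂ) * (τ : ℂ) * (WSpace.val v.1 T x - MSpace.val v.2 F x)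
  intElems (fun T x => ∑ i, (κ T x : ℂ) * VSpace.val q T x i * conj (WSpace.grad w.1 T x i))
    - intSkeleton (fun T F x => flux T F x * conj (WSpace.val w.1 T x))
    + intElems (fun T x => ϱ x * WSpace.val v.1 T x * conj (WSpace.val w.1 T x))
    + intSkeleton (fun T F x => flux T F x * conj (MSpace.val w.2 F x))
    + intBoundary (fun F x => ν x * MSpace.val v.2 F x * conj (MSpace.val w.2 F x))

/-- The functional `b_h((w, μ)) = (f, w)_{𝒯_h} + ⟨g, μ⟩_{∂𝒟}`. -/
def bForm (f g : EuclideanSpace ℝ (Fin d) → ℂ) (w : Space 𝒯 p) : ℂ :=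
  intElems (fun T x => f x * conj (WSpace.val w.1 T x))
    + intBoundary (fun F x => g x * conj (MSpace.val w.2 F x))

/-- The inner product `(v, w)_𝐖 = a_h(v, w; (1, 1, 1))`. -/
def innerW (τ : ℝ) (v w : Space 𝒯 p) : ℂ :=
  aForm τ (fun _ _ => 1) (fun _ => 1) (fun _ => 1) v w

/-- The norm `‖w‖_𝐖 = √((w, w)_𝐖)`. -/
def normW (τ : ℝ) (w : Space 𝒯 p) : ℝ := √(innerW τ w w).re

/-! ## The parametrized problem and its reduced basis approximation -/

/-- The data of the stochastic boundary value problem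
`-∇·(κ∇u) + ϱ u = f` in `𝒟`, `κ∇u·n + ν u = g` on `∂𝒟`, with
`κ(x, y) = κ̄(x) + ∑_q ψ_q(x) y_q`, and of its HDG discretization. -/
structure Problem (𝒯 : Mesh d) (p Q : ℕ) where
  τ : ℝ
  τ_pos : 0 < τ
  κbar : 𝒯.Elem → EuclideanSpace ℝ (Fin d) → ℝ
  ψ : Fin Q → 𝒯.Elem → EuclideanSpace ℝ (Fin d) → ℝ
  ϱ : EuclideanSpace ℝ (Fin d) → ℂ
  ν : EuclideanSpace ℝ (Fin d) → ℂ
  f : EuclideanSpace ℝ (Fin d) → ℂ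
  g : EuclideanSpace ℝ (Fin d) → ℂ
  measurable_κbar : ∀ T, Measurable (κbar T)
  measurable_ψ : ∀ q T, Measurable (ψ q T)
  bounded_κbar : ∃ C, ∀ T, ∀ x ∈ T.hull, |κbar T x| ≤ C
  bounded_ψ : ∃ C, ∀ q T, ∀ x ∈ T.hull, |ψ q T x| ≤ C
  integrable_ϱ : ∀ T : 𝒯.Elem, IntegrableOn ϱ T.hull
  integrable_f : ∀ T : 𝒯.Elem, IntegrableOn f T.hull
  integrable_ν : ∀ F ∈ 𝒯.boundaryFaces, IntegrableOn ν F.hull μHE[d - 1]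
  integrable_g : ∀ F ∈ 𝒯.boundaryFaces, IntegrableOn g F.hull μHE[d - 1]
  /-- the discrete output functional `ℓ_h` -/
  ℓ : Space 𝒯 p →ₗ[ℂ] ℂ

namespace Problem

variable {Q : ℕ} (D : Problem 𝒯 p Q)

/-- `κ(x, y) = κ̄(x) + ∑_q ψ_q(x) y_q`. -/
def κ (y : Fin Q → ℝ) (T : 𝒯.Elem) (x : EuclideanSpace ℝ (Fin d)) : ℝ :=
  D.κbar T x + ∑ q, D.ψ q T x * y q

/-- `a_h(v, w; y)`. -/
def a (y : Fin Q → ℝ) (v w : Space 𝒯 p) : ℂ := aForm D.τ (D.κ y) D.ϱ D.ν v w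

/-- `b_h(w)`. -/
def b (w : Space 𝒯 p) : ℂ := bForm D.f D.g w

/-- `u` is the HDG solution at `y`: `a_h(u, w; y) = b_h(w)` for all `w ∈ 𝐖_h^p`. -/
def IsHDG (y : Fin Q → ℝ) (u : Space 𝒯 p) : Prop := ∀ w, D.a y u w = D.b w

/-- `u` is the primal reduced basis approximation at `y` in the space `S`. -/
def IsPrimalRB (S : Submodule ℂ (Space 𝒯 p)) (y : Fin Q → ℝ) (u : Space 𝒯 p) : Prop :=
  u ∈ S ∧ ∀ w ∈ S, D.a y u w = D.b w

/-- `φ` is the dual reduced basis approximation at `y` in the space `S`. -/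
def IsDualRB (S : Submodule ℂ (Space 𝒯 p)) (y : Fin Q → ℝ) (φ : Space 𝒯 p) : Prop :=
  φ ∈ S ∧ ∀ w ∈ S, D.a y w φ = - D.ℓ w

/-- The (real) HDG output `s_h(y) = Re ℓ_h(u_h(y))`. -/
def hdgOutput (uh : (Fin Q → ℝ) → Space 𝒯 p) (y : Fin Q → ℝ) : ℝ := (D.ℓ (uh y)).re

/-- The (real) reduced basis output
`s_N(y) = Re (ℓ_h(u_N(y)) + a_h(u_N(y), φ_N(y); y) - b_h(φ_N(y)))`. -/
def rbOutput (uN φN : (Fin Q → ℝ) → Space 𝒯 p) (y : Fin Q → ℝ) : ℝ :=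
  (D.ℓ (uN y) + D.a y (uN y) (φN y) - D.b (φN y)).re

/-- The dual norm `‖r‖_{𝐖'} = sup_w |r(w)| / ‖w‖_𝐖` (the quotient is read as `0` for `w = 0`). -/
def dualNorm (r : Space 𝒯 p → ℂ) : ℝ := ⨆ w : Space 𝒯 p, ‖r w‖ / normW D.τ w

/-- The inf-sup constant `β_h(y) = inf_{w ≠ 0} sup_{v ≠ 0} |a_h(w, v; y)| / (‖w‖_𝐖 ‖v‖_𝐖)`. -/
def infSup (y : Fin Q → ℝ) : ℝ :=
  ⨅ w : {w : Space 𝒯 p // w ≠ 0}, ⨆ v : {v : Space 𝒯 p // v ≠ 0},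
    ‖D.a y w.1 v.1‖ / (normW D.τ w.1 * normW D.τ v.1)

/-- The primal error bound `Δ_N^pr(y) = ‖b_h - a_h(u_N(y), ·; y)‖_{𝐖'} / β̃(y)`. -/
def primalBound (β : (Fin Q → ℝ) → ℝ) (uN : (Fin Q → ℝ) → Space 𝒯 p) (y : Fin Q → ℝ) : ℝ :=
  D.dualNorm (fun w => D.b w - D.a y (uN y) w) / β y

/-- The dual error bound `Δ_N^du(y) = ‖-ℓ_h - a_h(·, φ_N(y); y)‖_{𝐖'} / β̃(y)`. -/
def dualBound (β : (Fin Q → ℝ) → ℝ) (φN : (Fin Q → ℝ) → Space 𝒯 p) (y : Fin Q → ℝ) : ℝ :=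
  D.dualNorm (fun w => - D.ℓ w - D.a y w (φN y)) / β y

/-- The output error bound `Δ_N^s(y) = β̃(y) Δ_N^pr(y) Δ_N^du(y)`. -/
def outputBound (β : (Fin Q → ℝ) → ℝ) (uN φN : (Fin Q → ℝ) → Space 𝒯 p) (y : Fin Q → ℝ) : ℝ :=
  β y * D.primalBound β uN y * D.dualBound β φN y

end Problem

/-- The reduced basis space `span {ζ_n, 1 ≤ n ≤ N}` (the indices of `ζ` start at `0`). -/
def rbSpace {Nmax : ℕ} (ζ : Fin Nmax → Space 𝒯 p) (N : ℕ) : Submodule ℂ (Space 𝒯 p) :=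
  Submodule.span ℂ {v | ∃ n : Fin Nmax, (n : ℕ) < N ∧ ζ n = v}

/-! ## Random parameters and Monte Carlo estimators -/

/-- The parameter domain `Λ = ∏_q [-γ_q, γ_q]`. -/
def paramBox {Q : ℕ} (γ : Fin Q → ℝ) : Set (Fin Q → ℝ) :=
  Set.univ.pi fun q => Set.Icc (-γ q) (γ q)

/-- `ρ_q`, `q = 1, …, Q`, are bounded probability densities on `Λ_q = [-γ_q, γ_q]`. -/
structure IsDensity {Q : ℕ} (γ : Fin Q → ℝ) (ρ : Fin Q → ℝ → ℝ) : Prop where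
  measurable : ∀ q, Measurable (ρ q)
  nonneg : ∀ q, ∀ t ∈ Set.Icc (-γ q) (γ q), 0 ≤ ρ q t
  bounded : ∃ C, ∀ q, ∀ t ∈ Set.Icc (-γ q) (γ q), ρ q t ≤ C
  integral_eq_one : ∀ q, ∫ t in Set.Icc (-γ q) (γ q), ρ q t = 1

/-- The joint density `ρ(y) = ∏_q ρ_q(y_q)`. -/
def jointDensity {Q : ℕ} (ρ : Fin Q → ℝ → ℝ) (y : Fin Q → ℝ) : ℝ := ∏ q, ρ q (y q)

/-- The law on `Λ` with density `ρ(y) = ∏_q ρ_q(y_q)`. -/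
def paramLaw {Q : ℕ} (γ : Fin Q → ℝ) (ρ : Fin Q → ℝ → ℝ) : Measure (Fin Q → ℝ) :=
  (volume.restrict (paramBox γ)).withDensity fun y => ENNReal.ofReal (jointDensity ρ y)

/-- `E[s] = ∫_Λ s(y) ρ(y) dy`. -/
def expect {Q : ℕ} (γ : Fin Q → ℝ) (ρ : Fin Q → ℝ → ℝ) (s : (Fin Q → ℝ) → ℝ) : ℝ :=
  ∫ y in paramBox γ, s y * jointDensity ρ y

/-- The Monte Carlo mean `E_M[s]` over the samples `y_0, …, y_{M-1}`. -/
def mcMean {Q : ℕ} (s : (Fin Q → ℝ) → ℝ) (Y : ℕ → Fin Q → ℝ) (M : ℕ) : ℝ :=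
  1 / (M : ℝ) * ∑ m ∈ Finset.range M, s (Y m)

/-- The Monte Carlo variance `V_M[s]` over the samples `y_0, …, y_{M-1}`. -/
def mcVar {Q : ℕ} (s : (Fin Q → ℝ) → ℝ) (Y : ℕ → Fin Q → ℝ) (M : ℕ) : ℝ :=
  1 / ((M : ℝ) - 1) * ∑ m ∈ Finset.range M, (mcMean s Y M - s (Y m)) ^ 2

/-- `Δ^V_{N,M} = 1/(M-1) ∑_m (Δ_N^s(y_m) + Δ^E_{N,M}) (Δ_N^s(y_m) + 2 |s_N(y_m)|)`, where
`Δ^E_{N,M} = E_M[Δ_N^s]`. -/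
def mcVarBound {Q : ℕ} (sN Δs : (Fin Q → ℝ) → ℝ) (Y : ℕ → Fin Q → ℝ) (M : ℕ) : ℝ :=
  1 / ((M : ℝ) - 1) * ∑ m ∈ Finset.range M,
    (Δs (Y m) + mcMean Δs Y M) * (Δs (Y m) + 2 * |sN (Y m)|)

/-- `Δ̃^E_{N,M} = a √((V_M[s_N] + Δ^V_{N,M}) / M) + Δ^E_{N,M}`. -/
def mcTotalBound {Q : ℕ} (a : ℝ) (sN Δs : (Fin Q → ℝ) → ℝ) (Y : ℕ → Fin Q → ℝ) (M : ℕ) : ℝ :=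
  a * √((mcVar sN Y M + mcVarBound sN Δs Y M) / M) + mcMean Δs Y M

/-- The error function `erf x = 2/√π ∫_0^x exp(-t²) dt`. -/
def erf (x : ℝ) : ℝ := 2 / √Real.pi * ∫ t in (0 : ℝ)..x, Real.exp (-t ^ 2)

end HDG

end

namespace HDG

/-! ## The error function and the normal distribution -/

/-! The theorem combines a deterministic error bound with a central limit argument that uses only
this bound and the boundedness of `s_h`.

Deterministic part. Put `e = u_h - u_N`. Since `b_h(φ_N) = a_h(u_h, φ_N)`, the output error `s_h -
s_N` is minus the real part of the dual residual at `e`. It is at most the dual norm of that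
residual times `‖e‖`, and the inf-sup constant bounds `β̃ ‖e‖` by the dual norm of the primal
residual `a_h(e, ·)`. Hence `|s_h - s_N| ≤ Δ_N^s` on the box (`abs_output_sub_le`). The argument
needs `(·,·)_𝐖` to be positive definite: in finite dimension every functional is then bounded and
the dual norms are genuine suprema. Integration by parts turns `(w, w)_𝐖` into `‖q‖² + τ ‖w - μ‖² +
‖w‖² + ‖μ‖²`, with norms over the elements, the element boundaries, the elements and the domain
boundary (`innerW_self_eq`, `innerW_self_re_pos`). The divergence theorem behind it,
`setIntegral_divergence`, comes from integrating over a simplex as a cone over each of its faces.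
Cramer's rule makes `s_h` continuous on the compact box, hence bounded (`continuousOn_hdgOutput`).

Probabilistic part. Write `s, t, r` for `s_h, s_N, Δ_N^s`, so `|s - t| ≤ r`, and let `W = V_M[t] +
Δ^V`. Multiplied by `√M`, the event reads `-T₁ ≤ Z ≤ T₂`, where `Z = √M (E_M[s] - E[s])` and `T₁, T₂
= a √W + √M E_M[r ∓ (s - t)]`. The central limit theorem sends `Z` to a centred normal law with
variance `Var s`. The functions `r ∓ (s - t)` are nonnegative, so their means times `√M` tend to `0`
or to infinity; and `W ≥ V_M[s]` on every path, so `W` tends to a constant at least `Var s` or to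
infinity (`hasLimitGE_mcVar_add_mcVarBound`). No moments of `t` or `r` are assumed, which is why
infinite limits must be admitted. A Slutsky argument, `exists_tendsto_measureReal_interval`, gives
the limit of the probabilities and bounds it below by the normal mass of `[-aσ, aσ]`, that is by
`erf (a / √2)`. If `Var s = 0`, the event has probability one for every positive `M`. -/

/-- The substitution `x = √(2v) t` turns the density into `exp (-t²) / √π`; evenness of the
integrand then supplies the factor 2 of `erf`. -/
lemma gaussianReal_Icc {v : NNReal} (hv : v ≠ 0) {a : ℝ} (ha : 0 < a) :
    (gaussianReal 0 v).real (Set.Icc (-(a * √v)) (a * √v)) = erf (a / √2) := by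
  have hv' : (0 : ℝ) < v := by positivity
  have hs : 0 < √(v : ℝ) := Real.sqrt_pos.2 hv'
  have hle : -(a * √v) ≤ a * √v := by nlinarith
  have h1 : (gaussianReal 0 v).real (Set.Icc (-(a * √v)) (a * √v))
      = ∫ x in (-(a * √v))..(a * √v), gaussianPDFReal 0 v x := by
    rw [intervalIntegral.integral_of_le hle, ← integral_Icc_eq_integral_Ioc, measureReal_def,
      gaussianReal_apply_eq_integral 0 hv, ENNReal.toReal_ofReal]
    exact integral_nonneg fun x => gaussianPDFReal_nonneg 0 v x
  have h2 : ∀ x : ℝ, gaussianPDFReal 0 v x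
      = (√Real.pi)⁻¹ * ((√(2 * v))⁻¹ * Real.exp (-((√(2 * v))⁻¹ * x) ^ 2)) := by
    intro x
    have e1 : √(2 * Real.pi * v) = √Real.pi * √(2 * v) := by
      rw [← Real.sqrt_mul Real.pi_pos.le]; ring_nf
    have e2 : -((√(2 * v))⁻¹ * x) ^ 2 = -(x - 0) ^ 2 / (2 * v) := by
      rw [mul_pow, inv_pow, Real.sq_sqrt (by positivity)]; field_simp; ring
    rw [gaussianPDFReal, e1, e2, mul_inv, mul_assoc]
  have hc : (√(2 * v))⁻¹ * (a * √v) = a / √2 := by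
    rw [Real.sqrt_mul (by norm_num)]; field_simp
  rw [h1]
  simp only [h2]
  rw [intervalIntegral.integral_const_mul, intervalIntegral.integral_const_mul,
    intervalIntegral.mul_integral_comp_mul_left (f := fun t => Real.exp (-t ^ 2)), mul_neg, hc]
  have hint : ∀ s t : ℝ, IntervalIntegrable (fun t : ℝ => Real.exp (-t ^ 2)) volume s t :=
    fun s t => (by fun_prop : Continuous fun t : ℝ => Real.exp (-t ^ 2)).intervalIntegrable _ _
  have hsymm : ∫ t in (-(a / √2))..0, Real.exp (-t ^ 2)
      = ∫ t in (0 : ℝ)..(a / √2), Real.exp (-t ^ 2) := by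
    have := intervalIntegral.integral_comp_neg (a := 0) (b := a / √2)
      fun t : ℝ => Real.exp (-t ^ 2)
    simpa using this.symm
  rw [← intervalIntegral.integral_add_adjacent_intervals (hint _ 0) (hint 0 _), hsymm, erf]
  ring

lemma erf_le_one {a : ℝ} (ha : 0 < a) : erf (a / √2) ≤ 1 := by
  rw [← gaussianReal_Icc one_ne_zero ha]
  exact measureReal_le_one

/-! ## Random intervals with convergent endpoints -/

/-- The random variables `T n` converge almost surely to a constant in `[s, ∞]`. -/
def HasLimitGE {Ω : Type*} [MeasurableSpace Ω] (P : Measure Ω) (T : ℕ → Ω → ℝ) (s : ℝ) : Prop :=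
  (∃ t, s ≤ t ∧ ∀ᵐ ω ∂P, Tendsto (fun n => T n ω) atTop (𝓝 t)) ∨
    ∀ᵐ ω ∂P, Tendsto (fun n => T n ω) atTop atTop

/-- Compressing the line by `arctan` turns divergence to infinity into convergence to `π / 2`, so
both alternatives become convergence to a real constant. -/
lemma HasLimitGE.arctan {Ω : Type*} [MeasurableSpace Ω] {P : Measure Ω} {T : ℕ → Ω → ℝ} {s : ℝ}
    (h : HasLimitGE P T s) :
    ∃ t, Real.arctan s ≤ t ∧ ∀ᵐ ω ∂P, Tendsto (fun n => Real.arctan (T n ω)) atTop (𝓝 t) := by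
  rcases h with ⟨t, ht, h⟩ | h
  · exact ⟨Real.arctan t, Real.arctan_strictMono.monotone ht, h.mono fun ω hω =>
      (Real.continuous_arctan.tendsto t).comp hω⟩
  · exact ⟨Real.pi / 2, (Real.arctan_lt_pi_div_two s).le, h.mono fun ω hω =>
      (Real.tendsto_arctan_atTop.mono_right nhdsWithin_le_nhds).comp hω⟩

/-- Slutsky's theorem after compression by `arctan`: the endpoints converge in measure to constants,
so the triple converges jointly in distribution. The limiting interval contains `[-s, s]`. -/
lemma exists_tendsto_measureReal_interval {Ω : Type*} [MeasurableSpace Ω] {P : Measure Ω}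
    [IsProbabilityMeasure P] {ν : Measure ℝ} [IsProbabilityMeasure ν] [NullSingletonClass ν]
    {Z T₁ T₂ : ℕ → Ω → ℝ} (hZ : TendstoInDistribution Z atTop id (fun _ => P) ν)
    (hm₁ : ∀ n, AEMeasurable (T₁ n) P) (hm₂ : ∀ n, AEMeasurable (T₂ n) P) {s : ℝ}
    (h₁ : HasLimitGE P T₁ s) (h₂ : HasLimitGE P T₂ s) :
    ∃ L : ℝ, Tendsto (fun n => P.real {ω | -T₁ n ω ≤ Z n ω ∧ Z n ω ≤ T₂ n ω}) atTop (𝓝 L) ∧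
      ν.real (Set.Icc (-s) s) ≤ L := by
  obtain ⟨t₁, hs₁, ht₁⟩ := h₁.arctan
  obtain ⟨t₂, hs₂, ht₂⟩ := h₂.arctan
  have hmeas : ∀ n, AEMeasurable (fun ω => (Real.arctan (T₁ n ω), Real.arctan (T₂ n ω))) P :=
    fun n => (Real.measurable_arctan.comp_aemeasurable (hm₁ n)).prodMk
      (Real.measurable_arctan.comp_aemeasurable (hm₂ n))
  have hT : TendstoInMeasure P (fun n ω => (Real.arctan (T₁ n ω), Real.arctan (T₂ n ω))) atTop
      fun _ => (t₁, t₂) := by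
    refine tendstoInMeasure_of_tendsto_ae (fun n => (hmeas n).aestronglyMeasurable) ?_
    filter_upwards [ht₁, ht₂] with ω h h'
    exact h.prodMk_nhds h'
  -- As `arctan` is odd and strictly increasing, `-T₁ ≤ Z ≤ T₂` says exactly that `g` of the
  -- compressed data lies in the closed quadrant `C`.
  let g : ℝ × (ℝ × ℝ) → ℝ × ℝ := fun x => (Real.arctan x.1 + x.2.1, x.2.2 - Real.arctan x.1)
  have hg : Continuous g := by
    have := Real.continuous_arctan
    fun_prop
  have key := (hZ.continuous_comp_prodMk_of_tendstoInMeasure_const hg hT hmeas)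
  let C : Set (ℝ × ℝ) := Set.Ici 0 ×ˢ Set.Ici 0
  have hC : MeasurableSet C := measurableSet_Ici.prod measurableSet_Ici
  have hmg : Measurable fun z : ℝ => g (z, (t₁, t₂)) :=
    (hg.comp (by fun_prop : Continuous fun z : ℝ => (z, (t₁, t₂)))).measurable
  have hnull : ∀ t : ℝ, ν {z | Real.arctan z = t} = 0 := fun t =>
    Set.Subsingleton.measure_zero (fun x hx y hy => Real.arctan_injective (hx.trans hy.symm)) ν
  -- The limit hits the boundary of the quadrant only when `arctan z` is `-t₁` or `t₂`, hence for at
  -- most two values of `z`; the limit law has no atoms.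
  have hfr : (ν.map fun z => g (z, (t₁, t₂))) (frontier C) = 0 := by
    rw [Measure.map_apply hmg measurableSet_frontier]
    refine measure_mono_null ?_ (measure_union_null (hnull (-t₁)) (hnull t₂))
    intro z hz
    have hz' : g (z, (t₁, t₂)) ∈ frontier C := hz
    rw [frontier_prod_eq] at hz'
    simp only [closure_Ici, frontier_Ici, Set.mem_union, Set.mem_prod, Set.mem_singleton_iff,
      g] at hz'
    rcases hz' with h | h
    · right
      have := h.2
      simp only [Set.mem_ofPred_eq]
      linarith
    · left
      have := h.1
      simp only [Set.mem_ofPred_eq]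
      linarith
  have hlim := ProbabilityMeasure.tendsto_measure_of_null_frontier_of_tendsto' key.tendsto
    (E := C) hfr
  simp only [ProbabilityMeasure.coe_mk] at hlim
  refine ⟨(ν.map fun z => g (z, (t₁, t₂))).real C, ?_, ?_⟩
  · have := (ENNReal.tendsto_toReal (measure_ne_top _ _)).comp hlim
    refine this.congr fun n => ?_
    simp only [Function.comp, measureReal_def]
    rw [Measure.map_apply_of_aemeasurable (key.forall_aemeasurable n) hC]
    congr 2
    ext ω
    simp only [C, g, Set.mem_preimage, Set.mem_prod, Set.mem_Ici, Set.mem_ofPred_eq]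
    have e1 : 0 ≤ Real.arctan (Z n ω) + Real.arctan (T₁ n ω) ↔ -T₁ n ω ≤ Z n ω := by
      rw [← Real.arctan_strictMono.le_iff_le (a := -T₁ n ω), Real.arctan_neg, neg_le_iff_add_nonneg]
    have e2 : 0 ≤ Real.arctan (T₂ n ω) - Real.arctan (Z n ω) ↔ Z n ω ≤ T₂ n ω := by
      rw [← Real.arctan_strictMono.le_iff_le (a := Z n ω), sub_nonneg]
    rw [e1, e2]
  · rw [map_measureReal_apply hmg hC]
    refine measureReal_mono fun z hz => ?_
    have a1 := Real.arctan_strictMono.monotone hz.1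
    have a2 := Real.arctan_strictMono.monotone hz.2
    rw [Real.arctan_neg] at a1
    simp only [C, g, Set.mem_preimage, Set.mem_prod, Set.mem_Ici]
    constructor <;> linarith

end HDG

namespace HDG

/-! ## Monte Carlo means -/

/-! ### Identities and pathwise inequalities for sample means and variances -/

section Algebra

variable {Q : ℕ} (Y : ℕ → Fin Q → ℝ) (M : ℕ)

lemma mcMean_mono {s t : (Fin Q → ℝ) → ℝ} (h : ∀ y, s y ≤ t y) : mcMean s Y M ≤ mcMean t Y M :=
  mul_le_mul_of_nonneg_left (Finset.sum_le_sum fun m _ => h (Y m)) (by positivity)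

lemma mcMean_nonneg {s : (Fin Q → ℝ) → ℝ} (h : ∀ y, 0 ≤ s y) : 0 ≤ mcMean s Y M :=
  mul_nonneg (by positivity) (Finset.sum_nonneg fun m _ => h (Y m))

lemma mcMean_add (s t : (Fin Q → ℝ) → ℝ) :
    mcMean (fun y => s y + t y) Y M = mcMean s Y M + mcMean t Y M := by
  simp only [mcMean, Finset.sum_add_distrib, mul_add]

lemma mcMean_sub (s t : (Fin Q → ℝ) → ℝ) :
    mcMean (fun y => s y - t y) Y M = mcMean s Y M - mcMean t Y M := by
  simp only [mcMean, Finset.sum_sub_distrib, mul_sub]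

lemma mul_mcMean (hM : 0 < M) (s : (Fin Q → ℝ) → ℝ) :
    M * mcMean s Y M = ∑ m ∈ Finset.range M, s (Y m) := by
  have : (M : ℝ) ≠ 0 := by positivity
  rw [mcMean]; field_simp

lemma sum_sq_mcMean_sub (hM : 0 < M) (s : (Fin Q → ℝ) → ℝ) :
    ∑ m ∈ Finset.range M, (mcMean s Y M - s (Y m)) ^ 2
      = M * (mcMean (fun y => s y ^ 2) Y M - mcMean s Y M ^ 2) := by
  have h1 := mul_mcMean Y M hM s
  have h2 := mul_mcMean Y M hM fun y => s y ^ 2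
  simp only [sub_sq, Finset.sum_add_distrib, Finset.sum_sub_distrib, Finset.sum_const,
    Finset.card_range, nsmul_eq_mul, ← Finset.mul_sum]
  rw [← h1, ← h2]
  ring

lemma mcVar_eq (hM : 0 < M) (s : (Fin Q → ℝ) → ℝ) :
    mcVar s Y M = M / ((M : ℝ) - 1) * (mcMean (fun y => s y ^ 2) Y M - mcMean s Y M ^ 2) := by
  rw [mcVar, sum_sq_mcMean_sub Y M hM]; ring

/-- Only sample means remain on the right, so the law of large numbers applies to each factor. -/
lemma mcVarBound_eq (hM : 0 < M) (s r : (Fin Q → ℝ) → ℝ) :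
    mcVarBound s r Y M = M / ((M : ℝ) - 1) * (mcMean (fun y => r y * (r y + 2 * |s y|)) Y M
      + mcMean r Y M * mcMean (fun y => r y + 2 * |s y|) Y M) := by
  have h1 := mul_mcMean Y M hM fun y => r y * (r y + 2 * |s y|)
  have h2 := mul_mcMean Y M hM fun y => r y + 2 * |s y|
  simp only [mcVarBound, add_mul (r _), Finset.sum_add_distrib (f := fun m => r (Y m) * _),
    ← Finset.mul_sum]
  rw [← h1, ← h2]
  ring

variable {s t r : (Fin Q → ℝ) → ℝ} (h : ∀ y, |s y - t y| ≤ r y)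

include h

/-- The sample variance of `s` is at most the bound computed from the approximation `t`. -/
lemma mcVar_le (hM : 1 < M) : mcVar s Y M ≤ mcVar t Y M + mcVarBound t r Y M := by
  have hM1 : (0 : ℝ) < (M : ℝ) - 1 := by
    rw [sub_pos]; exact_mod_cast hM
  rw [mcVar, mcVar, mcVarBound, ← mul_add, ← Finset.sum_add_distrib]
  refine mul_le_mul_of_nonneg_left ?_ (by positivity)
  set δ : (Fin Q → ℝ) → ℝ := fun y => s y - t y with hδ
  have hsδ : mcMean s Y M = mcMean t Y M + mcMean δ Y M := by
    rw [hδ, mcMean_sub]; ring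
  have hsum0 : ∑ m ∈ Finset.range M, (mcMean δ Y M - δ (Y m)) = 0 := by
    rw [Finset.sum_sub_distrib, ← mul_mcMean Y M (by omega)]; simp
  have hδr : |mcMean δ Y M| ≤ mcMean r Y M := by
    rw [abs_le]
    constructor
    · have := mcMean_nonneg Y M (s := fun y => r y + δ y) fun y => by
        have := (abs_le.1 (h y)).1; simp only [hδ]; linarith
      rw [mcMean_add] at this; linarith
    · exact mcMean_mono Y M fun y => (abs_le.1 (h y)).2
  -- Expanding the square with `s = t + δ` leaves one term whose first factor does not depend on
  -- `m`; it drops out because deviations from the mean sum to zero. What remains matches the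
  -- summands of `mcVarBound`.
  have key : ∑ m ∈ Finset.range M, (mcMean s Y M - s (Y m)) ^ 2
      = ∑ m ∈ Finset.range M, ((mcMean t Y M - t (Y m)) ^ 2
        + (δ (Y m) - mcMean δ Y M) * (δ (Y m) + 2 * t (Y m))) := by
    have : ∀ m, (mcMean s Y M - s (Y m)) ^ 2 = ((mcMean t Y M - t (Y m)) ^ 2
        + (δ (Y m) - mcMean δ Y M) * (δ (Y m) + 2 * t (Y m)))
        + (mcMean δ Y M + 2 * mcMean t Y M) * (mcMean δ Y M - δ (Y m)) := by
      intro m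
      rw [hsδ]
      simp only [hδ]
      ring
    simp only [this]
    rw [Finset.sum_add_distrib, ← Finset.mul_sum, hsum0, mul_zero, add_zero]
  rw [key]
  refine Finset.sum_le_sum fun m _ => ?_
  refine add_le_add le_rfl ?_
  refine (le_abs_self _).trans ?_
  rw [abs_mul]
  have e1 : |δ (Y m) - mcMean δ Y M| ≤ r (Y m) + mcMean r Y M :=
    (abs_sub _ _).trans (add_le_add (h _) hδr)
  have e2 : |δ (Y m) + 2 * t (Y m)| ≤ r (Y m) + 2 * |t (Y m)| := by
    refine (abs_add_le _ _).trans (add_le_add (h _) ?_)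
    rw [abs_mul]; simp
  exact mul_le_mul e1 e2 (abs_nonneg _) ((abs_nonneg _).trans e1)

/-- Each summand of `mcVarBound` contains `r²` and otherwise nonnegative terms, and `1 / M ≤ 1 / (M
- 1)`. Hence the variance estimate diverges when `r` is not square integrable. -/
lemma mcMean_sq_le (hM : 1 < M) :
    mcMean (fun y => r y ^ 2) Y M ≤ mcVar t Y M + mcVarBound t r Y M := by
  have hM1 : (0 : ℝ) < (M : ℝ) - 1 := by
    rw [sub_pos]; exact_mod_cast hM
  have hr : ∀ y, 0 ≤ r y := fun y => (abs_nonneg _).trans (h y)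
  have h0 : 0 ≤ mcVar t Y M :=
    mul_nonneg (by positivity) (Finset.sum_nonneg fun m _ => sq_nonneg _)
  refine le_trans ?_ (le_add_of_nonneg_left h0)
  refine mul_le_mul (one_div_le_one_div_of_le hM1 (by linarith))
    (Finset.sum_le_sum fun m _ => ?_) (Finset.sum_nonneg fun m _ => sq_nonneg _) (by positivity)
  have := mcMean_nonneg Y M hr
  have := hr (Y m)
  have := abs_nonneg (t (Y m))
  nlinarith [mul_nonneg (mcMean_nonneg Y M hr) (hr (Y m)),
    mul_nonneg (mcMean_nonneg Y M hr) (abs_nonneg (t (Y m))),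
    mul_nonneg (hr (Y m)) (abs_nonneg (t (Y m)))]

end Algebra

/-! ### Laws of large numbers along the samples, with and without integrability -/

section Sampling

variable {Q : ℕ} {Ω : Type*} [MeasurableSpace Ω] {P : Measure Ω}
  {μ : Measure (Fin Q → ℝ)} {Y : ℕ → Ω → Fin Q → ℝ} (hYm : ∀ m, Measurable (Y m))
  (hYi : iIndepFun Y P) (hYl : ∀ m, P.map (Y m) = μ)

include hYm hYl in
lemma identDistrib_comp {f : (Fin Q → ℝ) → ℝ} (hf : Measurable f) (m : ℕ) :
    IdentDistrib (fun ω => f (Y m ω)) (fun ω => f (Y 0 ω)) P P :=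
  IdentDistrib.comp ⟨(hYm m).aemeasurable, (hYm 0).aemeasurable, (hYl m).trans (hYl 0).symm⟩ hf

include hYm hYi hYl

/-- The strong law of large numbers for Monte Carlo means. -/
lemma tendsto_mcMean {f : (Fin Q → ℝ) → ℝ} (hf : Measurable f) (hfi : Integrable f μ) :
    ∀ᵐ ω ∂P, Tendsto (fun M => mcMean f (fun m => Y m ω) M) atTop (𝓝 (∫ y, f y ∂μ)) := by
  have hi : Integrable (fun ω => f (Y 0 ω)) P := by
    rw [← hYl 0] at hfi
    exact hfi.comp_measurable (hYm 0)
  have key := strong_law_ae_real (fun m ω => f (Y m ω)) hi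
    (fun i j hij => (hYi.comp (fun _ => f) fun _ => hf).indepFun hij)
    (identDistrib_comp hYm hYl hf)
  have e : ∫ ω, f (Y 0 ω) ∂P = ∫ y, f y ∂μ := by
    rw [← hYl 0, integral_map (hYm 0).aemeasurable hf.aestronglyMeasurable]
  rw [e] at key
  filter_upwards [key] with ω hω
  refine hω.congr fun M => ?_
  rw [mcMean]; ring

/-- Monte Carlo means of a nonnegative function that is not integrable diverge. -/
lemma tendsto_mcMean_atTop [IsFiniteMeasure μ] {f : (Fin Q → ℝ) → ℝ} (hf : Measurable f)
    (h0 : ∀ y, 0 ≤ f y) (hfi : ¬ Integrable f μ) :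
    ∀ᵐ ω ∂P, Tendsto (fun M => mcMean f (fun m => Y m ω) M) atTop atTop := by
  have hmk : ∀ k : ℕ, Measurable fun y => min (f y) k := fun k => hf.min measurable_const
  have h0k : ∀ (k : ℕ) y, 0 ≤ min (f y) k := fun k y => le_min (h0 y) (by positivity)
  have hik : ∀ k : ℕ, Integrable (fun y => min (f y) k) μ := fun k =>
    Integrable.of_bound (hmk k).aestronglyMeasurable (k : ℝ) (ae_of_all _ fun y => by
      rw [Real.norm_of_nonneg (h0k k y)]; exact min_le_right _ _)
  -- If the integrals of the truncations `min f k` were bounded, monotone convergence would make `f`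
  -- integrable.
  have hunb : ∀ c : ℝ, ∃ k : ℕ, c < ∫ y, min (f y) k ∂μ := by
    by_contra! hc
    obtain ⟨c, hc⟩ := hc
    refine hfi ⟨hf.aestronglyMeasurable, ?_⟩
    have hlim := lintegral_tendsto_of_tendsto_of_monotone (μ := μ)
      (f := fun (k : ℕ) y => ENNReal.ofReal (min (f y) k)) (F := fun y => ENNReal.ofReal (f y))
      (fun k => (hmk k).ennreal_ofReal.aemeasurable)
      (ae_of_all _ fun y i j hij => ENNReal.ofReal_le_ofReal
        (min_le_min_left _ (by exact_mod_cast hij)))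
      (ae_of_all _ fun y => by
        obtain ⟨n, hn⟩ := exists_nat_ge (f y)
        refine tendsto_const_nhds.congr' ?_
        filter_upwards [eventually_ge_atTop n] with k hk
        rw [min_eq_left (hn.trans (by exact_mod_cast hk))])
    have hle : ∫⁻ y, ENNReal.ofReal (f y) ∂μ ≤ ENNReal.ofReal c := by
      refine le_of_tendsto' hlim fun k => ?_
      rw [← ofReal_integral_eq_lintegral_ofReal (hik k) (ae_of_all _ (h0k k))]
      exact ENNReal.ofReal_le_ofReal (hc k)
    rw [hasFiniteIntegral_iff_ofReal (ae_of_all _ h0)]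
    exact hle.trans_lt ENNReal.ofReal_lt_top
  -- Countably many truncations: on one almost sure event the strong law holds for all of them, and
  -- the means of `f` dominate each.
  have hall := ae_all_iff.2 fun k : ℕ => tendsto_mcMean hYm hYi hYl (hmk k) (hik k)
  filter_upwards [hall] with ω hω
  refine tendsto_atTop.2 fun c => ?_
  obtain ⟨k, hk⟩ := hunb c
  filter_upwards [(hω k).eventually_const_lt hk] with M hM
  exact hM.le.trans (mcMean_mono _ _ fun y => min_le_left _ _)

end Sampling

end HDG

namespace HDG

lemma HasLimitGE.add {Ω : Type*} [MeasurableSpace Ω] {P : Measure Ω} {T T' : ℕ → Ω → ℝ}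
    {s s' : ℝ} (h : HasLimitGE P T s) (h' : HasLimitGE P T' s') :
    HasLimitGE P (fun n ω => T n ω + T' n ω) (s + s') := by
  rcases h with ⟨t, ht, h⟩ | h <;> rcases h' with ⟨t', ht', h'⟩ | h'
  · refine .inl ⟨t + t', add_le_add ht ht', ?_⟩
    filter_upwards [h, h'] with ω h₁ h₂ using h₁.add h₂
  · refine .inr ?_
    filter_upwards [h, h'] with ω h₁ h₂ using h₁.add_atTop h₂
  · refine .inr ?_
    filter_upwards [h, h'] with ω h₁ h₂ using h₁.atTop_add h₂
  · refine .inr ?_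
    filter_upwards [h, h'] with ω h₁ h₂ using Tendsto.atTop_add_atTop h₁ h₂

/-! ## Coverage of the Monte Carlo confidence interval -/

lemma tendsto_natCast_div_sub_one : Tendsto (fun M : ℕ => (M : ℝ) / ((M : ℝ) - 1)) atTop (𝓝 1) :=
  tendsto_natCast_div_add_atTop (-1 : ℝ)

lemma tendsto_sqrt_natCast : Tendsto (fun M : ℕ => √(M : ℝ)) atTop atTop :=
  Real.tendsto_sqrt_atTop.comp tendsto_natCast_atTop_atTop

variable {Q : ℕ} {Ω : Type*} [MeasurableSpace Ω] {P : Measure Ω}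
  {μ : Measure (Fin Q → ℝ)} {Y : ℕ → Ω → Fin Q → ℝ} (hYm : ∀ m, Measurable (Y m))
  (hYi : iIndepFun Y P) (hYl : ∀ m, P.map (Y m) = μ)

include hYm hYl in
lemma ae_forall_sample {p : (Fin Q → ℝ) → Prop} (h : ∀ᵐ y ∂μ, p y) : ∀ᵐ ω ∂P, ∀ m, p (Y m ω) :=
  ae_all_iff.2 fun m => ae_of_ae_map (hYm m).aemeasurable (by rwa [hYl m])

section

variable [IsProbabilityMeasure μ]

include hYm hYi hYl

/-- Three cases: `f` vanishes almost everywhere and the expression is zero; `f` has positive finite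
integral and `√M` drives it to infinity; or `f` is not integrable and the means already diverge. -/
lemma hasLimitGE_sqrt_mul_mcMean {f : (Fin Q → ℝ) → ℝ} (hf : Measurable f) (h0 : ∀ y, 0 ≤ f y) :
    HasLimitGE P (fun M ω => √M * mcMean f (fun m => Y m ω) M) 0 := by
  by_cases hfi : Integrable f μ
  · rcases (integral_nonneg h0 : 0 ≤ ∫ y, f y ∂μ).eq_or_lt with h | h
    · have hz : ∀ᵐ y ∂μ, f y = 0 := (integral_eq_zero_iff_of_nonneg h0 hfi).1 h.symm
      refine .inl ⟨0, le_rfl, ?_⟩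
      filter_upwards [ae_forall_sample hYm hYl hz] with ω hω
      simp [mcMean, hω]
    · refine .inr ?_
      filter_upwards [tendsto_mcMean hYm hYi hYl hf hfi] with ω hω
      exact tendsto_sqrt_natCast.atTop_mul_pos h hω
  · refine .inr ?_
    filter_upwards [tendsto_mcMean_atTop hYm hYi hYl hf h0 hfi] with ω hω
    exact tendsto_sqrt_natCast.atTop_mul_atTop₀ hω

lemma tendsto_mcVar {s : (Fin Q → ℝ) → ℝ} (hs : Measurable s) (hs2 : MemLp s 2 μ) :
    ∀ᵐ ω ∂P, Tendsto (fun M => mcVar s (fun m => Y m ω) M) atTop (𝓝 Var[s; μ]) := by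
  filter_upwards [tendsto_mcMean hYm hYi hYl hs (hs2.integrable one_le_two),
    tendsto_mcMean hYm hYi hYl (hs.pow_const 2) hs2.integrable_sq] with ω h1 h2
  have := tendsto_natCast_div_sub_one.mul (h2.sub (h1.pow 2))
  rw [one_mul] at this
  rw [variance_eq_sub hs2]
  refine this.congr' ?_
  filter_upwards [eventually_gt_atTop 0] with M hM
  rw [mcVar_eq _ _ hM]

variable {s t r : (Fin Q → ℝ) → ℝ} (hs : Measurable s) (ht : Measurable t) (hr : Measurable r)
  {C : ℝ} (hsC : ∀ y, |s y| ≤ C) (hst : ∀ y, |s y - t y| ≤ r y)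

include hs ht hr hsC hst

/-- The case split is whether `r` is square integrable. If so, then so is `t`, as `s` is bounded and
`|s - t| ≤ r`, and all the sample moments converge. If not, `mcMean_sq_le` forces divergence. -/
lemma hasLimitGE_mcVar_add_mcVarBound :
    HasLimitGE P (fun M ω => mcVar t (fun m => Y m ω) M + mcVarBound t r (fun m => Y m ω) M)
      Var[s; μ] := by
  have hs2 : MemLp s 2 μ := MemLp.of_bound hs.aestronglyMeasurable C (ae_of_all _ hsC)
  by_cases hri : Integrable (fun y => r y ^ 2) μ
  · have hr2 : MemLp r 2 μ := (memLp_two_iff_integrable_sq hr.aestronglyMeasurable).2 hri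
    have ht2 : MemLp t 2 μ := by
      have : MemLp (fun y => s y - t y) 2 μ :=
        hr2.mono (hs.sub ht).aestronglyMeasurable (ae_of_all _ fun y =>
          (hst y).trans (le_abs_self _))
      refine (hs2.sub this).ae_eq (ae_of_all _ fun y => ?_)
      simp
    have hu2 : MemLp (fun y => r y + 2 * |t y|) 2 μ := hr2.add (ht2.abs.const_mul 2)
    have hu : Measurable fun y => r y + 2 * |t y| := by fun_prop
    have key : ∀ᵐ ω ∂P, Tendsto
        (fun M => mcVar t (fun m => Y m ω) M + mcVarBound t r (fun m => Y m ω) M) atTop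
        (𝓝 (Var[t; μ] + 1 * (∫ y, r y * (r y + 2 * |t y|) ∂μ
          + (∫ y, r y ∂μ) * ∫ y, r y + 2 * |t y| ∂μ))) := by
      filter_upwards [tendsto_mcVar hYm hYi hYl ht ht2,
        tendsto_mcMean hYm hYi hYl (hr.mul hu) (hr2.integrable_mul hu2),
        tendsto_mcMean hYm hYi hYl hr (hr2.integrable one_le_two),
        tendsto_mcMean hYm hYi hYl hu (hu2.integrable one_le_two)] with ω h1 h2 h3 h4
      refine h1.add ((tendsto_natCast_div_sub_one.mul (h2.add (h3.mul h4))).congr' ?_)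
      filter_upwards [eventually_gt_atTop 0] with M hM
      rw [mcVarBound_eq _ _ hM]
      rfl
    refine .inl ⟨_, ?_, key⟩
    -- Both limits are constants, so comparing them along a single sample path is enough; a nonzero
    -- `P` guarantees that such a path exists.
    have : NeZero P := ⟨fun h0 => by
      have := hYl 0
      rw [h0, Measure.map_zero] at this
      exact IsProbabilityMeasure.ne_zero μ this.symm⟩
    obtain ⟨ω, h1, h2⟩ := (key.and (tendsto_mcVar hYm hYi hYl hs hs2)).exists
    refine le_of_tendsto_of_tendsto h2 h1 ?_
    filter_upwards [eventually_gt_atTop 1] with M hM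
    exact mcVar_le _ _ hst hM
  · refine .inr ?_
    filter_upwards [tendsto_mcMean_atTop hYm hYi hYl (hr.pow_const 2) (fun y => sq_nonneg _) hri]
      with ω hω
    refine tendsto_atTop_mono' _ ?_ hω
    filter_upwards [eventually_gt_atTop 1] with M hM
    exact mcMean_sq_le _ _ hst hM

end

include hYm in
lemma measurable_mcMean {s : (Fin Q → ℝ) → ℝ} (hs : Measurable s) (M : ℕ) :
    Measurable fun ω => mcMean s (fun m => Y m ω) M :=
  (Finset.measurable_fun_sum _ fun m _ => hs.comp (hYm m)).const_mul _

lemma HasLimitGE.const_mul_sqrt {T : ℕ → Ω → ℝ} {v a : ℝ} (ha : 0 < a) (h : HasLimitGE P T v) :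
    HasLimitGE P (fun n ω => a * √(T n ω)) (a * √v) := by
  rcases h with ⟨t, ht, h⟩ | h
  · exact .inl ⟨a * √t, by gcongr, h.mono fun ω hω =>
      ((Real.continuous_sqrt.tendsto t).comp hω).const_mul a⟩
  · exact .inr (h.mono fun ω hω => (Real.tendsto_sqrt_atTop.comp hω).const_mul_atTop ha)

include hYm hYi hYl

/-- Monte Carlo confidence interval for the mean of `s` from samples of an approximation `t` of `s`
with error at most `r`. -/
theorem exists_tendsto_measureReal_mcTotalBound [IsProbabilityMeasure P]
    {s t r : (Fin Q → ℝ) → ℝ} (hs : Measurable s) (ht : Measurable t)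
    (hr : Measurable r) {C : ℝ} (hsC : ∀ y, |s y| ≤ C) (hst : ∀ y, |s y - t y| ≤ r y)
    {a : ℝ} (ha : 0 < a) :
    ∃ L : ℝ, Tendsto (fun M : ℕ => P.real {ω | |∫ y, s y ∂μ - mcMean t (fun m => Y m ω) M|
        ≤ mcTotalBound a t r (fun m => Y m ω) M}) atTop (𝓝 L) ∧ erf (a / √2) ≤ L := by
  have : IsProbabilityMeasure μ := by
    rw [← hYl 0]; exact Measure.isProbabilityMeasure_map (hYm 0).aemeasurable
  have hs2 : MemLp s 2 μ := MemLp.of_bound hs.aestronglyMeasurable C (ae_of_all _ hsC)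
  set e := ∫ y, s y ∂μ
  have hr0 : ∀ y, 0 ≤ r y := fun y => (abs_nonneg _).trans (hst y)
  let W : ℕ → Ω → ℝ := fun M ω =>
    mcVar t (fun m => Y m ω) M + mcVarBound t r (fun m => Y m ω) M
  -- In the degenerate case the normal limit would have an atom and the Slutsky argument fails. But
  -- then `s` is almost surely its mean, and the error is at most the sample mean of `r`.
  by_cases hv : Var[s; μ] = 0
  · refine ⟨1, ?_, erf_le_one ha⟩
    have hse : ∀ᵐ y ∂μ, s y = e := ae_eq_integral_of_variance_eq_zero hs2 hv
    refine tendsto_const_nhds.congr' ?_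
    filter_upwards [eventually_gt_atTop 0] with M hM
    rw [← probReal_univ (μ := P)]
    refine measureReal_congr ?_
    filter_upwards [ae_forall_sample hYm hYl hse] with ω hω
    refine propext ⟨fun _ => ?_, fun _ => trivial⟩
    have hM' : (M : ℝ) ≠ 0 := by positivity
    have hmean : mcMean s (fun m => Y m ω) M = e := by
      simp [mcMean, hω, hM']
    have h1 : mcMean s (fun m => Y m ω) M - mcMean t (fun m => Y m ω) M
        ≤ mcMean r (fun m => Y m ω) M := by
      rw [← mcMean_sub]
      exact mcMean_mono _ _ fun y => (abs_le.1 (hst y)).2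
    have h2 : mcMean t (fun m => Y m ω) M - mcMean s (fun m => Y m ω) M
        ≤ mcMean r (fun m => Y m ω) M := by
      rw [← mcMean_sub]
      exact mcMean_mono _ _ fun y => by linarith [(abs_le.1 (hst y)).1]
    rw [hmean] at h1 h2
    refine (abs_le.2 ⟨?_, h1⟩).trans (le_add_of_nonneg_left (by positivity))
    linarith
  -- The one-sided slacks `r ∓ (s - t)` are put into the endpoints, so that `Z` involves only the
  -- bounded function `s`, to which the central limit theorem applies.
  let Z : ℕ → Ω → ℝ := fun M ω => (√M)⁻¹ * (∑ m ∈ Finset.range M, s (Y m ω) - M * e)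
  let T₁ : ℕ → Ω → ℝ := fun M ω =>
    a * √(W M ω) + √M * mcMean (fun y => r y - (s y - t y)) (fun m => Y m ω) M
  let T₂ : ℕ → Ω → ℝ := fun M ω =>
    a * √(W M ω) + √M * mcMean (fun y => r y + (s y - t y)) (fun m => Y m ω) M
  have hWm : ∀ M, Measurable (W M) := by
    intro M
    have h1 := measurable_mcMean hYm ht M
    have h2 := measurable_mcMean hYm hr M
    simp only [W, mcVar, mcVarBound]
    fun_prop
  have hW := (hasLimitGE_mcVar_add_mcVarBound hYm hYi hYl hs ht hr hsC hst).const_mul_sqrt ha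
  have hm₁ : Measurable fun y => r y - (s y - t y) := by fun_prop
  have hm₂ : Measurable fun y => r y + (s y - t y) := by fun_prop
  have hT₁ : HasLimitGE P T₁ (a * √Var[s; μ]) := by
    simpa using hW.add (hasLimitGE_sqrt_mul_mcMean hYm hYi hYl hm₁ fun y =>
      sub_nonneg.2 (abs_le.1 (hst y)).2)
  have hT₂ : HasLimitGE P T₂ (a * √Var[s; μ]) := by
    simpa using hW.add (hasLimitGE_sqrt_mul_mcMean hYm hYi hYl hm₂ fun y => by
      linarith [(abs_le.1 (hst y)).1])
  have hT₁m : ∀ M, AEMeasurable (T₁ M) P := fun M =>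
    (((hWm M).sqrt.const_mul a).add ((measurable_mcMean hYm hm₁ M).const_mul _)).aemeasurable
  have hT₂m : ∀ M, AEMeasurable (T₂ M) P := fun M =>
    (((hWm M).sqrt.const_mul a).add ((measurable_mcMean hYm hm₂ M).const_mul _)).aemeasurable
  set v : NNReal := Var[s; μ].toNNReal with hv_def
  have hvr : (v : ℝ) = Var[s; μ] := Real.coe_toNNReal _ (variance_nonneg _ _)
  have hv0 : v ≠ 0 := fun h => hv (by rw [← hvr, h]; rfl)
  have hZ : TendstoInDistribution Z atTop id (fun _ => P) (gaussianReal 0 v) := by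
    have hvar : Var[fun ω => s (Y 0 ω); P] = Var[s; μ] := by
      rw [← hYl 0, variance_map hs.aemeasurable (hYm 0).aemeasurable]; rfl
    have he : ∫ ω, s (Y 0 ω) ∂P = e := by
      rw [← integral_map (hYm 0).aemeasurable hs.aestronglyMeasurable, hYl 0]
    have := tendstoInDistribution_inv_sqrt_mul_sum_sub (P := P) (P' := gaussianReal 0 v)
      (X := fun m ω => s (Y m ω)) (Y := id)
      (by rw [hvar]; exact HasLaw.id)
      (MemLp.of_bound (hs.comp (hYm 0)).aestronglyMeasurable C (ae_of_all _ fun ω => hsC _))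
      (hYi.comp (fun _ => s) fun _ => hs) (identDistrib_comp hYm hYl hs)
    simpa only [he] using this
  have : NullSingletonClass (gaussianReal 0 v) := nullSingletonClass_gaussianReal hv0
  obtain ⟨L, hL, hle⟩ := exists_tendsto_measureReal_interval hZ hT₁m hT₂m hT₁ hT₂
  rw [← hvr, gaussianReal_Icc hv0 ha] at hle
  refine ⟨L, hL.congr' ?_, hle⟩
  filter_upwards [eventually_gt_atTop 0] with M hM
  congr 1
  ext ω
  have hMs : 0 < √(M : ℝ) := Real.sqrt_pos.2 (by exact_mod_cast hM)
  have hMM : (M : ℝ) = √M * √M := (Real.mul_self_sqrt (by positivity)).symm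
  have hZe : Z M ω = √M * (mcMean s (fun m => Y m ω) M - e) := by
    simp only [Z]
    rw [← mul_mcMean (fun m => Y m ω) M hM s, ← mul_sub, ← mul_assoc]
    congr 1
    rw [inv_mul_eq_iff_eq_mul₀ hMs.ne']
    exact hMM
  have hWe : a * √(W M ω) = √M * (a * √(W M ω / M)) := by
    rw [Real.sqrt_div' _ (by positivity)]; field_simp
  simp only [Set.mem_ofPred_eq, T₁, T₂, hZe, hWe, mcMean_sub, mcMean_add, mcTotalBound, W,
    ← mul_add, ← mul_neg, mul_le_mul_iff_right₀ hMs]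
  rw [abs_le]
  constructor
  · rintro ⟨h1, h2⟩
    constructor <;> linarith
  · rintro ⟨h1, h2⟩
    constructor <;> linarith

end HDG

namespace HDG

open scoped ComplexConjugate Matrix

/-! ## Sesquilinear forms on finite-dimensional spaces -/

/-- A definite inner product, or rather its Hermitian part, as an inner product space core. -/
noncomputable abbrev hermitianCore {V : Type*} [AddCommGroup V] [Module ℂ V] (B : V →ₗ[ℂ] V →ₗ⋆[ℂ] ℂ)
    (hB : ∀ w, w ≠ 0 → 0 < (B w w).re) : InnerProductSpace.Core ℂ V where
  inner x y := (B y x + conj (B x y)) / 2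
  conj_inner_symm x y := by
    simp only [map_div₀, map_add, Complex.conj_conj, map_ofNat]
    ring
  re_inner_nonneg x := by
    rcases eq_or_ne x 0 with rfl | hx
    · simp
    · have := hB x hx
      rw [Complex.add_conj]
      simp only [RCLike.re_to_complex]
      norm_num
      exact this.le
  add_left x y z := by
    simp only [map_add, LinearMap.add_apply]
    ring
  smul_left x y r := by
    simp only [LinearMap.map_smulₛₗ, LinearMap.smul_apply, smul_eq_mul, map_mul, RingHom.id_apply]
    ring
  definite x hx := by
    by_contra h
    have := hB x h
    rw [Complex.add_conj] at hx
    have h2 := congrArg Complex.re hx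
    norm_num at h2
    linarith

/-- `B` is not assumed Hermitian, but its Hermitian part is an inner product with squared norm `(B w
w).re`, and linear functionals on a finite-dimensional space are continuous. -/
lemma exists_norm_le_mul_sqrt {V : Type*} [AddCommGroup V] [Module ℂ V] [FiniteDimensional ℂ V]
    (B : V →ₗ[ℂ] V →ₗ⋆[ℂ] ℂ) (hB : ∀ w, w ≠ 0 → 0 < (B w w).re) (l : V →ₗ[ℂ] ℂ) :
    ∃ C, ∀ w, ‖l w‖ ≤ C * √(B w w).re := by
  let c := hermitianCore B hB
  let _ : NormedAddCommGroup V := c.toNormedAddCommGroup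
  let _ : InnerProductSpace ℂ V := InnerProductSpace.ofCore c.toCore
  refine ⟨‖LinearMap.toContinuousLinearMap l‖, fun w => ?_⟩
  have h := (LinearMap.toContinuousLinearMap l).le_opNorm w
  have hn : ‖w‖ = √(B w w).re := by
    rw [norm_eq_sqrt_re_inner (𝕜 := ℂ) w]
    congr 1
    change ((B w w + conj (B w w)) / 2).re = _
    rw [Complex.add_conj]
    norm_num
  rw [hn] at h
  exact h

/-- The solution of a linear system with a nondegenerate form depends continuously on the form. -/
lemma continuousOn_solution {V X : Type*} [AddCommGroup V] [Module ℂ V] [FiniteDimensional ℂ V]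
    [TopologicalSpace X] (A : X → V →ₗ[ℂ] V →ₗ⋆[ℂ] ℂ) (hA : ∀ v w, Continuous fun y => A y v w)
    {K : Set X} (hK : ∀ y ∈ K, ∀ w, (∀ v, A y w v = 0) → w = 0) {u : X → V} {b : V → ℂ}
    (hu : ∀ y ∈ K, ∀ w, A y (u y) w = b w) (l : V →ₗ[ℂ] ℂ) :
    ContinuousOn (fun y => l (u y)) K := by
  let e := Module.finBasis ℂ V
  let M : X → Matrix (Fin (Module.finrank ℂ V)) (Fin (Module.finrank ℂ V)) ℂ :=
    fun y => Matrix.of fun j i => A y (e i) (e j)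
  have hM : Continuous M := continuous_matrix fun i j => hA _ _
  have hMv : ∀ y (c : Fin (Module.finrank ℂ V) → ℂ),
      M y *ᵥ c = fun j => A y (∑ i, c i • e i) (e j) := by
    intro y c
    funext j
    simp only [Matrix.mulVec, dotProduct, M, Matrix.of_apply, map_sum, map_smul,
      LinearMap.sum_apply, LinearMap.smul_apply, smul_eq_mul, mul_comm]
  -- A kernel vector of the matrix gives the coordinates of some `w` with `A y w = 0`; nondegeneracy
  -- makes `w` zero, against independence of the basis.
  have hdet : ∀ y ∈ K, (M y).det ≠ 0 := by
    intro y hy h0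
    obtain ⟨c, hc, h⟩ := Matrix.exists_mulVec_eq_zero_iff.2 h0
    rw [hMv] at h
    have hw : ∑ i, c i • e i = 0 := by
      refine hK y hy _ fun v => ?_
      have : A y (∑ i, c i • e i) = 0 := e.ext fun j => congrFun h j
      rw [this, LinearMap.zero_apply]
    exact hc (funext fun i => Fintype.linearIndependent_iff.1 e.linearIndependent c hw i)
  -- Cramer's rule: the coordinates of the solution are polynomials in the matrix entries divided by
  -- the determinant, which does not vanish on `K`.
  have hrepr : ∀ y ∈ K, (e.repr (u y) : Fin (Module.finrank ℂ V) → ℂ)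
      = ((M y).det)⁻¹ • ((M y).adjugate *ᵥ fun j => b (e j)) := by
    intro y hy
    have h1 : M y *ᵥ e.repr (u y) = fun j => b (e j) := by
      rw [hMv, e.sum_repr]
      exact funext fun j => hu y hy _
    rw [← h1, Matrix.mulVec_mulVec, Matrix.adjugate_mul, Matrix.smul_mulVec, Matrix.one_mulVec,
      smul_smul, inv_mul_cancel₀ (hdet y hy), one_smul]
  have hl : ∀ y, l (u y) = ∑ i, e.repr (u y) i * l (e i) := by
    intro y
    conv_lhs => rw [← e.sum_repr (u y)]
    simp only [map_sum, map_smul, smul_eq_mul]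
  have hc : ContinuousOn (fun y => ∑ i,
      (((M y).det)⁻¹ • ((M y).adjugate *ᵥ fun j => b (e j))) i * l (e i)) K := by
    refine continuousOn_finsetSum _ fun i _ => ContinuousOn.mul ?_ continuousOn_const
    have h1 : ContinuousOn (fun y => ((M y).det)⁻¹) K :=
      hM.matrix_det.continuousOn.inv₀ hdet
    have h2 : Continuous fun y => (M y).adjugate *ᵥ fun j => b (e j) :=
      hM.matrix_adjugate.matrix_mulVec continuous_const
    exact h1.mul ((continuous_apply i).comp h2).continuousOn
  refine hc.congr fun y hy => ?_
  simp only [hl, hrepr y hy]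

end HDG

namespace HDG

open scoped ComplexConjugate

/-! ## Families of sesquilinear forms that depend affinely on real parameters -/

section AffineSesq

variable {Q : ℕ} {V₁ V₂ : Type*} [AddCommGroup V₁] [Module ℂ V₁] [AddCommGroup V₂] [Module ℂ V₂]

/-- `B y` is a sesquilinear form for each `y` and depends affinely on `y`. -/
def IsAffineSesq (B : (Fin Q → ℝ) → V₁ → V₂ → ℂ) : Prop :=
  ∃ (A₀ : V₁ →ₗ[ℂ] V₂ →ₗ⋆[ℂ] ℂ) (A : Fin Q → V₁ →ₗ[ℂ] V₂ →ₗ⋆[ℂ] ℂ),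
    ∀ y v w, B y v w = A₀ v w + ∑ q, (y q : ℂ) * A q v w

variable {B B' : (Fin Q → ℝ) → V₁ → V₂ → ℂ}

lemma IsAffineSesq.add (h : IsAffineSesq B) (h' : IsAffineSesq B') :
    IsAffineSesq fun y v w => B y v w + B' y v w := by
  obtain ⟨A₀, A, hA⟩ := h
  obtain ⟨A₀', A', hA'⟩ := h'
  refine ⟨A₀ + A₀', fun q => A q + A' q, fun y v w => ?_⟩
  simp only [hA, hA', LinearMap.add_apply, mul_add, Finset.sum_add_distrib]
  ring

lemma IsAffineSesq.neg (h : IsAffineSesq B) : IsAffineSesq fun y v w => -B y v w := by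
  obtain ⟨A₀, A, hA⟩ := h
  refine ⟨-A₀, fun q => -A q, fun y v w => ?_⟩
  simp only [hA, LinearMap.neg_apply, mul_neg, Finset.sum_neg_distrib]
  ring

lemma IsAffineSesq.sub (h : IsAffineSesq B) (h' : IsAffineSesq B') :
    IsAffineSesq fun y v w => B y v w - B' y v w := by
  simpa only [sub_eq_add_neg] using h.add h'.neg

lemma IsAffineSesq.sum {ι : Type*} (s : Finset ι) {B : ι → (Fin Q → ℝ) → V₁ → V₂ → ℂ}
    (h : ∀ i ∈ s, IsAffineSesq (B i)) : IsAffineSesq fun y v w => ∑ i ∈ s, B i y v w := by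
  classical
  induction s using Finset.induction_on with
  | empty => exact ⟨0, 0, fun y v w => by simp⟩
  | insert i s hi ih =>
    simp only [Finset.sum_insert hi]
    exact (h i (Finset.mem_insert_self i s)).add
      (ih fun j hj => h j (Finset.mem_insert_of_mem hj))

/-- At each parameter an affine family of sesquilinear forms is a sesquilinear form. -/
lemma IsAffineSesq.exists_eq (h : IsAffineSesq B) :
    ∃ A : (Fin Q → ℝ) → V₁ →ₗ[ℂ] V₂ →ₗ⋆[ℂ] ℂ,
      (∀ y v w, A y v w = B y v w) ∧ ∀ v w, Continuous fun y => A y v w := by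
  obtain ⟨A₀, A, hA⟩ := h
  refine ⟨fun y => A₀ + ∑ q, (y q : ℂ) • A q, fun y v w => ?_, fun v w => ?_⟩
  · simp [hA, LinearMap.sum_apply]
  · simp only [LinearMap.add_apply, LinearMap.sum_apply, LinearMap.smul_apply]
    fun_prop

/-- `Fin 0 → ℝ` has a single point, so the calculus of affine families also yields the
sesquilinearity of forms without parameters, such as the two liftings and the inner product. -/
lemma exists_sesqForm (B : V₁ → V₂ → ℂ) (h : IsAffineSesq fun (_ : Fin 0 → ℝ) => B) :
    ∃ A : V₁ →ₗ[ℂ] V₂ →ₗ⋆[ℂ] ℂ, ∀ v w, A v w = B v w := by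
  obtain ⟨A, hA, -⟩ := h.exists_eq
  exact ⟨A 0, hA 0⟩

variable {X : Type*} [TopologicalSpace X] [T2Space X] [MeasurableSpace X]
  [OpensMeasurableSpace X] {ν : Measure X} {S : Set X}

lemma integrableOn_mul_mul_conj (hS : IsCompact S) {c P R : X → ℂ} (hc : IntegrableOn c S ν)
    (hP : ContinuousOn P S) (hR : ContinuousOn R S) :
    IntegrableOn (fun x => c x * P x * conj (R x)) S ν := by
  have h : ContinuousOn (fun x => P x * conj (R x)) S :=
    hP.mul (Complex.continuous_conj.comp_continuousOn hR)
  simpa only [mul_assoc] using hc.mul_continuousOn h hS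

lemma exists_sesqForm_integral (hS : IsCompact S) {c : X → ℂ} (hc : IntegrableOn c S ν)
    {P : V₁ →ₗ[ℂ] X → ℂ} {R : V₂ →ₗ[ℂ] X → ℂ} (hP : ∀ v, ContinuousOn (P v) S)
    (hR : ∀ w, ContinuousOn (R w) S) :
    ∃ A : V₁ →ₗ[ℂ] V₂ →ₗ⋆[ℂ] ℂ,
      ∀ v w, A v w = ∫ x in S, c x * P v x * conj (R w x) ∂ν := by
  have hi := fun v w => integrableOn_mul_mul_conj hS hc (hP v) (hR w)
  refine ⟨LinearMap.mk₂'ₛₗ (RingHom.id ℂ) (starRingEnd ℂ)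
    (fun v w => ∫ x in S, c x * P v x * conj (R w x) ∂ν) ?_ ?_ ?_ ?_, fun v w => rfl⟩
  · intro v v' w
    rw [← integral_add (hi v w) (hi v' w)]
    simp only [map_add, Pi.add_apply, mul_add, add_mul]
  · intro a v w
    rw [smul_eq_mul, ← integral_const_mul]
    congr 1
    funext x
    simp only [map_smul, Pi.smul_apply, smul_eq_mul, RingHom.id_apply]
    ring
  · intro v w w'
    rw [← integral_add (hi v w) (hi v w')]
    simp only [map_add, Pi.add_apply, mul_add]
  · intro a v w
    rw [smul_eq_mul, ← integral_const_mul]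
    congr 1
    funext x
    simp only [map_smul, Pi.smul_apply, smul_eq_mul, map_mul]
    ring

lemma isAffineSesq_integral {ι : Type*} [Fintype ι] (hS : IsCompact S) {c₀ : X → ℂ}
    {c : Fin Q → X → ℂ} (hc₀ : IntegrableOn c₀ S ν) (hc : ∀ q, IntegrableOn (c q) S ν)
    {P : ι → V₁ →ₗ[ℂ] X → ℂ} {R : ι → V₂ →ₗ[ℂ] X → ℂ} (hP : ∀ i v, ContinuousOn (P i v) S)
    (hR : ∀ i w, ContinuousOn (R i w) S) :
    IsAffineSesq fun (y : Fin Q → ℝ) v w =>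
      ∫ x in S, ∑ i, (c₀ x + ∑ q, c q x * y q) * P i v x * conj (R i w x) ∂ν := by
  have key : ∀ i ∈ Finset.univ, IsAffineSesq fun (y : Fin Q → ℝ) v w =>
      ∫ x in S, (c₀ x + ∑ q, c q x * y q) * P i v x * conj (R i w x) ∂ν := by
    intro i _
    obtain ⟨A₀, hA₀⟩ := exists_sesqForm_integral hS hc₀ (hP i) (hR i)
    choose A hA using fun q => exists_sesqForm_integral hS (hc q) (hP i) (hR i)
    refine ⟨A₀, A, fun y v w => ?_⟩
    have hi₀ := integrableOn_mul_mul_conj hS hc₀ (hP i v) (hR i w)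
    have hi := fun q => integrableOn_mul_mul_conj hS (hc q) (hP i v) (hR i w)
    simp only [hA₀, hA, ← integral_const_mul]
    rw [← integral_finsetSum _ fun q _ => (hi q).const_mul _,
      ← integral_add hi₀ (integrable_finsetSum _ fun q _ => (hi q).const_mul _)]
    congr 1
    funext x
    simp only [add_mul, Finset.sum_mul]
    congr 1
    exact Finset.sum_congr rfl fun q _ => by ring
  convert IsAffineSesq.sum Finset.univ key using 1
  funext y v w
  refine integral_finsetSum _ fun i _ => integrableOn_mul_mul_conj hS ?_ (hP i v) (hR i w)
  exact hc₀.add (integrable_finsetSum _ fun q _ => (hc q).mul_const _)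

end AffineSesq

/-! ## Integrals over faces -/

variable {d p : ℕ} {𝒯 : Mesh d}

lemma Mesh.Face.isCompact_hull (F : 𝒯.Face) : IsCompact F.hull :=
  F.1.finite_toSet.isCompact_convexHull ℝ

lemma Mesh.Elem.hull_subset_of_mem_faces {T : 𝒯.Elem} {F : 𝒯.Face} (hF : F ∈ T.faces) :
    F.hull ⊆ T.hull :=
  convexHull_mono (by exact_mod_cast (Finset.mem_filter.1 hF).2)

/-- Translation by a vertex `x₀` is an isometry from the `(d - 1)`-dimensional direction space `W`
onto a set containing the face. On `W` the measure is finite on compact sets. -/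
lemma Mesh.Face.measure_hull_lt_top (hd : 0 < d) (F : 𝒯.Face) : μHE[d - 1] F.hull < ⊤ := by
  obtain ⟨x₀, hx₀⟩ : F.1.Nonempty := Finset.card_pos.1 (F.2.2.symm ▸ hd)
  set W := vectorSpan ℝ (F.1 : Set (EuclideanSpace ℝ (Fin d)))
  have hW : Module.finrank ℝ W = d - 1 := by
    have := (𝒯.complex.indep F.2.1).finrank_vectorSpan (n := d - 1)
      (by rw [Fintype.card_coe, F.2.2]; omega)
    have hr : Set.range ((↑) : {x // x ∈ F.1} → EuclideanSpace ℝ (Fin d)) = F.1 :=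
      Subtype.range_coe
    exact (congrArg (fun s => Module.finrank ℝ (vectorSpan ℝ s)) hr).symm.trans this
  have hsub : F.hull ⊆ (fun w : W => (w : EuclideanSpace ℝ (Fin d)) + x₀) ''
      ((fun w : W => (w : EuclideanSpace ℝ (Fin d)) + x₀) ⁻¹' F.hull) := by
    intro x hx
    have hx' : x ∈ affineSpan ℝ (F.1 : Set (EuclideanSpace ℝ (Fin d))) :=
      convexHull_subset_affineSpan _ hx
    have hm : x - x₀ ∈ W := by
      have := AffineSubspace.vsub_mem_direction hx' (subset_affineSpan ℝ _ hx₀)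
      rwa [direction_affineSpan] at this
    exact ⟨⟨x - x₀, hm⟩, by simpa using hx, by simp⟩
  have hiso : Isometry fun w : W => (w : EuclideanSpace ℝ (Fin d)) + x₀ :=
    (IsometryEquiv.addRight x₀).isometry.comp isometry_subtype_coe
  have hemb : IsClosedEmbedding fun w : W => (w : EuclideanSpace ℝ (Fin d)) + x₀ :=
    hiso.isClosedEmbedding
  refine (measure_mono hsub).trans_lt ?_
  rw [hiso.euclideanHausdorffMeasure_image, ← hW]
  exact (hemb.isCompact_preimage F.isCompact_hull).measure_lt_top

lemma integrableOn_ofReal_of_bounded {ν : Measure (EuclideanSpace ℝ (Fin d))}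
    {S : Set (EuclideanSpace ℝ (Fin d))} (hS : MeasurableSet S) (hν : ν S < ⊤)
    {c : EuclideanSpace ℝ (Fin d) → ℝ} (hc : Measurable c) {C : ℝ} (hC : ∀ x ∈ S, |c x| ≤ C) :
    IntegrableOn (fun x => (c x : ℂ)) S ν := by
  refine Integrable.ofReal ?_
  exact IntegrableOn.of_bound hν hc.aestronglyMeasurable C
    ((ae_restrict_iff' hS).2 (ae_of_all _ hC))

end HDG

namespace HDG

open scoped ComplexConjugate

variable {d p : ℕ} {𝒯 : Mesh d}

/-! ## Sesquilinearity of the HDG forms -/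

noncomputable instance : FiniteDimensional ℂ (Space 𝒯 p) := by
  have : ∀ F : 𝒯.Face, FiniteDimensional ℂ (FacePoly p F) := fun F => by
    unfold FacePoly; infer_instance
  infer_instance

lemma MSpace.continuousOn_val (μ : MSpace 𝒯 p) (F : 𝒯.Face) :
    ContinuousOn (MSpace.val μ F) F.hull := by
  obtain ⟨q, -, hq⟩ := (μ F).2
  refine (evalAt_continuous q).continuousOn.congr fun x hx => ?_
  rw [MSpace.val, ← hq]
  exact Set.indicator_of_mem hx fun x => evalAt x q

/-- `w ↦ w|_T`, as a linear map. -/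
noncomputable def wVal (T : 𝒯.Elem) : WSpace 𝒯 p →ₗ[ℂ] EuclideanSpace ℝ (Fin d) → ℂ where
  toFun w := WSpace.val w T
  map_add' v w := by funext x; simp [WSpace.val]
  map_smul' c w := by funext x; simp [WSpace.val]

/-- `w ↦ ∂ᵢ w|_T`, as a linear map. -/
noncomputable def wGrad (T : 𝒯.Elem) (i : Fin d) :
    WSpace 𝒯 p →ₗ[ℂ] EuclideanSpace ℝ (Fin d) → ℂ where
  toFun w x := WSpace.grad w T x i
  map_add' v w := by funext x; simp [WSpace.grad]
  map_smul' c w := by funext x; simp [WSpace.grad]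

/-- `μ ↦ μ|_F`, as a linear map. -/
noncomputable def mVal (F : 𝒯.Face) : MSpace 𝒯 p →ₗ[ℂ] EuclideanSpace ℝ (Fin d) → ℂ where
  toFun μ := MSpace.val μ F
  map_add' v w := by funext x; simp [MSpace.val]
  map_smul' c w := by funext x; simp [MSpace.val]

/-- `r ↦ rᵢ|_T`, as a linear map. -/
noncomputable def vVal (T : 𝒯.Elem) (i : Fin d) :
    VSpace 𝒯 p →ₗ[ℂ] EuclideanSpace ℝ (Fin d) → ℂ where
  toFun r x := VSpace.val r T x i
  map_add' v w := by funext x; simp [VSpace.val]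
  map_smul' c w := by funext x; simp [VSpace.val]

/-- `r ↦ ∇·r|_T`, as a linear map. -/
noncomputable def vDiv (T : 𝒯.Elem) : VSpace 𝒯 p →ₗ[ℂ] EuclideanSpace ℝ (Fin d) → ℂ where
  toFun r := VSpace.div r T
  map_add' v w := by funext x; simp [VSpace.div, Finset.sum_add_distrib]
  map_smul' c w := by funext x; simp [VSpace.div, Finset.mul_sum]

/-- `r ↦ r·n` on the face `F` of `T`, as a linear map. -/
noncomputable def vFlux (T : 𝒯.Elem) (F : 𝒯.Face) :
    VSpace 𝒯 p →ₗ[ℂ] EuclideanSpace ℝ (Fin d) → ℂ where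
  toFun r := VSpace.flux r T F
  map_add' v w := by
    funext x; simp [VSpace.flux, VSpace.val, Finset.sum_add_distrib, add_mul]
  map_smul' c w := by
    funext x; simp [VSpace.flux, VSpace.val, Finset.mul_sum, mul_assoc]

lemma continuous_wVal (T : 𝒯.Elem) (w : WSpace 𝒯 p) : Continuous (wVal T w) :=
  evalAt_continuous _

lemma continuous_wGrad (T : 𝒯.Elem) (i : Fin d) (w : WSpace 𝒯 p) : Continuous (wGrad T i w) :=
  evalAt_continuous _

lemma continuous_vVal (T : 𝒯.Elem) (i : Fin d) (r : VSpace 𝒯 p) : Continuous (vVal T i r) :=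
  evalAt_continuous _

lemma continuous_vDiv (T : 𝒯.Elem) (r : VSpace 𝒯 p) : Continuous (vDiv T r) := by
  change Continuous fun x => VSpace.div r T x
  exact continuous_finsetSum _ fun _ _ => evalAt_continuous _

lemma continuous_vFlux (T : 𝒯.Elem) (F : 𝒯.Face) (r : VSpace 𝒯 p) : Continuous (vFlux T F r) := by
  change Continuous fun x => VSpace.flux r T F x
  exact continuous_finsetSum _ fun i _ => (val_cont r T i).mul continuous_const

lemma continuousOn_mVal (F : 𝒯.Face) (μ : MSpace 𝒯 p) : ContinuousOn (mVal F μ) F.hull :=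
  MSpace.continuousOn_val μ F

/-- `riesz` is a choice, made separately for each functional; uniqueness of the representative is
what makes the choices fit together linearly. -/
lemma exists_linearMap_riesz {V : Type*} [AddCommGroup V] [Module ℂ V]
    (A : V →ₗ[ℂ] VSpace 𝒯 p →ₗ⋆[ℂ] ℂ) : ∃ L : V →ₗ[ℂ] VSpace 𝒯 p, ∀ v, L v = riesz (A v) := by
  have hr : ∀ v r, gram (riesz (A v)) r = A v r := fun v r =>
    gram_riesz (A v) (map_add (A v)) (fun c r => by simp) r
  have huniq : ∀ v q, (∀ r, gram q r = A v r) → q = riesz (A v) := fun v q hq =>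
    (existsUnique_riesz (A v) (map_add (A v)) (fun c r => by simp)).unique hq (hr v)
  refine ⟨{
    toFun := fun v => riesz (A v)
    map_add' := fun v w => ?_
    map_smul' := fun c v => ?_ }, fun v => rfl⟩
  · refine (huniq _ _ fun r => ?_).symm
    rw [gram_add_left, hr, hr, map_add, LinearMap.add_apply]
  · refine (huniq _ _ fun r => ?_).symm
    rw [RingHom.id_apply, gram_smul_left, hr, map_smul, LinearMap.smul_apply, smul_eq_mul]

section

variable {Q : ℕ} {V₁ V₂ : Type*} [AddCommGroup V₁] [Module ℂ V₁] [AddCommGroup V₂] [Module ℂ V₂]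

lemma isAffineSesq_intElems {ι : Type*} [Fintype ι]
    {c₀ : 𝒯.Elem → EuclideanSpace ℝ (Fin d) → ℂ}
    {c : Fin Q → 𝒯.Elem → EuclideanSpace ℝ (Fin d) → ℂ}
    (hc₀ : ∀ T, IntegrableOn (c₀ T) T.hull) (hc : ∀ q T, IntegrableOn (c q T) T.hull)
    {P : 𝒯.Elem → ι → V₁ →ₗ[ℂ] EuclideanSpace ℝ (Fin d) → ℂ}
    {R : 𝒯.Elem → ι → V₂ →ₗ[ℂ] EuclideanSpace ℝ (Fin d) → ℂ}
    (hP : ∀ T i v, ContinuousOn (P T i v) T.hull) (hR : ∀ T i w, ContinuousOn (R T i w) T.hull) :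
    IsAffineSesq fun (y : Fin Q → ℝ) v w => intElems fun T x =>
      ∑ i, (c₀ T x + ∑ q, c q T x * y q) * P T i v x * conj (R T i w x) :=
  IsAffineSesq.sum _ fun T _ =>
    isAffineSesq_integral (hull_compact T) (hc₀ T) (fun q => hc q T) (hP T) (hR T)

lemma isAffineSesq_intSkeleton
    {c₀ : 𝒯.Elem → EuclideanSpace ℝ (Fin d) → ℂ}
    {c : Fin Q → 𝒯.Elem → EuclideanSpace ℝ (Fin d) → ℂ}
    (hc₀ : ∀ T, ∀ F ∈ T.faces, IntegrableOn (c₀ T) F.hull μHE[d - 1])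
    (hc : ∀ q T, ∀ F ∈ T.faces, IntegrableOn (c q T) F.hull μHE[d - 1])
    {P : 𝒯.Elem → 𝒯.Face → V₁ →ₗ[ℂ] EuclideanSpace ℝ (Fin d) → ℂ}
    {R : 𝒯.Elem → 𝒯.Face → V₂ →ₗ[ℂ] EuclideanSpace ℝ (Fin d) → ℂ}
    (hP : ∀ T F v, ContinuousOn (P T F v) F.hull) (hR : ∀ T F w, ContinuousOn (R T F w) F.hull) :
    IsAffineSesq fun (y : Fin Q → ℝ) v w => intSkeleton fun T F x =>
      (c₀ T x + ∑ q, c q T x * y q) * P T F v x * conj (R T F w x) := by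
  refine IsAffineSesq.sum _ fun T _ => IsAffineSesq.sum _ fun F hF => ?_
  simpa only [Fintype.sum_unique] using isAffineSesq_integral (ι := Unit) F.isCompact_hull
    (hc₀ T F hF) (fun q => hc q T F hF) (P := fun _ => P T F) (R := fun _ => R T F)
    (fun _ => hP T F) fun _ => hR T F

lemma isAffineSesq_intBoundary {c₀ : EuclideanSpace ℝ (Fin d) → ℂ}
    (hc₀ : ∀ F ∈ 𝒯.boundaryFaces, IntegrableOn c₀ F.hull μHE[d - 1])
    {P : 𝒯.Face → V₁ →ₗ[ℂ] EuclideanSpace ℝ (Fin d) → ℂ}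
    {R : 𝒯.Face → V₂ →ₗ[ℂ] EuclideanSpace ℝ (Fin d) → ℂ}
    (hP : ∀ F v, ContinuousOn (P F v) F.hull) (hR : ∀ F w, ContinuousOn (R F w) F.hull) :
    IsAffineSesq fun (_ : Fin Q → ℝ) v w => intBoundary (𝒯 := 𝒯) fun F x =>
      c₀ x * P F v x * conj (R F w x) := by
  refine IsAffineSesq.sum _ fun F hF => ?_
  simpa only [Fintype.sum_unique, zero_mul, Pi.zero_apply, Finset.sum_const_zero, add_zero] using
    isAffineSesq_integral (ι := Unit) F.isCompact_hull
    (hc₀ F hF) (c := 0) (fun q => integrableOn_zero) (P := fun _ => P F) (R := fun _ => R F)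
    (fun _ => hP F) fun _ => hR F

end

lemma integrableOn_const_face (hd : 0 < d) (F : 𝒯.Face) (c : ℂ) :
    IntegrableOn (fun _ => c) F.hull μHE[d - 1] :=
  integrableOn_const (F.measure_hull_lt_top hd).ne

lemma integrableOn_const_elem (T : 𝒯.Elem) (c : ℂ) : IntegrableOn (fun _ => c) T.hull :=
  integrableOn_const (hull_compact T).measure_lt_top.ne

lemma isAffineSesq_liftW : IsAffineSesq fun (_ : Fin 0 → ℝ) (w : WSpace 𝒯 p) (r : VSpace 𝒯 p) =>
    -intElems fun T x => WSpace.val w T x * conj (VSpace.div r T x) := by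
  have := (isAffineSesq_intElems (𝒯 := 𝒯) (Q := 0) (ι := Unit) (c₀ := fun _ _ => 1) (c := 0)
    (fun T => integrableOn_const_elem T 1) (fun q T => integrableOn_zero)
    (P := fun T _ => wVal (p := p) T) (R := fun T _ => vDiv (p := p) T)
    (fun T _ v => (continuous_wVal T v).continuousOn)
    (fun T _ w => (continuous_vDiv T w).continuousOn)).neg
  simpa using! this

lemma isAffineSesq_liftM (hd : 0 < d) :
    IsAffineSesq fun (_ : Fin 0 → ℝ) (μ : MSpace 𝒯 p) (r : VSpace 𝒯 p) =>
      intSkeleton fun T F x => MSpace.val μ F x * conj (VSpace.flux r T F x) := by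
  have := isAffineSesq_intSkeleton (𝒯 := 𝒯) (Q := 0) (c₀ := fun _ _ => 1) (c := 0)
    (fun T F _ => integrableOn_const_face hd F 1) (fun q T F _ => integrableOn_zero)
    (P := fun _ F => mVal (p := p) F) (R := fun T F => vFlux (p := p) T F)
    (fun T F μ => continuousOn_mVal F μ)
    (fun T F w => (continuous_vFlux T F w).continuousOn)
  simpa using! this

lemma exists_linearMap_liftW : ∃ L : WSpace 𝒯 p →ₗ[ℂ] VSpace 𝒯 p, ∀ w, L w = liftW w := by
  obtain ⟨A, hA⟩ := exists_sesqForm _ (isAffineSesq_liftW (𝒯 := 𝒯) (p := p))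
  obtain ⟨L, hL⟩ := exists_linearMap_riesz A
  exact ⟨L, fun w => by rw [hL, liftW]; congr 1; funext r; exact hA w r⟩

lemma exists_linearMap_liftM (hd : 0 < d) :
    ∃ L : MSpace 𝒯 p →ₗ[ℂ] VSpace 𝒯 p, ∀ μ, L μ = liftM μ := by
  obtain ⟨A, hA⟩ := exists_sesqForm _ (isAffineSesq_liftM (𝒯 := 𝒯) (p := p) hd)
  obtain ⟨L, hL⟩ := exists_linearMap_riesz A
  exact ⟨L, fun μ => by rw [hL, liftM]; congr 1; funext r; exact hA μ r⟩

/-- The HDG form is sesquilinear and depends affinely on the diffusion coefficient. -/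
lemma isAffineSesq_aForm {Q : ℕ} (hd : 0 < d) (τ : ℝ)
    {κ₀ : 𝒯.Elem → EuclideanSpace ℝ (Fin d) → ℝ}
    {ψ : Fin Q → 𝒯.Elem → EuclideanSpace ℝ (Fin d) → ℝ} {ϱ ν : EuclideanSpace ℝ (Fin d) → ℂ}
    (hκ₀ : ∀ T, Measurable (κ₀ T)) (hψ : ∀ q T, Measurable (ψ q T))
    (bκ₀ : ∃ C, ∀ T, ∀ x ∈ T.hull, |κ₀ T x| ≤ C) (bψ : ∃ C, ∀ q T, ∀ x ∈ T.hull, |ψ q T x| ≤ C)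
    (hϱ : ∀ T : 𝒯.Elem, IntegrableOn ϱ T.hull)
    (hν : ∀ F ∈ 𝒯.boundaryFaces, IntegrableOn ν F.hull μHE[d - 1]) :
    IsAffineSesq fun (y : Fin Q → ℝ) (v w : Space 𝒯 p) =>
      aForm τ (fun T x => κ₀ T x + ∑ q, ψ q T x * y q) ϱ ν v w := by
  obtain ⟨LW, hLW⟩ := exists_linearMap_liftW (𝒯 := 𝒯) (p := p)
  obtain ⟨LM, hLM⟩ := exists_linearMap_liftM (𝒯 := 𝒯) (p := p) hd
  obtain ⟨C₀, hC₀⟩ := bκ₀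
  obtain ⟨C, hC⟩ := bψ
  let pW : Space 𝒯 p →ₗ[ℂ] WSpace 𝒯 p := LinearMap.fst ℂ _ _
  let pM : Space 𝒯 p →ₗ[ℂ] MSpace 𝒯 p := LinearMap.snd ℂ _ _
  let Lq : Space 𝒯 p →ₗ[ℂ] VSpace 𝒯 p := LW ∘ₗ pW + LM ∘ₗ pM
  have hLq : ∀ v, Lq v = liftW v.1 + liftM v.2 := fun v => by
    simp [Lq, pW, pM, hLW, hLM]
  -- The numerical flux is `κ` times a linear expression in `v` with no coefficient in it, so every
  -- term of the form becomes a coefficient times a linear map times the conjugate of a linear map.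
  let fl : 𝒯.Elem → 𝒯.Face → Space 𝒯 p →ₗ[ℂ] EuclideanSpace ℝ (Fin d) → ℂ := fun T F =>
    vFlux T F ∘ₗ Lq - (τ : ℂ) • (wVal T ∘ₗ pW - mVal F ∘ₗ pM)
  have hfl : ∀ T F v, ContinuousOn (fl T F v) F.hull := fun T F v =>
    (continuous_vFlux T F (Lq v)).continuousOn.sub (((continuous_wVal T v.1).continuousOn.sub
      (continuousOn_mVal F v.2)).const_smul (τ : ℂ))
  have hc₀T : ∀ T : 𝒯.Elem, IntegrableOn (fun x => (κ₀ T x : ℂ)) T.hull := fun T =>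
    integrableOn_ofReal_of_bounded (hull_compact T).measurableSet
      (hull_compact T).measure_lt_top (hκ₀ T) (hC₀ T)
  have hcT : ∀ (q) (T : 𝒯.Elem), IntegrableOn (fun x => (ψ q T x : ℂ)) T.hull := fun q T =>
    integrableOn_ofReal_of_bounded (hull_compact T).measurableSet
      (hull_compact T).measure_lt_top (hψ q T) (hC q T)
  have hc₀F : ∀ T : 𝒯.Elem, ∀ F ∈ T.faces,
      IntegrableOn (fun x => (κ₀ T x : ℂ)) F.hull μHE[d - 1] := fun T F hF =>
    integrableOn_ofReal_of_bounded F.isCompact_hull.measurableSet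
      (F.measure_hull_lt_top hd) (hκ₀ T) fun x hx =>
        hC₀ T x (Mesh.Elem.hull_subset_of_mem_faces hF hx)
  have hcF : ∀ (q) (T : 𝒯.Elem), ∀ F ∈ T.faces,
      IntegrableOn (fun x => (ψ q T x : ℂ)) F.hull μHE[d - 1] := fun q T F hF =>
    integrableOn_ofReal_of_bounded F.isCompact_hull.measurableSet
      (F.measure_hull_lt_top hd) (hψ q T) fun x hx =>
        hC q T x (Mesh.Elem.hull_subset_of_mem_faces hF hx)
  have h1 := isAffineSesq_intElems (𝒯 := 𝒯) (Q := Q) hc₀T hcT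
    (P := fun T i => vVal T i ∘ₗ Lq) (R := fun T i => wGrad T i ∘ₗ pW)
    (fun T i v => (continuous_vVal T i _).continuousOn)
    (fun T i w => (continuous_wGrad T i _).continuousOn)
  have h2 := isAffineSesq_intSkeleton (𝒯 := 𝒯) (Q := Q) hc₀F hcF (P := fl)
    (R := fun T _ => wVal T ∘ₗ pW) hfl (fun T F w => (continuous_wVal T _).continuousOn)
  have h3 := isAffineSesq_intElems (𝒯 := 𝒯) (Q := Q) (ι := Unit) (c₀ := fun _ => ϱ) (c := 0)
    hϱ (fun q T => integrableOn_zero)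
    (P := fun T _ => wVal T ∘ₗ pW) (R := fun T _ => wVal T ∘ₗ pW)
    (fun T _ v => (continuous_wVal T _).continuousOn)
    (fun T _ w => (continuous_wVal T _).continuousOn)
  have h4 := isAffineSesq_intSkeleton (𝒯 := 𝒯) (Q := Q) hc₀F hcF (P := fl)
    (R := fun _ F => mVal F ∘ₗ pM) hfl (fun T F w => continuousOn_mVal F _)
  have h5 := isAffineSesq_intBoundary (𝒯 := 𝒯) (Q := Q) hν
    (P := fun F => mVal F ∘ₗ pM) (R := fun F => mVal F ∘ₗ pM)
    (fun F v => continuousOn_mVal F _) (fun F w => continuousOn_mVal F _)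
  convert (((h1.sub h2).add h3).add h4).add h5 using 4 with y v w
  have hflux : ∀ T F (k : ℂ) x, k * fl T F v x = k * VSpace.flux (liftW v.1 + liftM v.2) T F x
      - k * (τ : ℂ) * (WSpace.val v.1 T x - MSpace.val v.2 F x) := by
    intro T F k x
    rw [← hLq, mul_assoc, ← mul_sub]
    rfl
  simp only [aForm, hflux, LinearMap.comp_apply, hLq, Pi.zero_apply, zero_mul,
    Finset.sum_const_zero, add_zero, Finset.univ_unique, Finset.sum_singleton,
    Complex.ofReal_add, Complex.ofReal_sum, Complex.ofReal_mul]
  rfl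

end HDG

namespace HDG

/-! ## Integration over cones -/

section Cone

variable {d : ℕ} {b u : EuclideanSpace ℝ (Fin d)} {S T : Set (EuclideanSpace ℝ (Fin d))}

/-- Slice along `u`: the hyperplane at relative height `x` meets the cone in the image of the base
`S` under the homothety of ratio `x`, which scales `(d - 1)`-dimensional measure by `x ^ (d - 1)`.
The factor `‖u‖` is the height of the cone. -/
lemma volume_cone_inter (hu : u ≠ 0) (hS : ∀ y ∈ S, inner ℝ (y - b) u = ‖u‖ ^ 2)
    (hT : ∀ z, z ∈ T ↔ ∃ x ∈ Set.Icc (0 : ℝ) 1, ∃ y ∈ S, AffineMap.homothety b x y = z)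
    (hTm : MeasurableSet T) {A : Set (EuclideanSpace ℝ (Fin d))} (hA : MeasurableSet A) :
    volume (T ∩ A) = ∫⁻ x in Set.Ioc (0 : ℝ) 1, ‖u‖ₑ * ENNReal.ofReal x ^ (d - 1) *
      μHE[d - 1] (S ∩ AffineMap.homothety b x ⁻¹' A) := by
  have hslice : ∀ x : ℝ, x ≠ 0 →
      μHE[d - 1] (T ∩ A ∩ AffineSubspace.mk' (x • u +ᵥ b) (Submodule.span ℝ {u})ᗮ)
        = (Set.Ioc (0 : ℝ) 1).indicator (fun x => ENNReal.ofReal x ^ (d - 1) *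
          μHE[d - 1] (S ∩ AffineMap.homothety b x ⁻¹' A)) x := by
    intro x hx
    have hmem : ∀ (t : ℝ), ∀ y ∈ S, AffineMap.homothety b t y ∈
        AffineSubspace.mk' (x • u +ᵥ b) (Submodule.span ℝ {u})ᗮ ↔ t = x := by
      intro t y hy
      rw [AffineSubspace.mem_mk', Submodule.mem_orthogonal_singleton_iff_inner_left]
      have e : AffineMap.homothety b t y -ᵥ (x • u +ᵥ b) = t • (y - b) - x • u := by
        simp only [AffineMap.homothety_apply, vsub_eq_sub, vadd_eq_add]; abel
      rw [e, inner_sub_left, inner_smul_left, inner_smul_left, hS y hy,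
        real_inner_self_eq_norm_sq, RCLike.conj_to_real, RCLike.conj_to_real, ← sub_mul]
      have : ‖u‖ ^ 2 ≠ 0 := by simpa using hu
      rw [mul_eq_zero, or_iff_left this, sub_eq_zero]
    by_cases hx1 : x ∈ Set.Ioc (0 : ℝ) 1
    · rw [Set.indicator_of_mem hx1]
      have : T ∩ A ∩ AffineSubspace.mk' (x • u +ᵥ b) (Submodule.span ℝ {u})ᗮ
          = AffineMap.homothety b x '' (S ∩ AffineMap.homothety b x ⁻¹' A) := by
        ext z
        constructor
        · rintro ⟨⟨hzT, hzA⟩, hz⟩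
          obtain ⟨t, -, y, hy, rfl⟩ := (hT z).1 hzT
          obtain rfl := (hmem t y hy).1 hz
          exact ⟨y, ⟨hy, hzA⟩, rfl⟩
        · rintro ⟨y, ⟨hy, hyA⟩, rfl⟩
          exact ⟨⟨(hT _).2 ⟨x, ⟨hx1.1.le, hx1.2⟩, y, hy, rfl⟩, hyA⟩, (hmem x y hy).2 rfl⟩
      rw [this, euclideanHausdorffMeasure_homothety_image _ _ hx, ENNReal.smul_def, smul_eq_mul]
      congr 1
      rw [ENNReal.coe_pow, ENNReal.ofReal, Real.nnnorm_of_nonneg hx1.1.le]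
      congr 2
      exact (Real.toNNReal_of_nonneg hx1.1.le).symm
    · rw [Set.indicator_of_notMem hx1]
      convert measure_empty (μ := (μHE[d - 1] : Measure (EuclideanSpace ℝ (Fin d))))
      refine Set.eq_empty_of_forall_notMem ?_
      rintro z ⟨⟨hzT, hzA⟩, hz⟩
      obtain ⟨t, ht, y, hy, rfl⟩ := (hT z).1 hzT
      obtain rfl := (hmem t y hy).1 hz
      exact hx1 ⟨lt_of_le_of_ne ht.1 hx.symm, ht.2⟩
  have key := EuclideanGeometry.euclideanHausdorffMeasure_eq_lintegral b hu (hTm.inter hA)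
  rw [finrank_euclideanSpace_fin, EuclideanSpace.euclideanHausdorffMeasure_eq_volume] at key
  rw [key]
  simp only [mul_assoc]
  rw [lintegral_const_mul' _ _ enorm_ne_top, ← lintegral_indicator measurableSet_Ioc]
  congr 1
  refine lintegral_congr_ae ?_
  -- The apex slice `x = 0` is left out: there the homothety is degenerate and has no scaling law.
  filter_upwards [Measure.ae_ne volume (0 : ℝ)] with x hx using hslice x hx

lemma continuous_homothety (b : EuclideanSpace ℝ (Fin d)) :
    Continuous fun z : ℝ × EuclideanSpace ℝ (Fin d) => AffineMap.homothety b z.1 z.2 := by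
  simp only [AffineMap.homothety_apply, vsub_eq_sub, vadd_eq_add]
  fun_prop

/-- Lebesgue measure on a cone, in polar coordinates. -/
lemma volume_restrict_cone (hu : u ≠ 0) (hS : ∀ y ∈ S, inner ℝ (y - b) u = ‖u‖ ^ 2)
    (hT : ∀ z, z ∈ T ↔ ∃ x ∈ Set.Icc (0 : ℝ) 1, ∃ y ∈ S, AffineMap.homothety b x y = z)
    (hTm : MeasurableSet T) (hSf : μHE[d - 1] S < ⊤) :
    volume.restrict T = Measure.map (fun z : ℝ × _ => AffineMap.homothety b z.1 z.2)
      (((volume.restrict (Set.Ioc (0 : ℝ) 1)).withDensity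
        fun x => ‖u‖ₑ * ENNReal.ofReal x ^ (d - 1)).prod (μHE[d - 1].restrict S)) := by
  have : IsFiniteMeasure ((μHE[d - 1] : Measure (EuclideanSpace ℝ (Fin d))).restrict S) :=
    ⟨by rwa [Measure.restrict_apply_univ]⟩
  have hc := (continuous_homothety b).measurable
  ext A hA
  rw [Measure.restrict_apply hA, Set.inter_comm, volume_cone_inter hu hS hT hTm hA,
    Measure.map_apply hc hA, Measure.prod_apply (hc hA),
    lintegral_withDensity_eq_lintegral_mul _ (by fun_prop) (measurable_measure_prodMk_left (hc hA))]
  refine lintegral_congr fun x => ?_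
  rw [Pi.mul_apply, Measure.restrict_apply (measurable_prodMk_left (hc hA)), Set.inter_comm]
  rfl

/-- Push-forward along the polar map and Fubini, with the radial integral innermost so that it can
be evaluated ray by ray. -/
lemma setIntegral_cone (hu : u ≠ 0) (hS : ∀ y ∈ S, inner ℝ (y - b) u = ‖u‖ ^ 2)
    (hT : ∀ z, z ∈ T ↔ ∃ x ∈ Set.Icc (0 : ℝ) 1, ∃ y ∈ S, AffineMap.homothety b x y = z)
    (hTc : IsCompact T) (hSf : μHE[d - 1] S < ⊤)
    {g : EuclideanSpace ℝ (Fin d) → ℂ} (hg : Continuous g) :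
    ∫ z in T, g z = ‖u‖ * ∫ y in S, (∫ x in (0 : ℝ)..1,
      (x : ℂ) ^ (d - 1) * g (AffineMap.homothety b x y)) ∂μHE[d - 1] := by
  have : IsFiniteMeasure ((μHE[d - 1] : Measure (EuclideanSpace ℝ (Fin d))).restrict S) :=
    ⟨by rwa [Measure.restrict_apply_univ]⟩
  have hc := continuous_homothety b
  have hint : Integrable g (volume.restrict T) := hg.continuousOn.integrableOn_compact hTc
  have hmap := volume_restrict_cone hu hS hT hTc.measurableSet hSf
  rw [hmap] at hint ⊢
  rw [integral_map hc.measurable.aemeasurable hg.aestronglyMeasurable, integral_prod_symm,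
    ← integral_const_mul]
  · refine integral_congr_ae (ae_of_all _ fun y => ?_)
    simp only
    rw [integral_withDensity_eq_integral_toReal_smul (by fun_prop)
      (ae_of_all _ fun x => ENNReal.mul_lt_top enorm_lt_top (by finiteness)),
      intervalIntegral.integral_of_le zero_le_one, ← integral_const_mul]
    refine setIntegral_congr_fun measurableSet_Ioc fun x hx => ?_
    simp only [ENNReal.toReal_mul, ENNReal.toReal_pow, toReal_enorm,
      ENNReal.toReal_ofReal hx.1.le, Complex.real_smul, Complex.ofReal_mul, Complex.ofReal_pow,
      mul_assoc]
  · exact (integrable_map_measure hg.aestronglyMeasurable hc.measurable.aemeasurable).1 hint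

/-- Relatively open subsets of the base of a solid cone have positive surface measure. -/
lemma measure_base_inter_ne_zero (hu : u ≠ 0) (hS : ∀ y ∈ S, inner ℝ (y - b) u = ‖u‖ ^ 2)
    (hT : ∀ z, z ∈ T ↔ ∃ x ∈ Set.Icc (0 : ℝ) 1, ∃ y ∈ S, AffineMap.homothety b x y = z)
    (hTc : IsCompact T) (hTi : T ⊆ closure (interior T)) {V : Set (EuclideanSpace ℝ (Fin d))}
    (hV : IsOpen V) {y₀ : EuclideanSpace ℝ (Fin d)} (hy₀ : y₀ ∈ S) (hy₀V : y₀ ∈ V) :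
    μHE[d - 1] (S ∩ V) ≠ 0 := by
  intro h0
  have hn2 : ‖u‖ ^ 2 ≠ 0 := by simpa using hu
  -- `t` is the relative height above the apex `b`; it recovers the ratio of the homothety.
  obtain ⟨t, ht, htS⟩ : ∃ t : EuclideanSpace ℝ (Fin d) → ℝ, Continuous t ∧
      ∀ x : ℝ, ∀ y ∈ S, t (AffineMap.homothety b x y) = x := by
    refine ⟨fun z => inner ℝ (z - b) u / ‖u‖ ^ 2, by fun_prop, fun x y hy => ?_⟩
    have := hS y hy
    simp only [AffineMap.homothety_apply, vsub_eq_sub, vadd_eq_add, add_sub_cancel_right,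
      real_inner_smul_left, this]
    field_simp
  -- `U` is the double cone over `V`, without the level `t = 0`. If `S ∩ V` were null, so would be
  -- `T ∩ U`; yet `U` is open, contains `y₀` and therefore meets the interior of `T`.
  obtain ⟨U, hU, hmem⟩ : ∃ U : Set (EuclideanSpace ℝ (Fin d)), IsOpen U ∧
      ∀ z, z ∈ U ↔ t z ≠ 0 ∧ AffineMap.homothety b (t z)⁻¹ z ∈ V := by
    have hc : ContinuousOn (fun z => (t z)⁻¹ • (z - b) + b) {z | t z ≠ 0} :=
      ((ht.continuousOn.inv₀ fun z hz => hz).smul (continuousOn_id.sub continuousOn_const)).add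
        continuousOn_const
    exact ⟨_, hc.isOpen_inter_preimage (isOpen_ne.preimage ht) hV, fun z => Iff.rfl⟩
  have hvol : volume (T ∩ U) = 0 := by
    rw [volume_cone_inter hu hS hT hTc.measurableSet hU.measurableSet]
    refine (setLIntegral_congr_fun (g := fun _ => 0) measurableSet_Ioc fun x hx => ?_).trans
      lintegral_zero
    have h1 : μHE[d - 1] (S ∩ AffineMap.homothety b x ⁻¹' U) = 0 := by
      refine measure_mono_null ?_ h0
      rintro y ⟨hy, hyU⟩
      have h2 := ((hmem _).1 hyU).2
      rw [htS x y hy, ← AffineMap.homothety_mul_apply, inv_mul_cancel₀ hx.1.ne',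
        AffineMap.homothety_one, AffineMap.id_apply] at h2
      exact ⟨hy, h2⟩
    simp only [h1, mul_zero]
  have hy₁ : t y₀ = 1 := by
    have := htS 1 y₀ hy₀
    rwa [AffineMap.homothety_one, AffineMap.id_apply] at this
  have hy₀U : y₀ ∈ U := by
    rw [hmem, hy₁, inv_one, AffineMap.homothety_one, AffineMap.id_apply]
    exact ⟨one_ne_zero, hy₀V⟩
  have hy₀T : y₀ ∈ T :=
    (hT y₀).2 ⟨1, by simp, y₀, hy₀, by rw [AffineMap.homothety_one, AffineMap.id_apply]⟩
  have hpos := (hU.inter isOpen_interior).measure_pos volume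
    (mem_closure_iff.1 (hTi hy₀T) U hU hy₀U)
  have hsub : U ∩ interior T ⊆ T ∩ U := fun z hz => ⟨interior_subset hz.2, hz.1⟩
  exact hpos.ne' (measure_mono_null hsub hvol)

end Cone

end HDG

namespace HDG

variable {d : ℕ}

/-! ## The divergence theorem for polynomials on simplices -/

lemma hasDerivAt_evalAt_line (q : MvPolynomial (Fin d) ℂ) (b w : EuclideanSpace ℝ (Fin d)) (t : ℝ) :
    HasDerivAt (fun t : ℝ => evalAt (t • w + b) q)
      (∑ i, (w i : ℂ) * evalAt (t • w + b) (MvPolynomial.pderiv i q)) t := by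
  induction q using MvPolynomial.induction_on with
  | C a => simpa [evalAt] using hasDerivAt_const t a
  | add q r hq hr =>
    simpa only [map_add, mul_add, Finset.sum_add_distrib] using! hq.add hr
  | mul_X q j hq =>
    have hX : HasDerivAt (fun t : ℝ => evalAt (t • w + b) (MvPolynomial.X j)) (w j : ℂ) t := by
      have h : HasDerivAt (fun t : ℝ => t * w j + b j) (w j) t := by
        simpa using ((hasDerivAt_id t).mul_const (w j)).add_const (b j)
      simpa [evalAt] using! h.ofReal_comp
    have hm : ∀ x (q r : MvPolynomial (Fin d) ℂ), evalAt x (q * r) = evalAt x q * evalAt x r :=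
      fun x q r => map_mul (MvPolynomial.aeval fun i => ((x i : ℝ) : ℂ)) q r
    have h := hq.mul hX
    simp only [hm]
    refine h.congr_deriv ?_
    have hs : ∀ i, (w i : ℂ) * evalAt (t • w + b) (MvPolynomial.pderiv i (q * MvPolynomial.X j))
        = (w i : ℂ) * evalAt (t • w + b) (MvPolynomial.pderiv i q)
            * evalAt (t • w + b) (MvPolynomial.X j)
          + evalAt (t • w + b) q * if i = j then (w j : ℂ) else 0 := by
      intro i
      rw [MvPolynomial.pderiv_mul, map_add, hm, hm]
      rcases eq_or_ne i j with rfl | hij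
      · rw [MvPolynomial.pderiv_X_self, if_pos rfl]
        simp [evalAt]
        ring
      · rw [MvPolynomial.pderiv_X_of_ne hij.symm, if_neg hij]
        simp
        ring
    simp only [hs, Finset.sum_add_distrib, ← Finset.sum_mul, ← Finset.mul_sum, Finset.sum_ite_eq',
      Finset.mem_univ, if_true]

/-- The integrand is the derivative of `x ^ d * q (b + x (y - b))`; the boundary term at `x = 0`
vanishes because `d` is positive. -/
lemma integral_cone_ray (hd : 0 < d) (q : MvPolynomial (Fin d) ℂ)
    (b y : EuclideanSpace ℝ (Fin d)) :
    ∫ x in (0 : ℝ)..1, (x : ℂ) ^ (d - 1) * (d * evalAt (AffineMap.homothety b x y) q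
      + ∑ i, ((AffineMap.homothety b x y i - b i : ℝ) : ℂ) *
        evalAt (AffineMap.homothety b x y) (MvPolynomial.pderiv i q)) = evalAt y q := by
  obtain ⟨n, rfl⟩ : ∃ n, d = n + 1 := ⟨d - 1, by omega⟩
  simp only [AffineMap.homothety_apply, vsub_eq_sub, vadd_eq_add, Nat.add_sub_cancel]
  have hder : ∀ x : ℝ, HasDerivAt (fun x : ℝ => (x : ℂ) ^ (n + 1) * evalAt (x • (y - b) + b) q)
      ((x : ℂ) ^ n * ((n + 1 : ℕ) * evalAt (x • (y - b) + b) q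
        + ∑ i, (((x • (y - b) + b) i - b i : ℝ) : ℂ) *
          evalAt (x • (y - b) + b) (MvPolynomial.pderiv i q))) x := by
    intro x
    have h1 : HasDerivAt (fun x : ℝ => (x : ℂ) ^ (n + 1)) (((n + 1 : ℕ) : ℂ) * (x : ℂ) ^ n) x := by
      simpa using! (hasDerivAt_id x).ofReal_comp.pow (n + 1)
    refine (h1.mul (hasDerivAt_evalAt_line q b (y - b) x)).congr_deriv ?_
    rw [mul_add, Finset.mul_sum, Finset.mul_sum]
    congr 1
    · ring
    · refine Finset.sum_congr rfl fun i _ => ?_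
      simp only [PiLp.add_apply, PiLp.smul_apply, smul_eq_mul, add_sub_cancel_right,
        Complex.ofReal_mul]
      ring
  rw [intervalIntegral.integral_eq_sub_of_hasDerivAt fun x _ => hder x]
  · simp
  · refine Continuous.intervalIntegrable ?_ _ _
    have hl : Continuous fun x : ℝ => x • (y - b) + b := by fun_prop
    have := fun q => (evalAt_continuous q).comp hl
    simp only [Function.comp_def] at this
    fun_prop

section Simplex

variable (T : Finset (EuclideanSpace ℝ (Fin d))) (b : EuclideanSpace ℝ (Fin d))

/-- The vector from `b` to its orthogonal projection on the face of the simplex `T` that is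
opposite to `b`. -/
noncomputable def altitude : EuclideanSpace ℝ (Fin d) :=
  (vectorSpan ℝ (T.erase b : Set (EuclideanSpace ℝ (Fin d))))ᗮ.starProjection
    ((T.erase b).centroid ℝ id - b)

variable {T b}

/-- Moving `y` inside the span of the face does not change the product, since the altitude is
orthogonal to the face. At the centroid it is the product of a vector with its own orthogonal
projection. -/
lemma inner_altitude (hT : (T.erase b).Nonempty) {y : EuclideanSpace ℝ (Fin d)}
    (hy : y ∈ affineSpan ℝ (T.erase b : Set (EuclideanSpace ℝ (Fin d)))) :
    inner ℝ (y - b) (altitude T b) = ‖altitude T b‖ ^ 2 := by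
  set W := vectorSpan ℝ (T.erase b : Set (EuclideanSpace ℝ (Fin d)))
  set c := (T.erase b).centroid ℝ id with hc
  have hcm : c ∈ affineSpan ℝ (T.erase b : Set (EuclideanSpace ℝ (Fin d))) :=
    convexHull_subset_affineSpan _ (Finset.centroid_mem_convexHull _ hT)
  have hyc : y - c ∈ W := by
    have := AffineSubspace.vsub_mem_direction hy hcm
    rwa [direction_affineSpan] at this
  have hu : altitude T b = Wᗮ.starProjection (c - b) := rfl
  have hmem : altitude T b ∈ Wᗮ := Submodule.starProjection_apply_mem _ _
  rw [show y - b = (y - c) + (c - b) by abel, inner_add_left,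
    Submodule.inner_right_of_mem_orthogonal hyc hmem, zero_add, ← real_inner_self_eq_norm_sq]
  have h := Submodule.inner_starProjection_left_eq_right Wᗮ (c - b) (altitude T b)
  rw [Submodule.starProjection_eq_self_iff.2 hmem, ← hu] at h
  exact h.symm

/-- A zero altitude would put `b` into the affine span of the other vertices. -/
lemma altitude_ne_zero (hT : AffineIndependent ℝ ((↑) : T → EuclideanSpace ℝ (Fin d)))
    (hb : b ∈ T) (hne : (T.erase b).Nonempty) : altitude T b ≠ 0 := by
  intro h0
  set W := vectorSpan ℝ (T.erase b : Set (EuclideanSpace ℝ (Fin d))) with hW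
  set c := (T.erase b).centroid ℝ id with hc
  have hcm : c ∈ affineSpan ℝ (T.erase b : Set (EuclideanSpace ℝ (Fin d))) :=
    convexHull_subset_affineSpan _ (Finset.centroid_mem_convexHull _ hne)
  have hu : Wᗮ.starProjection (c - b) = 0 := h0
  have hcb : c - b ∈ W := by
    rw [← Submodule.starProjection_add_starProjection_orthogonal (K := W) (c - b), hu, add_zero]
    exact Submodule.starProjection_apply_mem _ _
  have hbm : b ∈ affineSpan ℝ (T.erase b : Set (EuclideanSpace ℝ (Fin d))) := by
    have := AffineSubspace.vadd_mem_of_mem_direction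
      (by rw [direction_affineSpan]; exact W.neg_mem hcb) hcm
    simpa using this
  refine hT.notMem_affineSpan_sdiff ⟨b, hb⟩ Set.univ ?_
  convert hbm using 2
  ext z
  simp [and_comm]

lemma mem_convexHull_iff_homothety (hb : b ∈ T) (hne : (T.erase b).Nonempty)
    (z : EuclideanSpace ℝ (Fin d)) :
    z ∈ convexHull ℝ (T : Set (EuclideanSpace ℝ (Fin d))) ↔ ∃ x ∈ Set.Icc (0 : ℝ) 1,
      ∃ y ∈ convexHull ℝ (T.erase b : Set (EuclideanSpace ℝ (Fin d))),
        AffineMap.homothety b x y = z := by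
  have hT : (T : Set (EuclideanSpace ℝ (Fin d))) = insert b (T.erase b : Set _) := by
    rw [← Finset.coe_insert, Finset.insert_erase hb]
  rw [hT, convexHull_insert (by exact_mod_cast hne), mem_convexJoin]
  simp only [Set.mem_singleton_iff, exists_eq_left, segment_eq_image_lineMap, Set.mem_image,
    AffineMap.homothety_eq_lineMap]
  exact ⟨fun ⟨y, hy, x, hx, h⟩ => ⟨x, hx, y, hy, h⟩, fun ⟨x, hx, y, hy, h⟩ => ⟨y, hy, x, hx, h⟩⟩

lemma isCompact_convexHull_finset (S : Finset (EuclideanSpace ℝ (Fin d))) :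
    IsCompact (convexHull ℝ (S : Set (EuclideanSpace ℝ (Fin d)))) :=
  S.finite_toSet.isCompact_convexHull ℝ

/-- The divergence theorem on a simplex for the radial field `q • (x - b)`. -/
lemma setIntegral_radial (hd : 0 < d)
    (hT : AffineIndependent ℝ ((↑) : T → EuclideanSpace ℝ (Fin d))) (hb : b ∈ T)
    (hne : (T.erase b).Nonempty)
    (hfin : μHE[d - 1] (convexHull ℝ (T.erase b : Set (EuclideanSpace ℝ (Fin d)))) < ⊤)
    (q : MvPolynomial (Fin d) ℂ) :
    ∫ z in convexHull ℝ (T : Set (EuclideanSpace ℝ (Fin d))), (d * evalAt z q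
        + ∑ i, ((z i - b i : ℝ) : ℂ) * evalAt z (MvPolynomial.pderiv i q))
      = ‖altitude T b‖ * ∫ y in convexHull ℝ (T.erase b : Set (EuclideanSpace ℝ (Fin d))),
          evalAt y q ∂μHE[d - 1] := by
  have hc : Continuous fun z : EuclideanSpace ℝ (Fin d) => d * evalAt z q
      + ∑ i, ((z i - b i : ℝ) : ℂ) * evalAt z (MvPolynomial.pderiv i q) := by
    have := fun q : MvPolynomial (Fin d) ℂ => evalAt_continuous q
    fun_prop
  rw [setIntegral_cone (altitude_ne_zero hT hb hne)
    (fun y hy => inner_altitude hne (convexHull_subset_affineSpan _ hy))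
    (mem_convexHull_iff_homothety hb hne) (isCompact_convexHull_finset T) hfin hc]
  simp only [integral_cone_ray hd]

/-- The divergence theorem on a simplex for a constant multiple of a polynomial. -/
theorem setIntegral_divergence (hd : 0 < d)
    (hT : AffineIndependent ℝ ((↑) : T → EuclideanSpace ℝ (Fin d))) (hcard : T.card = d + 1)
    (hfin : ∀ b ∈ T,
      μHE[d - 1] (convexHull ℝ (T.erase b : Set (EuclideanSpace ℝ (Fin d)))) < ⊤)
    (q : MvPolynomial (Fin d) ℂ) (e : EuclideanSpace ℝ (Fin d)) :
    ∑ i, (e i : ℂ) * ∫ z in convexHull ℝ (T : Set (EuclideanSpace ℝ (Fin d))),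
        evalAt z (MvPolynomial.pderiv i q)
      = ∑ b ∈ T, ((inner ℝ e (‖altitude T b‖⁻¹ • altitude T b) : ℝ) : ℂ) *
          ∫ y in convexHull ℝ (T.erase b : Set (EuclideanSpace ℝ (Fin d))),
            evalAt y q ∂μHE[d - 1] := by
  have hne : ∀ b ∈ T, (T.erase b).Nonempty := fun b hb =>
    Finset.card_pos.1 (by rw [Finset.card_erase_of_mem hb]; omega)
  let K := convexHull ℝ (T : Set (EuclideanSpace ℝ (Fin d)))
  let I : EuclideanSpace ℝ (Fin d) → ℂ := fun b =>
    ∫ y in convexHull ℝ (T.erase b : Set (EuclideanSpace ℝ (Fin d))), evalAt y q ∂μHE[d - 1]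
  let n : EuclideanSpace ℝ (Fin d) → EuclideanSpace ℝ (Fin d) := fun b =>
    ‖altitude T b‖⁻¹ • altitude T b
  let A : EuclideanSpace ℝ (Fin d) →ₗ[ℝ] ℂ :=
    { toFun := fun e => ∑ i, (e i : ℂ) * ∫ z in K, evalAt z (MvPolynomial.pderiv i q)
      map_add' := fun e e' => by simp [add_mul, Finset.sum_add_distrib]
      map_smul' := fun c e => by simp [Finset.mul_sum, mul_assoc] }
  let B : EuclideanSpace ℝ (Fin d) →ₗ[ℝ] ℂ :=
    { toFun := fun e => ∑ b ∈ T, ((inner ℝ e (n b) : ℝ) : ℂ) * I b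
      map_add' := fun e e' => by simp [inner_add_left, add_mul, Finset.sum_add_distrib]
      map_smul' := fun c e => by simp [inner_smul_left, Finset.mul_sum, mul_assoc] }
  have hspan : Submodule.span ℝ ((T : Set (EuclideanSpace ℝ (Fin d))) -ᵥ T) = ⊤ := by
    have h := hT.affineSpan_eq_top_iff_card_eq_finrank_add_one.2 (by simpa using hcard)
    rw [Subtype.range_coe] at h
    have := AffineSubspace.direction_top ℝ (EuclideanSpace ℝ (Fin d)) (EuclideanSpace ℝ (Fin d))
    rwa [← h, direction_affineSpan, vectorSpan_def] at this
  suffices hAB : A = B from DFunLike.congr_fun hAB e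
  -- Both sides are linear in `e` and the edge vectors span, so `e = a - b` suffices. This constant
  -- field is the difference of the radial fields `x - b` and `x - a`, and each of them gives a
  -- single face integral.
  refine LinearMap.ext_on hspan ?_
  rintro _ ⟨a, ha, b, hb, rfl⟩
  rcases eq_or_ne a b with rfl | hab
  · simp
  have ha' : a ∈ T := ha
  have hb' : b ∈ T := hb
  have hin : ∀ x ∈ T, ∀ c ∈ T, x ≠ c →
      inner ℝ (x - c) (altitude T c) = ‖altitude T c‖ ^ 2 := fun x hx c hc hxc =>
    inner_altitude (hne c hc) (subset_affineSpan ℝ _ (by simp [hxc, hx]))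
  have hpos : ∀ c ∈ T, ‖altitude T c‖ ≠ 0 := fun c hc =>
    norm_ne_zero_iff.2 (altitude_ne_zero hT hc (hne c hc))
  have hna : inner ℝ (a - b) (n a) = -‖altitude T a‖ := by
    rw [inner_smul_right, ← neg_sub b a, inner_neg_left, hin b hb' a ha' hab.symm]
    have := hpos a ha'
    field_simp
  have hnb : inner ℝ (a - b) (n b) = ‖altitude T b‖ := by
    rw [inner_smul_right, hin a ha' b hb' hab]
    have := hpos b hb'
    field_simp
  -- A face opposite to a third vertex contains both `a` and `b`, so the edge is tangent to it and
  -- there is no flux.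
  have hnc : ∀ c ∈ T, c ≠ a ∧ c ≠ b → ((inner ℝ (a - b) (n c) : ℝ) : ℂ) * I c = 0 := by
    rintro c hc ⟨hca, hcb⟩
    rw [inner_smul_right, show a - b = (a - c) - (b - c) by abel, inner_sub_left,
      hin a ha' c hc hca.symm, hin b hb' c hc hcb.symm]
    simp
  have hB : B (a - b) = ‖altitude T b‖ * I b - ‖altitude T a‖ * I a := by
    change ∑ c ∈ T, ((inner ℝ (a - b) (n c) : ℝ) : ℂ) * I c = _
    rw [Finset.sum_eq_add_of_mem a b ha' hb' hab hnc, hna, hnb]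
    push_cast
    ring
  have hq := fun q : MvPolynomial (Fin d) ℂ => evalAt_continuous q
  have hi : ∀ c : EuclideanSpace ℝ (Fin d), Integrable (fun z => d * evalAt z q
      + ∑ i, ((z i - c i : ℝ) : ℂ) * evalAt z (MvPolynomial.pderiv i q)) (volume.restrict K) :=
    fun c => (by fun_prop : Continuous _).continuousOn.integrableOn_compact
      (isCompact_convexHull_finset T)
  change A (a - b) = B (a - b)
  rw [hB, ← setIntegral_radial hd hT hb' (hne b hb') (hfin b hb') q,
    ← setIntegral_radial hd hT ha' (hne a ha') (hfin a ha') q, ← integral_sub (hi b) (hi a)]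
  change ∑ i, ((a - b) i : ℂ) * ∫ z in K, evalAt z (MvPolynomial.pderiv i q) = _
  simp only [← integral_const_mul]
  rw [← integral_finsetSum _ fun i _ => ((hq _).continuousOn.integrableOn_compact
    (isCompact_convexHull_finset T)).const_mul _]
  congr 1
  funext z
  rw [add_sub_add_left_eq_sub, ← Finset.sum_sub_distrib]
  refine Finset.sum_congr rfl fun i _ => ?_
  simp only [PiLp.sub_apply, Complex.ofReal_sub]
  ring

end Simplex

end HDG

namespace HDG

open scoped ComplexConjugate

variable {d p : ℕ} {𝒯 : Mesh d}

/-! ## Integration by parts on the triangulation -/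

lemma Mesh.Elem.affineIndependent (T : 𝒯.Elem) :
    AffineIndependent ℝ ((↑) : T.1 → EuclideanSpace ℝ (Fin d)) :=
  𝒯.complex.indep T.2.1

lemma Mesh.Elem.card_erase (T : 𝒯.Elem) {b : EuclideanSpace ℝ (Fin d)} (hb : b ∈ T.1) :
    (T.1.erase b).card = d := by
  rw [Finset.card_erase_of_mem hb, T.2.2, Nat.add_sub_cancel]

lemma Mesh.Elem.erase_nonempty (hd : 0 < d) (T : 𝒯.Elem) {b : EuclideanSpace ℝ (Fin d)}
    (hb : b ∈ T.1) : (T.1.erase b).Nonempty :=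
  Finset.card_pos.1 (by rwa [T.card_erase hb])

/-- The face of `T` opposite to the vertex `b`. -/
noncomputable def Mesh.Elem.opposite (hd : 0 < d) (T : 𝒯.Elem) (b : EuclideanSpace ℝ (Fin d)) (hb : b ∈ T.1) :
    𝒯.Face :=
  ⟨T.1.erase b, 𝒯.complex.down_closed T.2.1 (Finset.erase_subset _ _) (T.erase_nonempty hd hb),
    T.card_erase hb⟩

lemma Mesh.Elem.exists_opposite (hd : 0 < d) {T : 𝒯.Elem} {F : 𝒯.Face} (hF : F ∈ T.faces) :
    ∃ b, ∃ hb : b ∈ T.1, T.opposite hd b hb = F := by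
  obtain ⟨b, hb, h⟩ := Finset.exists_eq_insert_iff.2
    ⟨(Finset.mem_filter.1 hF).2, F.2.2.symm ▸ T.2.2.symm⟩
  refine ⟨b, h ▸ Finset.mem_insert_self _ _, Subtype.ext ?_⟩
  change T.1.erase b = F.1
  rw [← h, Finset.erase_insert hb]

lemma Mesh.Elem.sum_faces (hd : 0 < d) (T : 𝒯.Elem) (g : 𝒯.Face → ℂ) :
    ∑ F ∈ T.faces, g F = ∑ b ∈ T.1.attach, g (T.opposite hd b.1 b.2) := by
  symm
  refine Finset.sum_bij (fun b _ => T.opposite hd b.1 b.2) (fun b _ => ?_) (fun a _ b _ hab => ?_)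
    (fun F hF => ?_) fun b _ => rfl
  · exact Finset.mem_filter.2 ⟨Finset.mem_univ _, Finset.erase_subset _ _⟩
  · refine Subtype.ext ?_
    by_contra h
    have h' : T.1.erase a.1 = T.1.erase b.1 := congrArg Subtype.val hab
    have : b.1 ∈ T.1.erase a.1 := Finset.mem_erase.2 ⟨fun e => h e.symm, b.2⟩
    rw [h'] at this
    exact Finset.notMem_erase _ _ this
  · obtain ⟨b, hb, h⟩ := exists_opposite hd hF
    exact ⟨⟨b, hb⟩, Finset.mem_attach _ _, h⟩

lemma centroid_eq_smul_sum {S : Finset (EuclideanSpace ℝ (Fin d))} (hS : S.Nonempty) :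
    S.centroid ℝ id = (S.card : ℝ)⁻¹ • ∑ x ∈ S, x := by
  rw [Finset.centroid_def, Finset.affineCombination_eq_linear_combination _ _ _
    (S.sum_centroidWeights_eq_one_of_nonempty ℝ hS), Finset.smul_sum]
  rfl

/-- Replacing the barycentre of `T` by the vertex `b` multiplies the vector to the barycentre of the
face by `d + 1`; a positive factor disappears on normalization. -/
lemma normal_opposite (hd : 0 < d) (T : 𝒯.Elem) {b : EuclideanSpace ℝ (Fin d)} (hb : b ∈ T.1) :
    Mesh.normal T (T.opposite hd b hb) = ‖altitude T.1 b‖⁻¹ • altitude T.1 b := by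
  have hd' : (d : ℝ) ≠ 0 := by positivity
  have hne := T.erase_nonempty hd hb
  have hc : (T.1.erase b).centroid ℝ id - T.1.centroid ℝ id
      = ((d : ℝ) + 1)⁻¹ • ((T.1.erase b).centroid ℝ id - b) := by
    have hsum : ∑ x ∈ T.1, x = b + ∑ x ∈ T.1.erase b, x := (Finset.add_sum_erase _ _ hb).symm
    have h1 : ∑ x ∈ T.1.erase b, x = (d : ℝ) • (T.1.erase b).centroid ℝ id := by
      rw [centroid_eq_smul_sum hne, T.card_erase hb, smul_inv_smul₀ hd']
    rw [centroid_eq_smul_sum ⟨b, hb⟩, hsum, h1, T.2.2]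
    push_cast
    have hd1 : (d : ℝ) + 1 ≠ 0 := by positivity
    rw [← sub_eq_zero, smul_add, smul_sub, smul_smul]
    have : (T.1.erase b).centroid ℝ id
        = (((d : ℝ) + 1)⁻¹ * d + ((d : ℝ) + 1)⁻¹) • (T.1.erase b).centroid ℝ id := by
      rw [← mul_add_one, inv_mul_cancel₀ hd1, one_smul]
    nth_rewrite 1 [this]
    rw [add_smul]
    abel
  have hpos : (0 : ℝ) < ((d : ℝ) + 1)⁻¹ := by positivity
  change ‖(vectorSpan ℝ (T.1.erase b : Set (EuclideanSpace ℝ (Fin d))))ᗮ.starProjection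
    ((T.1.erase b).centroid ℝ id - T.1.centroid ℝ id)‖⁻¹ •
    (vectorSpan ℝ (T.1.erase b : Set (EuclideanSpace ℝ (Fin d))))ᗮ.starProjection
    ((T.1.erase b).centroid ℝ id - T.1.centroid ℝ id) = _
  rw [hc, map_smul]
  change ‖((d : ℝ) + 1)⁻¹ • altitude T.1 b‖⁻¹ • ((d : ℝ) + 1)⁻¹ • altitude T.1 b = _
  rw [norm_smul, Real.norm_of_nonneg hpos.le, smul_smul, mul_inv, mul_right_comm,
    inv_mul_cancel₀ hpos.ne', one_mul]

theorem setIntegral_pderiv_elem (hd : 0 < d) (T : 𝒯.Elem) (q : MvPolynomial (Fin d) ℂ)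
    (i : Fin d) :
    ∫ x in T.hull, evalAt x (MvPolynomial.pderiv i q)
      = ∑ F ∈ T.faces, ∫ x in F.hull, ((Mesh.normal T F i : ℝ) : ℂ) * evalAt x q ∂μHE[d - 1] := by
  have h := setIntegral_divergence hd T.affineIndependent T.2.2
    (fun b hb => (T.opposite hd b hb).measure_hull_lt_top hd) q (EuclideanSpace.single i 1)
  simp only [EuclideanSpace.inner_single_left, PiLp.single_apply, map_one, one_mul,
    apply_ite, Complex.ofReal_one, Complex.ofReal_zero, ite_mul, zero_mul, Finset.sum_ite_eq',
    Finset.mem_univ, if_true] at h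
  rw [T.sum_faces hd]
  refine h.trans ?_
  rw [← Finset.sum_attach]
  refine Finset.sum_congr rfl fun b _ => ?_
  rw [integral_const_mul, normal_opposite hd T b.2]
  rfl

lemma evalAt_mul (x : EuclideanSpace ℝ (Fin d)) (q r : MvPolynomial (Fin d) ℂ) :
    evalAt x (q * r) = evalAt x q * evalAt x r :=
  map_mul (MvPolynomial.aeval fun i => ((x i : ℝ) : ℂ)) q r

/-- The points are real, so conjugating the coefficients conjugates the value. Thus products with a
conjugated test function are again polynomials, open to the divergence theorem. -/
lemma evalAt_map_conj (x : EuclideanSpace ℝ (Fin d)) (q : MvPolynomial (Fin d) ℂ) :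
    evalAt x (MvPolynomial.map (starRingEnd ℂ) q) = conj (evalAt x q) := by
  induction q using MvPolynomial.induction_on with
  | C a => simp [evalAt]
  | add q r hq hr => simp only [map_add, hq, hr]
  | mul_X q j hq =>
    rw [map_mul, evalAt_mul, evalAt_mul, hq, map_mul]
    simp [evalAt]

lemma Mesh.Face.integrableOn (hd : 0 < d) (F : 𝒯.Face) {g : EuclideanSpace ℝ (Fin d) → ℂ}
    (hg : ContinuousOn g F.hull) : IntegrableOn g F.hull μHE[d - 1] := by
  simpa using (integrableOn_const_face hd F 1).mul_continuousOn hg F.isCompact_hull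

/-- `(r, ∇w) + (∇·r, w) = ⟨r·n, w⟩` on one element. -/
lemma integration_by_parts_elem (hd : 0 < d) (r : VSpace 𝒯 p) (w : WSpace 𝒯 p) (T : 𝒯.Elem) :
    (∫ x in T.hull, ∑ i, VSpace.val r T x i * conj (WSpace.grad w T x i))
      + ∫ x in T.hull, VSpace.div r T x * conj (WSpace.val w T x)
      = ∑ F ∈ T.faces, ∫ x in F.hull,
        VSpace.flux r T F x * conj (WSpace.val w T x) ∂μHE[d - 1] := by
  let s : Fin d → MvPolynomial (Fin d) ℂ := fun i =>
    (r T i : MvPolynomial (Fin d) ℂ) * MvPolynomial.map (starRingEnd ℂ) (w T)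
  have hs : ∀ i x, evalAt x (s i) = VSpace.val r T x i * conj (WSpace.val w T x) := fun i x => by
    rw [evalAt_mul, evalAt_map_conj]; rfl
  have hds : ∀ i x, evalAt x (MvPolynomial.pderiv i (s i))
      = VSpace.val r T x i * conj (WSpace.grad w T x i)
        + evalAt x (MvPolynomial.pderiv i (r T i : MvPolynomial (Fin d) ℂ))
          * conj (WSpace.val w T x) := fun i x => by
    rw [MvPolynomial.pderiv_mul, MvPolynomial.pderiv_map, map_add, evalAt_mul, evalAt_mul,
      evalAt_map_conj, evalAt_map_conj, add_comm]
    rfl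
  have hv := fun i => val_cont r T i
  have hw : Continuous fun x => WSpace.val w T x := continuous_wVal T w
  have hg : ∀ i, Continuous fun x => WSpace.grad w T x i := fun i => continuous_wGrad T i w
  have hdiv : Continuous fun x => VSpace.div r T x := continuous_vDiv T r
  rw [← integral_add (intOn T (by fun_prop)) (intOn T (by fun_prop))]
  have h1 : ∀ x, (∑ i, VSpace.val r T x i * conj (WSpace.grad w T x i))
      + VSpace.div r T x * conj (WSpace.val w T x)
      = ∑ i, evalAt x (MvPolynomial.pderiv i (s i)) := fun x => by
    simp only [hds, Finset.sum_add_distrib, VSpace.div, Finset.sum_mul]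
  simp only [h1]
  rw [integral_finsetSum _ fun i _ => intOn T (evalAt_continuous _)]
  simp only [setIntegral_pderiv_elem hd]
  rw [Finset.sum_comm]
  refine Finset.sum_congr rfl fun F _ => ?_
  have hi : ∀ i ∈ Finset.univ, IntegrableOn
      (fun x => ((Mesh.normal T F i : ℝ) : ℂ) * evalAt x (s i)) F.hull μHE[d - 1] := fun i _ =>
    F.integrableOn hd (continuousOn_const.mul (evalAt_continuous _).continuousOn)
  rw [← integral_finsetSum _ hi]
  congr 1
  funext x
  simp only [hs, VSpace.flux, Finset.sum_mul]
  exact Finset.sum_congr rfl fun i _ => by ring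

lemma integration_by_parts (hd : 0 < d) (r : VSpace 𝒯 p) (w : WSpace 𝒯 p) :
    intElems (fun T x => ∑ i, VSpace.val r T x i * conj (WSpace.grad w T x i))
      + intElems (fun T x => VSpace.div r T x * conj (WSpace.val w T x))
      = intSkeleton fun T F x => VSpace.flux r T F x * conj (WSpace.val w T x) := by
  rw [intElems, intElems, intSkeleton, ← Finset.sum_add_distrib]
  exact Finset.sum_congr rfl fun T _ => integration_by_parts_elem hd r w T

end HDG

namespace HDG

open scoped ComplexConjugate

variable {d p : ℕ} {𝒯 : Mesh d}

/-! ## Positive definiteness of the HDG inner product -/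

lemma conj_intElems (φ : 𝒯.Elem → EuclideanSpace ℝ (Fin d) → ℂ) :
    conj (intElems φ) = intElems fun T x => conj (φ T x) := by
  simp only [intElems, map_sum, integral_conj]

lemma conj_intSkeleton (φ : 𝒯.Elem → 𝒯.Face → EuclideanSpace ℝ (Fin d) → ℂ) :
    conj (intSkeleton φ) = intSkeleton fun T F x => conj (φ T F x) := by
  simp only [intSkeleton, map_sum, integral_conj]

lemma gram_liftW (w : WSpace 𝒯 p) (r : VSpace 𝒯 p) : gram (liftW w) r
    = -intElems fun T x => WSpace.val w T x * conj (VSpace.div r T x) := by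
  obtain ⟨A, hA⟩ := exists_sesqForm _ (isAffineSesq_liftW (𝒯 := 𝒯) (p := p))
  exact gram_riesz _ (fun r s => by simp only [← hA, map_add])
    (fun c r => by simp only [← hA, LinearMap.map_smulₛₗ, smul_eq_mul]) r

lemma gram_liftM (hd : 0 < d) (μ : MSpace 𝒯 p) (r : VSpace 𝒯 p) : gram (liftM μ) r
    = intSkeleton fun T F x => MSpace.val μ F x * conj (VSpace.flux r T F x) := by
  obtain ⟨A, hA⟩ := exists_sesqForm _ (isAffineSesq_liftM (𝒯 := 𝒯) (p := p) hd)
  exact gram_riesz _ (fun r s => by simp only [← hA, map_add])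
    (fun c r => by simp only [← hA, LinearMap.map_smulₛₗ, smul_eq_mul]) r

/-- Tested with `q` itself, the liftings express `(q, q)` through `(∇·q, w)` and `⟨q·n, μ⟩`.
Integration by parts turns the volume and skeleton terms of the form into the same quantities, and
the two stabilization terms combine to a square. -/
lemma innerW_self_eq (hd : 0 < d) (τ : ℝ) (w : Space 𝒯 p) :
    innerW τ w w = gram (liftW w.1 + liftM w.2) (liftW w.1 + liftM w.2)
      + ((τ * ∑ T : 𝒯.Elem, ∑ F ∈ T.faces, ∫ x in F.hull,
          ‖WSpace.val w.1 T x - MSpace.val w.2 F x‖ ^ 2 ∂μHE[d - 1]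
        + (∑ T : 𝒯.Elem, ∫ x in T.hull, ‖WSpace.val w.1 T x‖ ^ 2)
        + ∑ F ∈ 𝒯.boundaryFaces, ∫ x in F.hull, ‖MSpace.val w.2 F x‖ ^ 2 ∂μHE[d - 1] : ℝ) : ℂ) := by
  set q := liftW w.1 + liftM w.2 with hq
  have hg : gram q q = -intElems (fun T x => VSpace.div q T x * conj (WSpace.val w.1 T x))
      + intSkeleton fun T F x => VSpace.flux q T F x * conj (MSpace.val w.2 F x) := by
    rw [← gram_conj]
    nth_rewrite 1 [hq]
    rw [gram_add_left, gram_liftW, gram_liftM hd, map_add, map_neg, conj_intElems,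
      conj_intSkeleton]
    simp only [map_mul, Complex.conj_conj, mul_comm]
  have hibp := integration_by_parts hd q w.1
  -- Subtracting the two skeleton terms pairs the stabilization `-τ (w - μ)` with `conj (μ - w)`,
  -- which is `τ |w - μ|²`.
  have hskel : intSkeleton (𝒯 := 𝒯) (fun T F x => (VSpace.flux q T F x
          - (τ : ℂ) * (WSpace.val w.1 T x - MSpace.val w.2 F x)) * conj (MSpace.val w.2 F x))
      - intSkeleton (𝒯 := 𝒯) (fun T F x => (VSpace.flux q T F x
          - (τ : ℂ) * (WSpace.val w.1 T x - MSpace.val w.2 F x)) * conj (WSpace.val w.1 T x))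
      = intSkeleton (𝒯 := 𝒯) (fun T F x => VSpace.flux q T F x * conj (MSpace.val w.2 F x))
        - intSkeleton (𝒯 := 𝒯) (fun T F x => VSpace.flux q T F x * conj (WSpace.val w.1 T x))
        + ((τ * ∑ T : 𝒯.Elem, ∑ F ∈ T.faces, ∫ x in F.hull,
          ‖WSpace.val w.1 T x - MSpace.val w.2 F x‖ ^ 2 ∂μHE[d - 1] : ℝ) : ℂ) := by
    simp only [intSkeleton, Complex.ofReal_mul, Complex.ofReal_sum, Finset.mul_sum,
      ← Finset.sum_sub_distrib, ← Finset.sum_add_distrib]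
    refine Finset.sum_congr rfl fun T _ => Finset.sum_congr rfl fun F _ => ?_
    have hf : ContinuousOn (fun x => VSpace.flux q T F x) F.hull :=
      (continuous_vFlux T F q).continuousOn
    have hw : ContinuousOn (fun x => WSpace.val w.1 T x) F.hull :=
      (continuous_wVal T w.1).continuousOn
    have hm : ContinuousOn (fun x => MSpace.val w.2 F x) F.hull := continuousOn_mVal F w.2
    have hfl : ContinuousOn (fun x => VSpace.flux q T F x
        - (τ : ℂ) * (WSpace.val w.1 T x - MSpace.val w.2 F x)) F.hull :=
      hf.sub (continuousOn_const.mul (hw.sub hm))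
    have hi : ∀ {f g : EuclideanSpace ℝ (Fin d) → ℂ}, ContinuousOn f F.hull →
        ContinuousOn g F.hull →
        Integrable (fun x => f x * conj (g x)) (μHE[d - 1].restrict F.hull) :=
      fun hf hg => F.integrableOn hd (hf.mul (Complex.continuous_conj.comp_continuousOn hg))
    have hn : IntegrableOn (fun x => ((‖WSpace.val w.1 T x - MSpace.val w.2 F x‖ ^ 2 : ℝ) : ℂ))
        F.hull μHE[d - 1] := F.integrableOn hd
      (Complex.continuous_ofReal.comp_continuousOn ((hw.sub hm).norm.pow 2))
    have hsub : Integrable (fun x => VSpace.flux q T F x * conj (MSpace.val w.2 F x)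
        - VSpace.flux q T F x * conj (WSpace.val w.1 T x)) (μHE[d - 1].restrict F.hull) :=
      (hi hf hm).sub (hi hf hw)
    rw [← integral_complex_ofReal, ← integral_const_mul, ← integral_sub (hi hfl hm) (hi hfl hw),
      ← integral_sub (hi hf hm) (hi hf hw),
      ← integral_add hsub (hn.const_mul _)]
    congr 1
    funext x
    have : ((‖WSpace.val w.1 T x - MSpace.val w.2 F x‖ ^ 2 : ℝ) : ℂ)
        = (WSpace.val w.1 T x - MSpace.val w.2 F x)
          * (conj (WSpace.val w.1 T x) - conj (MSpace.val w.2 F x)) := by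
      rw [← map_sub, Complex.mul_conj']; push_cast; rfl
    simp only [this]
    ring
  have hE : intElems (fun T x => WSpace.val w.1 T x * conj (WSpace.val w.1 T x))
      = ((∑ T : 𝒯.Elem, ∫ x in T.hull, ‖WSpace.val w.1 T x‖ ^ 2 : ℝ) : ℂ) := by
    simp only [intElems, Complex.mul_conj', Complex.ofReal_sum, ← integral_complex_ofReal,
      Complex.ofReal_pow]
  have hB : intBoundary (𝒯 := 𝒯) (fun F x => MSpace.val w.2 F x * conj (MSpace.val w.2 F x))
      = ((∑ F ∈ 𝒯.boundaryFaces, ∫ x in F.hull, ‖MSpace.val w.2 F x‖ ^ 2 ∂μHE[d - 1] : ℝ) : ℂ) := by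
    simp only [intBoundary, Complex.mul_conj', Complex.ofReal_sum, ← integral_complex_ofReal,
      Complex.ofReal_pow]
  simp only [innerW, aForm, one_mul, Complex.ofReal_one]
  rw [hE, hB, Complex.ofReal_add, Complex.ofReal_add, hg]
  linear_combination hibp + hskel

lemma gram_self_re_nonneg (q : VSpace 𝒯 p) : 0 ≤ (gram q q).re := by
  have h1 : gram q q =
      ((∑ T : 𝒯.Elem, ∫ x in T.hull, ∑ i, ‖VSpace.val q T x i‖ ^ 2 : ℝ) : ℂ) := by
    simp only [gram, intElems, Complex.mul_conj', Complex.ofReal_sum, ← integral_complex_ofReal,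
      Complex.ofReal_pow]
  rw [h1, Complex.ofReal_re]
  exact Finset.sum_nonneg fun T _ => integral_nonneg fun x => Finset.sum_nonneg fun i _ =>
    sq_nonneg _

/-- Relatively open subsets of a face have positive surface measure. -/
lemma measure_face_inter_ne_zero (hd : 0 < d) {T : 𝒯.Elem} {F : 𝒯.Face} (hF : F ∈ T.faces)
    {V : Set (EuclideanSpace ℝ (Fin d))} (hV : IsOpen V) {y₀ : EuclideanSpace ℝ (Fin d)}
    (hy₀ : y₀ ∈ F.hull) (hy₀V : y₀ ∈ V) : μHE[d - 1] (F.hull ∩ V) ≠ 0 := by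
  obtain ⟨b, hb, h⟩ := Mesh.Elem.exists_opposite hd hF
  have hne := T.erase_nonempty hd hb
  have hFh : convexHull ℝ (T.1.erase b : Set (EuclideanSpace ℝ (Fin d))) = F.hull := by
    rw [← h]; rfl
  refine measure_base_inter_ne_zero (b := b) (T := T.hull)
    (altitude_ne_zero T.affineIndependent hb hne) (fun y hy => ?_) (fun z => ?_) (hull_compact T)
    ?_ hV hy₀ hy₀V
  · rw [← hFh] at hy
    exact inner_altitude hne (convexHull_subset_affineSpan _ hy)
  · rw [← hFh]
    exact mem_convexHull_iff_homothety hb hne z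
  · rw [Mesh.Elem.hull, (convex_convexHull ℝ _).closure_interior_eq_closure_of_nonempty_interior
      (hull_interior T)]
    exact subset_closure

/-- If `g` is nonzero at a point, by continuity it is nonzero on a relatively open piece of the
face, and such a piece has positive surface measure. -/
lemma eqOn_zero_of_setIntegral_face (hd : 0 < d) {T : 𝒯.Elem} {F : 𝒯.Face} (hF : F ∈ T.faces)
    {g : EuclideanSpace ℝ (Fin d) → ℂ} (hg : ContinuousOn g F.hull)
    (h : ∫ x in F.hull, ‖g x‖ ^ 2 ∂μHE[d - 1] = 0) {x : EuclideanSpace ℝ (Fin d)}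
    (hx : x ∈ F.hull) : g x = 0 := by
  have hi : IntegrableOn (fun x => ‖g x‖ ^ 2) F.hull μHE[d - 1] := by
    have := F.integrableOn hd (hg.mul hg)
    simpa [IntegrableOn, pow_two] using this.norm
  have h0 := (setIntegral_eq_zero_iff_of_nonneg_ae
    (Filter.Eventually.of_forall fun x => sq_nonneg _) hi).1 h
  by_contra hne
  obtain ⟨V, hV, hVg⟩ := continuousOn_iff'.1 hg {0}ᶜ isOpen_compl_singleton
  have hxV : x ∈ V := by
    have : x ∈ g ⁻¹' {0}ᶜ ∩ F.hull := ⟨hne, hx⟩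
    rw [hVg] at this
    exact this.1
  refine measure_face_inter_ne_zero hd hF hV hx hxV ?_
  have h1 : ∀ᵐ y ∂(μHE[d - 1] : Measure (EuclideanSpace ℝ (Fin d))),
      y ∈ F.hull → ‖g y‖ ^ 2 = 0 :=
    (ae_restrict_iff' F.isCompact_hull.measurableSet).1 h0
  refine measure_mono_null (fun y hy => ?_) h1
  have hy' : y ∈ g ⁻¹' {0}ᶜ ∩ F.hull := by rw [hVg]; exact ⟨hy.2, hy.1⟩
  intro hc
  exact hy'.1 (by simpa using hc hy.1)

lemma WSpace.eq_zero_of_setIntegral (w : WSpace 𝒯 p)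
    (h : ∀ T : 𝒯.Elem, ∫ x in T.hull, ‖WSpace.val w T x‖ ^ 2 = 0) : w = 0 := by
  funext T
  have hc : Continuous fun x => ‖WSpace.val w T x‖ ^ 2 := (continuous_wVal T w).norm.pow 2
  have h0 := (setIntegral_eq_zero_iff_of_nonneg_ae
    (Filter.Eventually.of_forall fun x => sq_nonneg _)
    (hc.continuousOn.integrableOn_compact (hull_compact T))).1 (h T)
  have h2 : (fun x => ‖WSpace.val w T x‖ ^ 2) =ᵐ[volume.restrict (interior T.hull)] 0 :=
    ae_restrict_of_ae_restrict_of_subset interior_subset h0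
  have h3 := Measure.eqOn_open_of_ae_eq h2 isOpen_interior hc.continuousOn continuousOn_const
  refine Subtype.ext (eq_zero_of_open _ _ isOpen_interior (hull_interior T) fun x hx => ?_)
  simpa [WSpace.val] using h3 hx

/-- All summands are nonnegative. If the total is not positive, the volume term forces `w = 0` on
every element, and then the stabilization term forces `μ = 0` on every face. -/
theorem innerW_self_re_pos (hd : 0 < d) {τ : ℝ} (hτ : 0 < τ) {w : Space 𝒯 p} (hw : w ≠ 0) :
    0 < (innerW τ w w).re := by
  rw [innerW_self_eq hd, Complex.add_re, Complex.ofReal_re]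
  have hq := gram_self_re_nonneg (liftW w.1 + liftM w.2)
  have nT : ∀ T : 𝒯.Elem, 0 ≤ ∫ x in T.hull, ‖WSpace.val w.1 T x‖ ^ 2 := fun T =>
    integral_nonneg fun x => sq_nonneg _
  have nF : ∀ (T : 𝒯.Elem) (F : 𝒯.Face), 0 ≤ ∫ x in F.hull,
      ‖WSpace.val w.1 T x - MSpace.val w.2 F x‖ ^ 2 ∂μHE[d - 1] := fun T F =>
    integral_nonneg fun x => sq_nonneg _
  have nB : 0 ≤ ∑ F ∈ 𝒯.boundaryFaces, ∫ x in F.hull, ‖MSpace.val w.2 F x‖ ^ 2 ∂μHE[d - 1] :=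
    Finset.sum_nonneg fun F _ => integral_nonneg fun x => sq_nonneg _
  have nE := Finset.sum_nonneg fun T (_ : T ∈ Finset.univ) => nT T
  have nS := Finset.sum_nonneg fun T (_ : T ∈ Finset.univ) =>
    Finset.sum_nonneg fun F (_ : F ∈ T.faces) => nF T F
  by_contra! hle
  have hτS := mul_nonneg hτ.le nS
  have hE : ∑ T : 𝒯.Elem, ∫ x in T.hull, ‖WSpace.val w.1 T x‖ ^ 2 = 0 := by linarith
  have hS : ∑ T : 𝒯.Elem, ∑ F ∈ T.faces, ∫ x in F.hull,
      ‖WSpace.val w.1 T x - MSpace.val w.2 F x‖ ^ 2 ∂μHE[d - 1] = 0 :=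
    (mul_eq_zero.1 (by linarith)).resolve_left hτ.ne'
  have hw1 : w.1 = 0 := WSpace.eq_zero_of_setIntegral _ fun T =>
    (Finset.sum_eq_zero_iff_of_nonneg fun T _ => nT T).1 hE T (Finset.mem_univ T)
  refine hw (Prod.ext hw1 ?_)
  funext F
  -- Purity of the complex: each face bounds some element, so its trace is seen by the stabilization
  -- term.
  obtain ⟨t, ht, hFt, hcard⟩ := 𝒯.pure F.1 F.2.1
  let T : 𝒯.Elem := ⟨t, ht, hcard⟩
  have hF : F ∈ T.faces := Finset.mem_filter.2 ⟨Finset.mem_univ _, hFt⟩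
  have h1 := (Finset.sum_eq_zero_iff_of_nonneg fun T _ =>
    Finset.sum_nonneg fun F _ => nF T F).1 hS T (Finset.mem_univ T)
  have h2 := (Finset.sum_eq_zero_iff_of_nonneg fun F _ => nF T F).1 h1 F hF
  refine Subtype.ext (funext fun x => ?_)
  by_cases hx : x ∈ F.hull
  · have := eqOn_zero_of_setIntegral_face hd hF
      ((continuous_wVal T w.1).continuousOn.sub (continuousOn_mVal F w.2)) h2 hx
    have hz : WSpace.val w.1 T x = 0 := by rw [hw1]; simp [WSpace.val]
    have h3 : WSpace.val w.1 T x - MSpace.val w.2 F x = 0 := this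
    rw [hz, zero_sub, neg_eq_zero] at h3
    exact h3
  · obtain ⟨q, -, hq⟩ := (w.2 F).2
    rw [← hq]
    exact Set.indicator_of_notMem hx fun x => evalAt x q

end HDG

namespace HDG

open scoped ComplexConjugate

variable {d p Q : ℕ} {𝒯 : Mesh d}

/-! ## The output error bound -/

lemma exists_sesqForm_innerW (hd : 0 < d) (τ : ℝ) :
    ∃ B : Space 𝒯 p →ₗ[ℂ] Space 𝒯 p →ₗ⋆[ℂ] ℂ, ∀ v w, B v w = innerW τ v w := by
  have := isAffineSesq_aForm (𝒯 := 𝒯) (p := p) (Q := 0) hd τ (κ₀ := fun _ _ => 1) (ψ := 0)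
    (ϱ := fun _ => 1) (ν := fun _ => 1) (fun _ => measurable_const) (fun q => q.elim0)
    ⟨1, fun _ _ _ => by simp⟩ ⟨0, fun q => q.elim0⟩ (fun T => integrableOn_const_elem T 1)
    fun F _ => integrableOn_const_face hd F 1
  refine exists_sesqForm _ ?_
  simpa using! this

namespace Problem

variable (D : Problem 𝒯 p Q)

lemma exists_sesqForm_a (hd : 0 < d) :
    ∃ A : (Fin Q → ℝ) → Space 𝒯 p →ₗ[ℂ] Space 𝒯 p →ₗ⋆[ℂ] ℂ,
      (∀ y v w, A y v w = D.a y v w) ∧ ∀ v w, Continuous fun y => A y v w :=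
  (isAffineSesq_aForm hd D.τ D.measurable_κbar D.measurable_ψ D.bounded_κbar D.bounded_ψ
    D.integrable_ϱ D.integrable_ν).exists_eq

lemma normW_nonneg (τ : ℝ) (w : Space 𝒯 p) : 0 ≤ normW τ w := Real.sqrt_nonneg _

lemma infSup_le (y : Fin Q → ℝ) {w : Space 𝒯 p} (hw : w ≠ 0) :
    D.infSup y ≤ ⨆ v : {v : Space 𝒯 p // v ≠ 0},
      ‖D.a y w v.1‖ / (normW D.τ w * normW D.τ v.1) :=
  ciInf_le (f := fun w : {w : Space 𝒯 p // w ≠ 0} => ⨆ v : {v : Space 𝒯 p // v ≠ 0},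
      ‖D.a y w.1 v.1‖ / (normW D.τ w.1 * normW D.τ v.1))
    ⟨0, by
      rintro _ ⟨w, rfl⟩
      exact Real.iSup_nonneg fun v => div_nonneg (norm_nonneg _)
        (mul_nonneg (normW_nonneg _ _) (normW_nonneg _ _))⟩ ⟨w, hw⟩

lemma exists_ne_zero_of_infSup_pos {y : Fin Q → ℝ} (h : 0 < D.infSup y) {w : Space 𝒯 p}
    (hw : w ≠ 0) : ∃ v, D.a y w v ≠ 0 := by
  by_contra! h0
  refine (h.trans_le (D.infSup_le y hw)).not_ge ?_
  exact Real.iSup_nonpos fun v => by rw [h0, norm_zero, zero_div]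

variable {D}

/-- The a priori constant `C` only serves to show that the supremum is over a bounded set; an
unbounded real supremum has the default value `0`. -/
lemma norm_le_dualNorm_mul {r : Space 𝒯 p → ℂ} {C : ℝ} (hr : ∀ w, ‖r w‖ ≤ C * normW D.τ w)
    (w : Space 𝒯 p) : ‖r w‖ ≤ D.dualNorm r * normW D.τ w := by
  rcases (normW_nonneg D.τ w).eq_or_lt with h | h
  · have := hr w
    rw [← h, mul_zero] at this ⊢
    exact this
  · rw [← div_le_iff₀ h]
    have hb : BddAbove (Set.range fun w => ‖r w‖ / normW D.τ w) := by
      refine ⟨max C 0, Set.forall_mem_range.2 fun v => ?_⟩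
      rcases (normW_nonneg D.τ v).eq_or_lt with h' | h'
      · rw [← h', div_zero]
        exact le_max_right _ _
      · exact (div_le_iff₀ h').2 ((hr v).trans
          (mul_le_mul_of_nonneg_right (le_max_left C 0) (normW_nonneg D.τ v)))
    exact le_ciSup hb w

lemma dualNorm_nonneg (r : Space 𝒯 p → ℂ) : 0 ≤ D.dualNorm r :=
  Real.iSup_nonneg fun _ => div_nonneg (norm_nonneg _) (normW_nonneg _ _)

lemma infSup_mul_normW_le {y : Fin Q → ℝ} {w : Space 𝒯 p} {C : ℝ}
    (hr : ∀ v, ‖D.a y w v‖ ≤ C * normW D.τ v) (hw : w ≠ 0) (hpos : 0 < normW D.τ w) :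
    D.infSup y * normW D.τ w ≤ D.dualNorm (D.a y w) := by
  rw [← le_div_iff₀ hpos]
  refine (D.infSup_le y hw).trans ?_
  have : Nonempty {v : Space 𝒯 p // v ≠ 0} := ⟨⟨w, hw⟩⟩
  refine ciSup_le fun v => ?_
  rw [mul_comm, ← div_div]
  refine div_le_div_of_nonneg_right ?_ hpos.le
  rcases (normW_nonneg D.τ v.1).eq_or_lt with h | h
  · rw [← h, div_zero]
    exact dualNorm_nonneg _
  · exact (div_le_iff₀ h).2 (norm_le_dualNorm_mul hr _)

lemma exists_norm_le_normW (hd : 0 < d) (hpos : ∀ w : Space 𝒯 p, w ≠ 0 → 0 < (innerW D.τ w w).re)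
    (l : Space 𝒯 p →ₗ[ℂ] ℂ) : ∃ C, ∀ w, ‖l w‖ ≤ C * normW D.τ w := by
  obtain ⟨B, hB⟩ := exists_sesqForm_innerW (𝒯 := 𝒯) (p := p) hd D.τ
  simpa only [hB] using! exists_norm_le_mul_sqrt B (fun w hw => by rw [hB]; exact hpos w hw) l

lemma exists_norm_le_normW_conj (hd : 0 < d)
    (hpos : ∀ w : Space 𝒯 p, w ≠ 0 → 0 < (innerW D.τ w w).re)
    (l : Space 𝒯 p →ₗ⋆[ℂ] ℂ) : ∃ C, ∀ w, ‖l w‖ ≤ C * normW D.τ w := by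
  let l' : Space 𝒯 p →ₗ[ℂ] ℂ :=
    { toFun := fun w => conj (l w)
      map_add' := fun v w => by simp
      map_smul' := fun c w => by simp }
  obtain ⟨C, hC⟩ := exists_norm_le_normW hd hpos l'
  exact ⟨C, fun w => by simpa [l'] using hC w⟩

/-- The reduced basis output error is at most the a posteriori output bound. -/
theorem abs_output_sub_le (hd : 0 < d) {β : (Fin Q → ℝ) → ℝ}
    {uh uN φN : (Fin Q → ℝ) → Space 𝒯 p} {y : Fin Q → ℝ} (hβ : 0 < β y)
    (hβh : β y ≤ D.infSup y) (huh : D.IsHDG y (uh y)) :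
    |D.hdgOutput uh y - D.rbOutput uN φN y| ≤ D.outputBound β uN φN y := by
  have hpos : ∀ w : Space 𝒯 p, w ≠ 0 → 0 < (innerW D.τ w w).re :=
    fun w hw => innerW_self_re_pos hd D.τ_pos hw
  obtain ⟨A, hA, -⟩ := D.exists_sesqForm_a hd
  set e := uh y - uN y
  have hae : ∀ v, D.a y e v = D.a y (uh y) v - D.a y (uN y) v := fun v => by
    simp only [← hA, e, map_sub, LinearMap.sub_apply]
  have hres : (fun v => D.b v - D.a y (uN y) v) = D.a y e := by
    funext v
    rw [hae, huh v]
  have hprimal : β y * normW D.τ e ≤ D.dualNorm (fun v => D.b v - D.a y (uN y) v) := by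
    rw [hres]
    -- The inf-sup constant sees only nonzero vectors, so a vanishing error is treated apart.
    rcases eq_or_ne e 0 with h0 | h0
    · have : normW D.τ e = 0 := by
        obtain ⟨B, hB⟩ := exists_sesqForm_innerW (𝒯 := 𝒯) (p := p) hd D.τ
        rw [normW, ← hB, h0]
        simp
      rw [this, mul_zero]
      exact dualNorm_nonneg _
    · obtain ⟨C, hC⟩ := exists_norm_le_normW_conj hd hpos (A y e)
      simp only [hA] at hC
      refine le_trans ?_ (infSup_mul_normW_le hC h0 (Real.sqrt_pos.2 (hpos e h0)))
      exact mul_le_mul_of_nonneg_right hβh (normW_nonneg _ _)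
  have hdual : ‖-D.ℓ e - D.a y e (φN y)‖
      ≤ D.dualNorm (fun w => -D.ℓ w - D.a y w (φN y)) * normW D.τ e := by
    obtain ⟨C, hC⟩ := exists_norm_le_normW hd hpos (-D.ℓ - (A y).flip (φN y))
    simp only [LinearMap.sub_apply, LinearMap.neg_apply, LinearMap.flip_apply, hA] at hC
    exact norm_le_dualNorm_mul (r := fun w => -D.ℓ w - D.a y w (φN y)) hC e
  -- Here `b_h(φ_N)` is replaced by `a_h(u_h, φ_N)`: the correction in the reduced output converts
  -- the error `ℓ(e)` into a dual residual at `e`.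
  have hdiff : D.hdgOutput uh y - D.rbOutput uN φN y = -(-D.ℓ e - D.a y e (φN y)).re := by
    rw [hdgOutput, rbOutput, ← huh (φN y), ← Complex.sub_re, ← Complex.neg_re, hae]
    congr 1
    simp only [e, map_sub]
    ring
  rw [hdiff, abs_neg]
  refine (Complex.abs_re_le_norm _).trans (hdual.trans ?_)
  have hout : D.outputBound β uN φN y = D.dualNorm (fun w => -D.ℓ w - D.a y w (φN y))
      * (D.dualNorm (fun v => D.b v - D.a y (uN y) v) / β y) := by
    rw [outputBound, primalBound, dualBound]
    field_simp
  rw [hout]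
  refine mul_le_mul_of_nonneg_left ?_ (dualNorm_nonneg _)
  rw [le_div_iff₀ hβ, mul_comm]
  exact hprimal

/-- A positive inf-sup constant makes the form nondegenerate at each parameter, and the form is
affine in the parameter, so Cramer's rule applies. On the box this supplies both measurability and
boundedness of the output. -/
lemma continuousOn_hdgOutput (hd : 0 < d) {K : Set (Fin Q → ℝ)} (hK : ∀ y ∈ K, 0 < D.infSup y)
    {uh : (Fin Q → ℝ) → Space 𝒯 p} (huh : ∀ y ∈ K, D.IsHDG y (uh y)) :
    ContinuousOn (D.hdgOutput uh) K := by
  obtain ⟨A, hA, hcont⟩ := D.exists_sesqForm_a hd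
  refine Complex.continuous_re.comp_continuousOn (continuousOn_solution A hcont (b := D.b)
    (fun y hy w hw => ?_) (fun y hy w => (hA _ _ _).trans (huh y hy w)) D.ℓ)
  by_contra h0
  obtain ⟨v, hv⟩ := D.exists_ne_zero_of_infSup_pos (hK y hy) h0
  exact hv ((hA y w v).symm.trans (hw v))

end Problem

/-! ## The law of the random parameters -/

lemma isCompact_paramBox (γ : Fin Q → ℝ) : IsCompact (paramBox γ) :=
  isCompact_univ_pi fun _ => isCompact_Icc

lemma measurableSet_paramBox (γ : Fin Q → ℝ) : MeasurableSet (paramBox γ) :=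
  (isCompact_paramBox γ).measurableSet

lemma paramLaw_absolutelyContinuous (γ : Fin Q → ℝ) (ρ : Fin Q → ℝ → ℝ) :
    paramLaw γ ρ ≪ volume.restrict (paramBox γ) :=
  withDensity_absolutelyContinuous _ _

lemma ae_mem_paramBox (γ : Fin Q → ℝ) (ρ : Fin Q → ℝ → ℝ) :
    ∀ᵐ y ∂paramLaw γ ρ, y ∈ paramBox γ :=
  (paramLaw_absolutelyContinuous γ ρ).ae_le (ae_restrict_mem (measurableSet_paramBox γ))

/-- `ENNReal.ofReal` does not alter the density here, because it is nonnegative on the box. -/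
lemma expect_eq_integral_paramLaw {γ : Fin Q → ℝ} {ρ : Fin Q → ℝ → ℝ} (hρ : IsDensity γ ρ)
    (s : (Fin Q → ℝ) → ℝ) : expect γ ρ s = ∫ y, s y ∂paramLaw γ ρ := by
  have hm : Measurable (jointDensity ρ) :=
    Finset.measurable_fun_prod _ fun q _ => (hρ.measurable q).comp (measurable_pi_apply q)
  rw [paramLaw, integral_withDensity_eq_integral_toReal_smul hm.ennreal_ofReal
    (ae_of_all _ fun _ => ENNReal.ofReal_lt_top), expect]
  refine setIntegral_congr_fun (measurableSet_paramBox γ) fun y hy => ?_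
  have h0 : 0 ≤ jointDensity ρ y :=
    Finset.prod_nonneg fun q _ => hρ.nonneg q _ (hy q (Set.mem_univ q))
  simp only [ENNReal.toReal_ofReal h0, smul_eq_mul, mul_comm]

end HDG

/-! ### The confidence interval for the HDG output -/

theorem mainTheorem5 {d p Q : ℕ} (hd : 0 < d)
    -- the triangulation and the parametrized HDG problem on it
    (𝒯 : HDG.Mesh d) (D : HDG.Problem 𝒯 p Q)
    -- the parameter domain and the densities of the independent parameters
    (γ : Fin Q → ℝ) (ρ : Fin Q → ℝ → ℝ) (hρ : HDG.IsDensity γ ρ)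
    -- the HDG solution
    (uh : (Fin Q → ℝ) → HDG.Space 𝒯 p)
    (huh : ∀ y ∈ HDG.paramBox γ, D.IsHDG y (uh y))
    -- the orthonormal primal and dual bases, and the reduced basis approximations
    {Nmax : ℕ} (ζpr ζdu : Fin Nmax → HDG.Space 𝒯 p)
    (hζpr : ∀ m n, HDG.innerW D.τ (ζpr m) (ζpr n) = if m = n then 1 else 0)
    (hζdu : ∀ m n, HDG.innerW D.τ (ζdu m) (ζdu n) = if m = n then 1 else 0)
    (N : ℕ) (hN : 1 ≤ N) (hNmax : N ≤ Nmax)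
    (uN φN : (Fin Q → ℝ) → HDG.Space 𝒯 p)
    (huN : ∀ y ∈ HDG.paramBox γ, D.IsPrimalRB (HDG.rbSpace ζpr N) y (uN y))
    (hφN : ∀ y ∈ HDG.paramBox γ, D.IsDualRB (HDG.rbSpace ζdu N) y (φN y))
    -- the positive lower bound for the inf-sup constant
    (β : (Fin Q → ℝ) → ℝ)
    (hβ : ∀ y ∈ HDG.paramBox γ, 0 < β y ∧ β y ≤ D.infSup y)
    -- the reduced basis output and its error bound are random variables
    (hsN : AEMeasurable (D.rbOutput uN φN) (HDG.paramLaw γ ρ))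
    (hΔs : AEMeasurable (D.outputBound β uN φN) (HDG.paramLaw γ ρ))
    -- the random samples
    {Ω : Type*} [MeasurableSpace Ω] (P : Measure Ω) [IsProbabilityMeasure P]
    (Y : ℕ → Ω → Fin Q → ℝ) (hYm : ∀ m, Measurable (Y m)) (hYi : iIndepFun Y P)
    (hYl : ∀ m, P.map (Y m) = HDG.paramLaw γ ρ)
    (a : ℝ) (ha : 0 < a) :
    ∃ L : ℝ,
      Tendsto (fun M : ℕ => P.real {ω |
          |HDG.expect γ ρ (D.hdgOutput uh)
              - HDG.mcMean (D.rbOutput uN φN) (fun m => Y m ω) M|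
            ≤ HDG.mcTotalBound a (D.rbOutput uN φN) (D.outputBound β uN φN)
                (fun m => Y m ω) M})
        atTop (𝓝 L)
      ∧ HDG.erf (a / √2) ≤ L := by
  have hcont := HDG.Problem.continuousOn_hdgOutput hd
    (fun y hy => (hβ y hy).1.trans_le (hβ y hy).2) huh
  have hs : AEMeasurable (D.hdgOutput uh) (HDG.paramLaw γ ρ) :=
    (hcont.aemeasurable (HDG.measurableSet_paramBox γ)).mono_ac
      (HDG.paramLaw_absolutelyContinuous γ ρ)
  obtain ⟨C, hC⟩ := (HDG.isCompact_paramBox γ).exists_bound_of_continuousOn hcont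
  -- The Monte Carlo theorem asks for measurable functions with bounds at every point, whereas the
  -- outputs are controlled only on the box. Measurable versions are therefore clipped to `[-|C|,
  -- |C|]`, and the error bound is enlarged to at least `|s - t|`; almost surely neither change has
  -- any effect.
  let s := fun y => max (-|C|) (min (hs.mk _ y) |C|)
  let t := hsN.mk _
  let r := fun y => max (hΔs.mk _ y) |s y - t y|
  have hsm : Measurable s := measurable_const.max (hs.measurable_mk.min measurable_const)
  have htm : Measurable t := hsN.measurable_mk
  have hrm : Measurable r := hΔs.measurable_mk.max (hsm.sub htm).abs
  have hsC : ∀ y, |s y| ≤ |C| := fun y =>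
    abs_le.2 ⟨le_max_left _ _, max_le (neg_le_self (abs_nonneg C)) (min_le_right _ _)⟩
  have hs_eq : ∀ᵐ y ∂HDG.paramLaw γ ρ, D.hdgOutput uh y = s y := by
    filter_upwards [hs.ae_eq_mk, HDG.ae_mem_paramBox γ ρ] with y h1 h2
    have := abs_le.1 ((hC y h2).trans (le_abs_self C))
    simp only [s, ← h1]
    rw [min_eq_left this.2, max_eq_right this.1]
  have hr_eq : ∀ᵐ y ∂HDG.paramLaw γ ρ, D.outputBound β uN φN y = r y := by
    filter_upwards [hs_eq, hsN.ae_eq_mk, hΔs.ae_eq_mk, HDG.ae_mem_paramBox γ ρ] with y h1 h2 h3 h4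
    simp only [r, t, ← h1, ← h2, ← h3]
    rw [max_eq_left]
    exact HDG.Problem.abs_output_sub_le hd (hβ y h4).1 (hβ y h4).2 (huh y h4)
  obtain ⟨L, hL, hle⟩ := HDG.exists_tendsto_measureReal_mcTotalBound hYm hYi hYl hsm htm hrm hsC
    (fun y => le_max_right _ _) ha
  refine ⟨L, hL.congr fun M => measureReal_congr (eventuallyEq_set.2 ?_), hle⟩
  rw [HDG.expect_eq_integral_paramLaw hρ, integral_congr_ae hs_eq]
  -- Almost surely all samples avoid the exceptional null sets at once, so the two events coincide
  -- up to a null set for each `M`.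
  filter_upwards [HDG.ae_forall_sample hYm hYl hsN.ae_eq_mk,
    HDG.ae_forall_sample hYm hYl hr_eq] with ω h1 h2
  have h1' : ∀ m, D.rbOutput uN φN (Y m ω) = t (Y m ω) := h1
  simp only [HDG.mcTotalBound, HDG.mcVar, HDG.mcVarBound, HDG.mcMean, h1', h2]
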